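/- Let $1<p<\infty$ and let $(X,d)$ be a complete, locally compact, separable metric space with a Radon measure $\mu$ that is doubling: there is $C_D$ with $0<\mu(B(x,2r))\le C_D\,\mu(B(x,r))<\infty$ for all $x\in X$, $r>0$. Balls $B=B(x,r)$ are open, $\lambda B=B(x,\lambda r)$, $f_B=\frac1{\mu(B)}\int_B f\,d\mu$, and only balls with radius $0<r\le 2\,\mathrm{diam}(X)$ are considered in the conditions below. Let $(X,d,\mu,\mathcal F_p,\Gamma_p)$ be a regular local $p$-Dirichlet space. That is, $\mathcal F_p$ is a linear subspace of $L^p(X,\mu)$; to each $f\in\mathcal F_p$ is associated a finite Borel measure $\Gamma_p\langle f\rangle$ on $X$, and with $\mathcal E_p(f)=\Gamma_p\langle f\rangle(X)$ we have: 1. $\mathcal F_p$ is complete in the norm $\|f\|_{\mathcal F_p}=(\|f\|_{L^p}^p+\mathcal E_p(f))^{1/p}$. 2. $\Gamma_p\langle\lambda f\rangle=|\lambda|^p\Gamma_p\langle f\rangle$ for $\lambda\in\mathbb R$. 3. $\Gamma_p\langle f+g\rangle(A)^{1/p}\le\Gamma_p\langle f\rangle(A)^{1/p}+\Gamma_p\langle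 g\rangle(A)^{1/p}$ for all Borel $A$. 4. If $g:\mathbb R\to\mathbb R$ is $K$-Lipschitz and $g(0)=0$, then $g\circ f\in\mathcal F_p$ and $\Gamma_p\langle g\circ f\rangle\le K^p\,\Gamma_p\langle f\rangle$. 5. If $f=c$ $\mu$-a.e. on an open set $A$, for a constant $c$, then $\Gamma_p\langle f\rangle(A)=0$. 6. If $f_i\in\mathcal F_p$, $f_i\to f$ in $L^p$ and $\sup_i\mathcal E_p(f_i)<\infty$, then $f\in\mathcal F_p$ and $\Gamma_p\langle f\rangle(A)\le\liminf_i\Gamma_p\langle f_i\rangle(A)$ for all Borel $A$. 7. $C_c(X)\cap\mathcal F_p$ is dense in $\mathcal F_p$ in the norm $\|\cdot\|_{\mathcal F_p}$ and in $C_c(X)$ in the supremum norm. For open $O\subset X$ let $\mathrm{Cap}(O)=\inf\{\|f\|_{\mathcal F_p}^p: f\in\mathcal F_p,\ f=1\text{ a.e. on }O\}$. A quasicontinuous representative of $f\in\mathcal F_p$ is a measurable $\tilde f:X\to[-\infty,\infty]$ with $\tilde f=f$ a.e. such that for every $\epsilon>0$ there is an open $O$ with $\mathrm{Cap}(O)<\epsilon$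 and $\tilde f|_{X\setminus O}$ continuous. Let $\Psi:X\times[0,\infty)\to[0,\infty)$ be a regular scale function: $\Psi(x,0)=0$, $\Psi(x,r)>0$ for $r>0$, and there are $C_\Psi,\beta_-,\beta_+>0$ such that for all $x,y\in X$, $0<s\le r\le2\,\mathrm{diam}(X)$, with $R=d(x,y)$, $$C_\Psi^{-1}\Big(\frac{r}{r\vee R}\Big)^{\beta_+}\Big(\frac{r\vee R}{s}\Big)^{\beta_-}\le\frac{\Psi(x,r)}{\Psi(y,s)}\le C_\Psi\Big(\frac{r}{r\vee R}\Big)^{\beta_-}\Big(\frac{r\vee R}{s}\Big)^{\beta_+}.$$ Assume: * ($\mathrm{Cap}_p(\Psi)$) there is $C_{\rm cap}>0$ such that for every ball $B=B(x,r)$ there is $\psi\in C(X)\cap\mathcal F_p$ with $\psi=1$ on $B$, $\psi=0$ on $X\setminus2B$ and $\Gamma_p\langle\psi\rangle(X)\le C_{\rm cap}\,\mu(B)/\Psi(x,r)$; * ($\mathrm{PI}_p(\Psi)$) there are $C_{\rm PI},\Lambda>0$ such that for every ball $B=B(x,r)$ and every $f\in\mathcal F_p$, $\frac1{\mu(B)}\int_B|f-f_B|^p\,d\mu\le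 C_{\rm PI}\frac{\Psi(x,r)}{\mu(B)}\Gamma_p\langle f\rangle(\Lambda B)$. Then the $p$-cutoff Sobolev inequality $\mathrm{CS}_p$ holds: there are constants $C,\Lambda\ge1$ such that for every ball $B$ there is $\psi_B\in\mathcal F_p$ with $\psi_B=1$ a.e. on $B$ and $\psi_B=0$ a.e. on $X\setminus2B$ such that, for every $f\in\mathcal F_p$ and every quasicontinuous representative $\tilde f$ of $f$, $$\int_{2B}|\tilde f-f_B|^p\,d\Gamma_p\langle\psi_B\rangle\le C\,\Gamma_p\langle f\rangle(\Lambda B).\qquad(*)$$ Moreover, harmonic cutoff functions serve: there are constants $C,\Lambda\ge1$ such that for every ball $B$ there exists a capacity minimizer, i.e. a function $\psi_B\in\mathcal F_p$ with $0\le\psi_B\le1$ a.e., $\psi_B=1$ a.e. on $B$, $\psi_B=0$ a.e. on $X\setminus 2B$, and $\mathcal E_p(\psi_B)\le\mathcal E_p(\phi)$ for every $\phi\in\mathcal F_p$ with $\phi=1$ a.e. on $B$ and $\phi=0$ a.e. on $X\setminus2B$; and $(*)$ holds for every capacity minimizer $\psi_B$. -/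

import Mathlib

open MeasureTheory Filter Topology Set
open scoped ENNReal NNReal

noncomputable section

/-- A regular local `p`-Dirichlet structure `(𝓕_p, Γ_p)` on a metric measure space `(X, d, μ)`.
The domain `𝓕_p` is a linear subspace of `L^p(X, μ)`; every `f ∈ 𝓕_p` has an energy measure
`Γ_p⟨f⟩`, and the energy of `f` is `𝓔_p(f) = Γ_p⟨f⟩(X)`, so that the norm is
`‖f‖_{𝓕_p} = (‖f‖_{L^p}^p + Γ_p⟨f⟩(X))^{1/p}`. -/
structure PDirichletStructure (X : Type*) [MetricSpace X] [MeasurableSpace X] [BorelSpace X]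
    (μ : Measure X) (p : ℝ) where
  /-- the domain `𝓕_p` -/
  dom : Submodule ℝ (Lp ℝ (ENNReal.ofReal p) μ)
  /-- the energy measures -/
  Γ : dom → Measure X
  /-- energy measures are finite -/
  finite : ∀ f : dom, Γ f univ < ∞
  /-- completeness of the norm `(‖f‖_{L^p}^p + 𝓔_p(f))^{1/p}` on the domain -/
  complete : ∀ u : ℕ → dom,
    (∀ ε : ℝ, 0 < ε → ∃ N : ℕ, ∀ m ≥ N, ∀ n ≥ N,
      (‖((u m - u n : dom) : Lp ℝ (ENNReal.ofReal p) μ)‖ ^ p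
        + (Γ (u m - u n) univ).toReal) ^ (1 / p) < ε) →
    ∃ f : dom, Tendsto (fun n : ℕ =>
      (‖((u n - f : dom) : Lp ℝ (ENNReal.ofReal p) μ)‖ ^ p
        + (Γ (u n - f) univ).toReal) ^ (1 / p)) atTop (𝓝 0)
  /-- homogeneity -/
  homogeneous : ∀ (c : ℝ) (f : dom), Γ (c • f) = ENNReal.ofReal (|c| ^ p) • Γ f
  /-- triangle inequality -/
  triangle : ∀ (f g : dom) (A : Set X), MeasurableSet A →
    (Γ (f + g) A) ^ (1 / p) ≤ (Γ f A) ^ (1 / p) + (Γ g A) ^ (1 / p)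
  /-- Lipschitz contractivity -/
  lipschitz : ∀ (f : dom) (K : ℝ≥0) (g : ℝ → ℝ) (hg : LipschitzWith K g) (h0 : g 0 = 0),
    ∃ h : hg.compLp h0 (f : Lp ℝ (ENNReal.ofReal p) μ) ∈ dom,
      Γ ⟨hg.compLp h0 (f : Lp ℝ (ENNReal.ofReal p) μ), h⟩ ≤ ((K : ℝ≥0∞) ^ p) • Γ f
  /-- strong locality -/
  strongLocal : ∀ (f : dom) (A : Set X) (c : ℝ), IsOpen A →
    (∀ᵐ x ∂(μ.restrict A), (f : Lp ℝ (ENNReal.ofReal p) μ) x = c) → Γ f A = 0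
  /-- weak lower semicontinuity -/
  lsc : ∀ (f : Lp ℝ (ENNReal.ofReal p) μ) (u : ℕ → dom),
    Tendsto (fun i : ℕ => ‖(u i : Lp ℝ (ENNReal.ofReal p) μ) - f‖) atTop (𝓝 0) →
    (∃ M : ℝ, ∀ i : ℕ, (Γ (u i) univ).toReal ≤ M) →
    ∃ h : f ∈ dom, ∀ A : Set X, MeasurableSet A →
      Γ ⟨f, h⟩ A ≤ liminf (fun i : ℕ => Γ (u i) A) atTop
  /-- regularity, part one: `C_c(X) ∩ 𝓕_p` is dense in `𝓕_p` -/
  denseDom : ∀ (f : dom) (ε : ℝ), 0 < ε → ∃ (g : dom) (φ : X → ℝ),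
    Continuous φ ∧ HasCompactSupport φ ∧ (g : Lp ℝ (ENNReal.ofReal p) μ) =ᵐ[μ] φ ∧
      (‖((f - g : dom) : Lp ℝ (ENNReal.ofReal p) μ)‖ ^ p
        + (Γ (f - g) univ).toReal) ^ (1 / p) < ε
  /-- regularity, part two: `C_c(X) ∩ 𝓕_p` is uniformly dense in `C_c(X)` -/
  denseCc : ∀ (η : X → ℝ), Continuous η → HasCompactSupport η → ∀ ε : ℝ, 0 < ε →
    ∃ (g : dom) (φ : X → ℝ),
      Continuous φ ∧ HasCompactSupport φ ∧ (g : Lp ℝ (ENNReal.ofReal p) μ) =ᵐ[μ] φ ∧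
      ∀ x : X, |η x - φ x| ≤ ε

/-- A doubling measure: balls have positive finite measure and
`μ(B(x,2r)) ≤ C μ(B(x,r))` with a uniform constant. -/
def IsDoublingMeasure {X : Type*} [MetricSpace X] [MeasurableSpace X] (μ : Measure X) : Prop :=
  ∃ C : ℝ≥0, ∀ (x : X) (r : ℝ), 0 < r →
    0 < μ (Metric.ball x r) ∧ μ (Metric.ball x r) < ∞ ∧
      μ (Metric.ball x (2 * r)) ≤ C * μ (Metric.ball x r)

/-- The radii under consideration: `0 < r ≤ 2 diam(X)`, where `diam(X)` may be infinite. -/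
def AdmissibleRadius (X : Type*) [MetricSpace X] (r : ℝ) : Prop :=
  0 < r ∧ ENNReal.ofReal r ≤ 2 * Metric.ediam (univ : Set X)

/-- Regular scale functions `Ψ(x, r)`; only `r ≥ 0` is relevant. -/
def IsRegularScale {X : Type*} [MetricSpace X] (Ψ : X → ℝ → ℝ) : Prop :=
  (∀ x : X, Ψ x 0 = 0) ∧ (∀ (x : X) (r : ℝ), 0 < r → 0 < Ψ x r) ∧
  ∃ C βm βp : ℝ, 0 < C ∧ 0 < βm ∧ 0 < βp ∧
    ∀ (x y : X) (s r : ℝ), 0 < s → s ≤ r → AdmissibleRadius X r →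
      C⁻¹ * (r / max r (dist x y)) ^ βp * (max r (dist x y) / s) ^ βm ≤ Ψ x r / Ψ y s ∧
      Ψ x r / Ψ y s ≤ C * (r / max r (dist x y)) ^ βm * (max r (dist x y) / s) ^ βp

namespace PDirichletStructure

variable {X : Type*} [MetricSpace X] [MeasurableSpace X] [BorelSpace X] {μ : Measure X} {p : ℝ}

/-- `Cap(O) = inf { ‖f‖_{𝓕_p}^p : f ∈ 𝓕_p, f = 1 a.e. on O }`, for open sets `O`. -/
def openCap (D : PDirichletStructure X μ p) (O : Set X) : ℝ≥0∞ :=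
  ⨅ (f : D.dom) (_ : ∀ᵐ x ∂(μ.restrict O), (f : Lp ℝ (ENNReal.ofReal p) μ) x = 1),
    ENNReal.ofReal (‖(f : Lp ℝ (ENNReal.ofReal p) μ)‖ ^ p) + D.Γ f univ

/-- `F : X → [-∞, ∞]` is a quasicontinuous representative of `f ∈ 𝓕_p`. -/
def IsQuasicontinuousRep (D : PDirichletStructure X μ p) (f : D.dom) (F : X → EReal) : Prop :=
  Measurable F ∧
  (∀ᵐ x ∂μ, F x = (((f : Lp ℝ (ENNReal.ofReal p) μ) x : ℝ) : EReal)) ∧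
  ∀ ε : ℝ≥0∞, 0 < ε → ∃ O : Set X, IsOpen O ∧ D.openCap O < ε ∧ ContinuousOn F Oᶜ

/-- The capacity upper bound `Cap_p(Ψ)`. -/
def CapUpperBound (D : PDirichletStructure X μ p) (Ψ : X → ℝ → ℝ) : Prop :=
  ∃ C : ℝ, 0 < C ∧ ∀ (x : X) (r : ℝ), AdmissibleRadius X r →
    ∃ (ψ : D.dom) (φ : X → ℝ), Continuous φ ∧ (ψ : Lp ℝ (ENNReal.ofReal p) μ) =ᵐ[μ] φ ∧
      (∀ y ∈ Metric.ball x r, φ y = 1) ∧ (∀ y ∉ Metric.ball x (2 * r), φ y = 0) ∧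
      D.Γ ψ univ ≤ ENNReal.ofReal C * (μ (Metric.ball x r) / ENNReal.ofReal (Ψ x r))

/-- The Poincaré inequality `PI_p(Ψ)`. -/
def Poincare (D : PDirichletStructure X μ p) (Ψ : X → ℝ → ℝ) : Prop :=
  ∃ C Λ : ℝ, 0 < C ∧ 0 < Λ ∧ ∀ (x : X) (r : ℝ), AdmissibleRadius X r → ∀ f : D.dom,
    ⨍⁻ y in Metric.ball x r, ENNReal.ofReal (|(f : Lp ℝ (ENNReal.ofReal p) μ) y
        - ⨍ z in Metric.ball x r, (f : Lp ℝ (ENNReal.ofReal p) μ) z ∂μ| ^ p) ∂μ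
      ≤ ENNReal.ofReal C * (ENNReal.ofReal (Ψ x r) / μ (Metric.ball x r))
        * D.Γ f (Metric.ball x (Λ * r))

/-- `ψ ∈ 𝓕_p` satisfies `ψ = 1` on `B(x,r)` and `ψ = 0` on `X ∖ B(x,2r)` (almost everywhere). -/
def IsCutoff (D : PDirichletStructure X μ p) (x : X) (r : ℝ) (ψ : D.dom) : Prop :=
  (∀ᵐ y ∂μ, y ∈ Metric.ball x r → (ψ : Lp ℝ (ENNReal.ofReal p) μ) y = 1) ∧
  (∀ᵐ y ∂μ, y ∉ Metric.ball x (2 * r) → (ψ : Lp ℝ (ENNReal.ofReal p) μ) y = 0)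

/-- `ψ` is a capacity minimizer for the pair `B(x,r) ⊂ B(x,2r)`, i.e. a harmonic cutoff
function: it takes values in `[0,1]`, and it has the least energy among all cutoff functions,
that is, `𝓔_p(ψ) ≤ 𝓔_p(ψ + η)` for all `η ∈ 𝓕_p` vanishing outside `B(x,2r) ∖ B(x,r)`. -/
def IsCapacityMinimizer (D : PDirichletStructure X μ p) (x : X) (r : ℝ) (ψ : D.dom) : Prop :=
  D.IsCutoff x r ψ ∧
  (∀ᵐ y ∂μ, (ψ : Lp ℝ (ENNReal.ofReal p) μ) y ∈ Icc (0 : ℝ) 1) ∧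
  ∀ φ : D.dom, D.IsCutoff x r φ → D.Γ ψ univ ≤ D.Γ φ univ

/-- The inequality `∫_{2B} |f̃ - f_B|^p dΓ_p⟨ψ⟩ ≤ C Γ_p⟨f⟩(ΛB)` on the ball `B = B(x,r)`, for all
`f ∈ 𝓕_p` and all quasicontinuous representatives `f̃` of `f`. -/
def CutoffInequality (D : PDirichletStructure X μ p) (C Λ : ℝ) (x : X) (r : ℝ)
    (ψ : D.dom) : Prop :=
  ∀ (f : D.dom) (F : X → EReal), D.IsQuasicontinuousRep f F →
    ∫⁻ y in Metric.ball x (2 * r),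
        (F y - ((⨍ z in Metric.ball x r, (f : Lp ℝ (ENNReal.ofReal p) μ) z ∂μ : ℝ) : EReal)).abs ^ p
        ∂(D.Γ ψ)
      ≤ ENNReal.ofReal C * D.Γ f (Metric.ball x (Λ * r))

/-- The `p`-cutoff Sobolev inequality `CS_p`. -/
def CutoffSobolev (D : PDirichletStructure X μ p) : Prop :=
  ∃ C Λ : ℝ, 1 ≤ C ∧ 1 ≤ Λ ∧ ∀ (x : X) (r : ℝ), AdmissibleRadius X r →
    ∃ ψ : D.dom, D.IsCutoff x r ψ ∧ D.CutoffInequality C Λ x r ψ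

end PDirichletStructure

end

noncomputable section

/-! No Leibniz or chain rule is available for `Γ`, so `(*)` cannot be reached by differentiating a
product. The proof uses only lattice operations, strong locality and lower semicontinuity of energy.

Minimality turns capacity into a bound for an energy measure. Let `ψ` be a capacity minimizer for `B
⊂ 2B`, and let `k` take values in `[0,1]` and vanish outside `2B` or on `B`. Then `max ψ k`,
respectively `min ψ (1 - k)`, is again a cutoff. Its energy measure is at most `Γ ψ + Γ k`, and it
has no energy where `k = 1`, being constant there. Comparison with `ψ` leaves `Γ ψ {k = 1} ≤ 𝓔 k`
(`Γ_minimizer_le`). Applied to the rescaled dyadic slices of a function `g` of the same kind, whose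
energies sum to at most `𝓔 g`, this gives `∫ |g|^p dΓ ψ ≤ 4^p 𝓔 g` (`setLIntegral_minimizer_le`).
Since `Γ ψ` may charge `μ`-null sets, quasicontinuity is essential: superlevel sets of `F` are open
up to sets of small capacity, and strong locality survives that error (`Γ_eq_zero_of_quasi_open`).

It remains to realize `f - f_B` locally by such a `g` with `𝓔 g ≤ C Γ f (ΛB)`. Multiplying by a
cutoff would presuppose an inequality like `(*)`. Instead `exists_blend` replaces `f - c` by a sum
of local averages times a partition of unity, on a mesh that is fine in `B(x, a)` and coarsens to
size comparable to `ρ` at distance `ρ`, where the coefficients are switched to zero. Poincaré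
controls differences of neighbouring averages, the capacity bound controls the partition functions,
and the switch costs only `∫ |f - c|^p / Ψ`, which for `c = f_B` is absorbed by Poincaré
(`exists_localEnergy_le`). One blend handles `3/2 B`, a difference of two handles `2B` minus the
closed ball `5/4 B`, and these two sets cover `2B` (`exists_cutoffInequality`).

Rellich compactness, itself a consequence of Poincaré and doubling (`exists_subseq_tendsto`),
together with lower semicontinuity provides both the minimizers and the limit of the blends as the
mesh size tends to zero. -/

theorem ENNReal.liminf_add_liminf_le (u v : ℕ → ℝ≥0∞) :
    liminf u atTop + liminf v atTop ≤ liminf (fun n => u n + v n) atTop := by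
  simp only [liminf_eq_iSup_iInf_of_nat]
  rw [ENNReal.iSup_add_iSup_of_monotone]
  · refine iSup_mono fun n => le_iInf₂ fun i hi => ?_
    exact add_le_add (iInf₂_le i hi) (iInf₂_le i hi)
  · intro a b hab
    exact le_iInf₂ fun i hi => iInf₂_le i (hab.trans hi)
  · intro a b hab
    exact le_iInf₂ fun i hi => iInf₂_le i (hab.trans hi)

namespace PDirichletStructure

variable {X : Type*} [MetricSpace X] [MeasurableSpace X] [BorelSpace X] {μ : Measure X} {p : ℝ}

/-! ### Elementary calculus of energy measures. -/

section Calculus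

variable (D : PDirichletStructure X μ p)

/-- The composition `g ∘ f ∈ 𝓕_p` with a Lipschitz function `g` vanishing at `0`. -/
def comp (f : D.dom) {K : ℝ≥0} {g : ℝ → ℝ} (hg : LipschitzWith K g) (h0 : g 0 = 0) : D.dom :=
  ⟨hg.compLp h0 (f : Lp ℝ (ENNReal.ofReal p) μ), (D.lipschitz f K g hg h0).choose⟩

theorem coeFn_comp (f : D.dom) {K : ℝ≥0} {g : ℝ → ℝ} (hg : LipschitzWith K g) (h0 : g 0 = 0) :
    ∀ᵐ x ∂μ, (D.comp f hg h0 : Lp ℝ (ENNReal.ofReal p) μ) x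
      = g ((f : Lp ℝ (ENNReal.ofReal p) μ) x) :=
  hg.coeFn_compLp h0 _

theorem Γ_comp_le (f : D.dom) {K : ℝ≥0} {g : ℝ → ℝ} (hg : LipschitzWith K g) (h0 : g 0 = 0)
    (A : Set X) : D.Γ (D.comp f hg h0) A ≤ (K : ℝ≥0∞) ^ p * D.Γ f A :=
  (D.lipschitz f K g hg h0).choose_spec A

theorem Γ_comp_le_of_one (f : D.dom) {g : ℝ → ℝ} (hg : LipschitzWith 1 g) (h0 : g 0 = 0)
    (A : Set X) : D.Γ (D.comp f hg h0) A ≤ D.Γ f A := by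
  simpa using D.Γ_comp_le f hg h0 A

theorem Γ_ne_top (f : D.dom) (A : Set X) : D.Γ f A ≠ ∞ :=
  ((measure_mono (subset_univ A)).trans_lt (D.finite f)).ne

theorem coeFn_add (f g : D.dom) : ∀ᵐ x ∂μ, ((f + g : D.dom) : Lp ℝ (ENNReal.ofReal p) μ) x
    = (f : Lp ℝ (ENNReal.ofReal p) μ) x + (g : Lp ℝ (ENNReal.ofReal p) μ) x :=
  Lp.coeFn_add _ _

theorem coeFn_sub (f g : D.dom) : ∀ᵐ x ∂μ, ((f - g : D.dom) : Lp ℝ (ENNReal.ofReal p) μ) x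
    = (f : Lp ℝ (ENNReal.ofReal p) μ) x - (g : Lp ℝ (ENNReal.ofReal p) μ) x :=
  Lp.coeFn_sub _ _

theorem coeFn_neg (f : D.dom) : ∀ᵐ x ∂μ, ((-f : D.dom) : Lp ℝ (ENNReal.ofReal p) μ) x
    = -(f : Lp ℝ (ENNReal.ofReal p) μ) x :=
  Lp.coeFn_neg _

theorem coeFn_smul (c : ℝ) (f : D.dom) :
    ∀ᵐ x ∂μ, ((c • f : D.dom) : Lp ℝ (ENNReal.ofReal p) μ) x
    = c * (f : Lp ℝ (ENNReal.ofReal p) μ) x :=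
  Lp.coeFn_smul _ _

theorem coeFn_sum {ι : Type*} (s : Finset ι) (u : ι → D.dom) :
    ∀ᵐ x ∂μ, ((∑ i ∈ s, u i : D.dom) : Lp ℝ (ENNReal.ofReal p) μ) x
      = ∑ i ∈ s, (u i : Lp ℝ (ENNReal.ofReal p) μ) x := by
  classical
  induction s using Finset.induction_on with
  | empty =>
    filter_upwards [Lp.coeFn_zero ℝ (ENNReal.ofReal p) μ] with x hx
    simpa using hx
  | insert a s ha ih =>
    rw [Finset.sum_insert ha]
    filter_upwards [D.coeFn_add (u a) (∑ i ∈ s, u i), ih] with x h1 h2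
    rw [h1, h2, Finset.sum_insert ha]

theorem lipschitzWith_excess (κ : ℝ≥0) : LipschitzWith 1 fun s : ℝ => max (s - κ) 0 := by
  refine LipschitzWith.of_dist_le_mul fun a b => ?_
  simp only [NNReal.coe_one, one_mul, Real.dist_eq]
  exact (abs_max_sub_max_le_abs _ _ _).trans (by simp)

/-- The truncation `(f - κ)₊` for `κ ≥ 0`. -/
def excess (f : D.dom) (κ : ℝ≥0) : D.dom :=
  D.comp f (lipschitzWith_excess κ) (by simp)

theorem coeFn_excess (f : D.dom) (κ : ℝ≥0) :
    ∀ᵐ x ∂μ, (D.excess f κ : Lp ℝ (ENNReal.ofReal p) μ) x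
      = max ((f : Lp ℝ (ENNReal.ofReal p) μ) x - κ) 0 :=
  D.coeFn_comp f _ _

theorem Γ_excess_le (f : D.dom) (κ : ℝ≥0) (A : Set X) : D.Γ (D.excess f κ) A ≤ D.Γ f A :=
  D.Γ_comp_le_of_one f _ _ A

theorem Γ_smul (c : ℝ) (f : D.dom) (A : Set X) :
    D.Γ (c • f) A = ENNReal.ofReal (|c| ^ p) * D.Γ f A := by
  rw [D.homogeneous]; rfl

theorem Γ_neg (f : D.dom) (A : Set X) : D.Γ (-f) A = D.Γ f A := by
  rw [← neg_one_smul ℝ f, Γ_smul]; simp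

theorem Γ_zero (hp : 0 < p) (A : Set X) : D.Γ 0 A = 0 := by
  rw [← zero_smul ℝ (0 : D.dom), Γ_smul]; simp [Real.zero_rpow hp.ne']

theorem Γ_add_of_eq_zero (hp : 0 < p) {f g : D.dom} {A : Set X} (hA : MeasurableSet A)
    (h : D.Γ g A = 0) : D.Γ (f + g) A ≤ D.Γ f A := by
  have := D.triangle f g A hA
  rw [h, ENNReal.zero_rpow_of_pos (by positivity), add_zero] at this
  exact (ENNReal.rpow_le_rpow_iff (by positivity)).1 this

theorem Γ_le_of_sub_eq_zero (hp : 0 < p) {f g : D.dom} {A : Set X} (hA : MeasurableSet A)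
    (h : D.Γ (f - g) A = 0) : D.Γ f A ≤ D.Γ g A := by
  have := D.Γ_add_of_eq_zero hp (f := g) (g := f - g) hA h
  simpa using this

theorem Γ_sub_comm (f g : D.dom) (A : Set X) : D.Γ (f - g) A = D.Γ (g - f) A := by
  rw [← Γ_neg, neg_sub]

theorem Γ_add_le (hp : 1 ≤ p) (f g : D.dom) {A : Set X} (hA : MeasurableSet A) :
    D.Γ (f + g) A ≤ 2 ^ (p - 1) * (D.Γ f A + D.Γ g A) := by
  have h := ENNReal.rpow_le_rpow (D.triangle f g A hA) (by linarith : (0 : ℝ) ≤ p)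
  have h2 := ENNReal.rpow_add_le_mul_rpow_add_rpow (D.Γ f A ^ (1 / p)) (D.Γ g A ^ (1 / p)) hp
  have hp0 : p ≠ 0 := by linarith
  simp only [← ENNReal.rpow_mul, one_div, inv_mul_cancel₀ hp0, ENNReal.rpow_one] at h h2
  exact h.trans h2

theorem Γ_sub_le (hp : 1 ≤ p) (f g : D.dom) {A : Set X} (hA : MeasurableSet A) :
    D.Γ (f - g) A ≤ 2 ^ (p - 1) * (D.Γ f A + D.Γ g A) := by
  rw [sub_eq_add_neg, ← D.Γ_neg g]
  exact D.Γ_add_le hp _ _ hA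

theorem Γ_sum_rpow_le (hp : 0 < p) {ι : Type*} (s : Finset ι) (u : ι → D.dom) {A : Set X}
    (hA : MeasurableSet A) :
    D.Γ (∑ i ∈ s, u i) A ^ (1 / p) ≤ ∑ i ∈ s, D.Γ (u i) A ^ (1 / p) := by
  classical
  induction s using Finset.induction_on with
  | empty => simp [D.Γ_zero hp, hp]
  | insert a s ha ih =>
    rw [Finset.sum_insert ha, Finset.sum_insert ha]
    exact (D.triangle _ _ A hA).trans (by gcongr)

theorem Γ_sum_le (hp : 1 ≤ p) {ι : Type*} (s : Finset ι) (u : ι → D.dom) {A : Set X}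
    (hA : MeasurableSet A) :
    D.Γ (∑ i ∈ s, u i) A ≤ (s.card : ℝ≥0∞) ^ (p - 1) * ∑ i ∈ s, D.Γ (u i) A := by
  have hp0 : 0 < p := by linarith
  have h := ENNReal.rpow_le_rpow (D.Γ_sum_rpow_le hp0 s u hA) hp0.le
  have h2 := ENNReal.rpow_sum_le_const_mul_sum_rpow s (fun i => D.Γ (u i) A ^ (1 / p)) hp
  simp only [← ENNReal.rpow_mul, one_div, inv_mul_cancel₀ hp0.ne', ENNReal.rpow_one] at h h2
  exact h.trans h2

/-- Strong locality for functions that are constant on an open set. -/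
theorem Γ_eq_zero_of_ae_eq {f : D.dom} {U A : Set X} (hU : IsOpen U) (hA : A ⊆ U) (c : ℝ)
    (h : ∀ᵐ x ∂μ, x ∈ U → (f : Lp ℝ (ENNReal.ofReal p) μ) x = c) : D.Γ f A = 0 :=
  measure_mono_null hA (D.strongLocal f U c hU ((ae_restrict_iff' hU.measurableSet).2 h))

theorem Γ_le_liminf {f : D.dom} {u : ℕ → D.dom}
    (hu : Tendsto (fun i => ‖(u i : Lp ℝ (ENNReal.ofReal p) μ) - f‖) atTop (𝓝 0))
    {M : ℝ≥0∞} (hM : M ≠ ∞) (hb : ∀ i, D.Γ (u i) univ ≤ M) {A : Set X} (hA : MeasurableSet A) :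
    D.Γ f A ≤ liminf (fun i => D.Γ (u i) A) atTop := by
  obtain ⟨h, h2⟩ := D.lsc f u hu ⟨M.toReal, fun i => ENNReal.toReal_mono hM (hb i)⟩
  exact h2 A hA

/-- Convergence in the norm of `𝓕_p`. -/
def Converges (u : ℕ → D.dom) (f : D.dom) : Prop :=
  Tendsto (fun n => ‖(u n : Lp ℝ (ENNReal.ofReal p) μ) - f‖) atTop (𝓝 0) ∧
    Tendsto (fun n => D.Γ (u n - f) univ) atTop (𝓝 0)

variable {D}

/-- For each Borel `A`, the map `f ↦ Γ f A ^ (1/p)` is a seminorm dominated by the root of the total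
energy. The triangle inequality in both directions squeezes it. -/
theorem Converges.tendsto_Γ (hp : 0 < p) {u : ℕ → D.dom} {f : D.dom} (h : D.Converges u f)
    {A : Set X} (hA : MeasurableSet A) : Tendsto (fun n => D.Γ (u n) A) atTop (𝓝 (D.Γ f A)) := by
  have hz : Tendsto (fun n => D.Γ (u n - f) A ^ (1 / p)) atTop (𝓝 0) := by
    have h1 : Tendsto (fun n => D.Γ (u n - f) A) atTop (𝓝 0) :=
      tendsto_of_tendsto_of_tendsto_of_le_of_le tendsto_const_nhds h.2 (fun _ => zero_le)
        (fun n => measure_mono (subset_univ A))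
    have h2 := h1.ennrpow_const (1 / p)
    rwa [ENNReal.zero_rpow_of_pos (by positivity)] at h2
  have hroot : Tendsto (fun n => D.Γ (u n) A ^ (1 / p)) atTop (𝓝 (D.Γ f A ^ (1 / p))) := by
    have hne : D.Γ f A ^ (1 / p) ≠ ∞ :=
      ENNReal.rpow_ne_top_of_nonneg (by positivity) (D.Γ_ne_top f A)
    have hup : Tendsto (fun n => D.Γ f A ^ (1 / p) + D.Γ (u n - f) A ^ (1 / p)) atTop
        (𝓝 (D.Γ f A ^ (1 / p))) := by
      simpa using tendsto_const_nhds.add hz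
    have hlo : Tendsto (fun n => D.Γ f A ^ (1 / p) - D.Γ (u n - f) A ^ (1 / p)) atTop
        (𝓝 (D.Γ f A ^ (1 / p))) := by
      simpa using ENNReal.Tendsto.sub (tendsto_const_nhds (x := D.Γ f A ^ (1 / p))) hz (Or.inl hne)
    refine tendsto_of_tendsto_of_tendsto_of_le_of_le hlo hup (fun n => ?_) (fun n => ?_)
    · have := D.triangle (u n) (f - u n) A hA
      rw [add_sub_cancel, D.Γ_sub_comm f] at this
      exact tsub_le_iff_right.2 this
    · have := D.triangle f (u n - f) A hA
      rwa [add_sub_cancel] at this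
  have := hroot.ennrpow_const p
  simpa only [← ENNReal.rpow_mul, one_div, inv_mul_cancel₀ hp.ne', ENNReal.rpow_one] using this

theorem Converges.subseq {u : ℕ → D.dom} {f : D.dom} (h : D.Converges u f) {φ : ℕ → ℕ}
    (hφ : Tendsto φ atTop atTop) : D.Converges (fun n => u (φ n)) f :=
  ⟨h.1.comp hφ, h.2.comp hφ⟩

theorem Converges.exists_bound (hp : 0 < p) {u : ℕ → D.dom} {f : D.dom} (h : D.Converges u f) :
    ∃ N : ℕ, ∀ n, D.Γ (u (n + N)) univ ≤ D.Γ f univ + 1 := by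
  have h1 := h.tendsto_Γ hp MeasurableSet.univ
  have h2 : ∀ᶠ n in atTop, D.Γ (u n) univ < D.Γ f univ + 1 :=
    h1.eventually (gt_mem_nhds (ENNReal.lt_add_right (D.Γ_ne_top f _) one_ne_zero))
  obtain ⟨N, hN⟩ := eventually_atTop.1 h2
  exact ⟨N, fun n => (hN _ (by omega)).le⟩

variable (D)

/-- `f ∈ 𝓕_p` is represented by a continuous function with compact support. -/
def IsCc (f : D.dom) (φ : X → ℝ) : Prop :=
  Continuous φ ∧ HasCompactSupport φ ∧ ∀ᵐ x ∂μ, (f : Lp ℝ (ENNReal.ofReal p) μ) x = φ x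

/-- Energies converge along an approximating sequence, so dropping finitely many terms gives the
uniform bound that lower semicontinuity requires. -/
theorem exists_converges_isCc [Fact (1 ≤ ENNReal.ofReal p)] (hp : 0 < p) (f : D.dom) :
    ∃ (u : ℕ → D.dom) (φ : ℕ → X → ℝ), (∀ n, D.IsCc (u n) (φ n)) ∧ D.Converges u f ∧
      ∀ n, D.Γ (u n) univ ≤ D.Γ f univ + 1 := by
  choose g φ h1 h2 h3 h4 using fun n : ℕ => D.denseDom f (1 / ((n : ℝ) + 1)) (by positivity)
  have hconv : D.Converges g f := by
    have hlim : Tendsto (fun n : ℕ => 1 / ((n : ℝ) + 1)) atTop (𝓝 0) :=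
      tendsto_one_div_add_atTop_nhds_zero_nat
    refine ⟨?_, ?_⟩
    · refine squeeze_zero (fun _ => norm_nonneg _) (fun n => ?_) hlim
      refine le_trans ?_ (h4 n).le
      have hn : ‖(g n : Lp ℝ (ENNReal.ofReal p) μ) - f‖
          = ‖((f - g n : D.dom) : Lp ℝ (ENNReal.ofReal p) μ)‖ := by
        rw [norm_sub_rev]; rfl
      rw [hn]
      calc _ = (‖((f - g n : D.dom) : Lp ℝ (ENNReal.ofReal p) μ)‖ ^ p) ^ (1 / p) := by
            rw [← Real.rpow_mul (norm_nonneg _), mul_one_div_cancel hp.ne', Real.rpow_one]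
        _ ≤ _ := by
            apply Real.rpow_le_rpow (by positivity) _ (by positivity)
            exact le_add_of_nonneg_right ENNReal.toReal_nonneg
    · have hreal : Tendsto (fun n => (D.Γ (g n - f) univ).toReal) atTop (𝓝 0) := by
        have hlim2 : Tendsto (fun n : ℕ => (1 / ((n : ℝ) + 1)) ^ p) atTop (𝓝 0) := by
          have := hlim.rpow_const (p := p) (Or.inr hp.le)
          rwa [Real.zero_rpow hp.ne'] at this
        refine squeeze_zero (fun _ => ENNReal.toReal_nonneg) (fun n => ?_) hlim2
        have hb : 0 ≤ ‖((f - g n : D.dom) : Lp ℝ (ENNReal.ofReal p) μ)‖ ^ p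
          + (D.Γ (f - g n) univ).toReal := by positivity
        have h5 := Real.rpow_le_rpow (by positivity) (h4 n).le hp.le
        rw [← Real.rpow_mul hb, one_div_mul_cancel hp.ne', Real.rpow_one] at h5
        rw [D.Γ_sub_comm]
        exact le_trans (le_add_of_nonneg_left (by positivity)) h5
      have := ENNReal.tendsto_ofReal hreal
      simpa [ENNReal.ofReal_toReal (D.Γ_ne_top _ _)] using this
  obtain ⟨N, hN⟩ := hconv.exists_bound hp
  exact ⟨fun n => g (n + N), fun n => φ (n + N), fun n => ⟨h1 _, h2 _, h3 _⟩,
    hconv.subseq (tendsto_add_atTop_nat N), hN⟩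

end Calculus

end PDirichletStructure

namespace PDirichletStructure

variable {X : Type*} [MetricSpace X] [MeasurableSpace X] [BorelSpace X] {μ : Measure X} {p : ℝ}

/-! ### Truncations and lattice operations. -/

section Truncation

variable (D : PDirichletStructure X μ p)

/-- Soft thresholding collapses `[t - ε, t + ε]` to a point and moves all other values by `ε`
towards `t`. Subtracting the value at `0` normalizes the function so that composition preserves the
domain. -/
theorem lipschitzWith_softThreshold {ε : ℝ} (hε : 0 ≤ ε) (t : ℝ) :
    LipschitzWith 1 fun s : ℝ =>
      (max (s - t - ε) 0 + min (s - t + ε) 0) - (max (-t - ε) 0 + min (-t + ε) 0) := by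
  refine LipschitzWith.of_le_add fun a b => ?_
  rw [Real.dist_eq]
  have h1 := le_abs_self (a - b)
  have h2 := neg_le_abs (a - b)
  rcases max_cases (a - t - ε) 0 with h3 | h3 <;> rcases max_cases (b - t - ε) 0 with h4 | h4 <;>
  rcases min_cases (a - t + ε) 0 with h5 | h5 <;> rcases min_cases (b - t + ε) 0 with h6 | h6 <;>
  linarith

/-- Soft thresholding at `t` makes the function constant on an open neighbourhood of the level set
without raising its energy. Strong locality kills the energy of the approximations there, and lower
semicontinuity passes this to `f`. -/
theorem Γ_levelSet_eq_zero [Fact (1 ≤ ENNReal.ofReal p)] [IsFiniteMeasureOnCompacts μ]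
    {f : D.dom} {φ : X → ℝ} (hf : D.IsCc f φ) (t : ℝ) : D.Γ f {x | φ x = t} = 0 := by
  set ε : ℕ → ℝ := fun n => 1 / ((n : ℝ) + 1) with hεdef
  have hε : ∀ n, 0 < ε n := fun n => by positivity
  set u : ℕ → D.dom := fun n => D.comp f (lipschitzWith_softThreshold (hε n).le t) (by simp)
    with hu
  have hK : IsCompact (tsupport φ) := hf.2.1
  -- The normalized threshold moves values by at most `2ε` and fixes `0`, so the error is bounded by
  -- `2ε` times the indicator of the compact support.
  have hconv : Tendsto (fun n => ‖(u n : Lp ℝ (ENNReal.ofReal p) μ) - f‖) atTop (𝓝 0) := by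
    have hlim : Tendsto (fun n => 2 * ε n * μ.real (tsupport φ) ^ (1 / (ENNReal.ofReal p).toReal))
        atTop (𝓝 0) := by
      have := (tendsto_one_div_add_atTop_nhds_zero_nat (𝕜 := ℝ)).const_mul 2
      simpa [hεdef] using this.mul_const (μ.real (tsupport φ) ^ (1 / (ENNReal.ofReal p).toReal))
    refine squeeze_zero (fun _ => norm_nonneg _) (fun n => ?_) hlim
    have hp0 : ENNReal.ofReal p ≠ 0 := fun h => by
      have := (Fact.out : 1 ≤ ENNReal.ofReal p); simp [h] at this
    have hind := norm_indicatorConstLp (μ := μ) (c := 2 * ε n) (s := tsupport φ)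
      (hs := hK.isClosed.measurableSet) (hμs := hK.measure_lt_top.ne) hp0 ENNReal.ofReal_ne_top
    rw [Real.norm_of_nonneg (by linarith [hε n])] at hind
    rw [← hind]
    refine Lp.norm_le_norm_of_ae_le ?_
    filter_upwards [Lp.coeFn_sub (u n : Lp ℝ (ENNReal.ofReal p) μ) f,
      D.coeFn_comp f (lipschitzWith_softThreshold (hε n).le t) (by simp), hf.2.2,
      indicatorConstLp_coeFn (p := ENNReal.ofReal p) (μ := μ) (c := 2 * ε n)
        (hs := hK.isClosed.measurableSet) (hμs := hK.measure_lt_top.ne)] with x h1 h2 h3 h4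
    rw [h1, h4, Pi.sub_apply, h2, h3]
    by_cases hx : x ∈ tsupport φ
    · rw [indicator_of_mem hx, Real.norm_eq_abs, Real.norm_of_nonneg (by linarith [hε n]),
        abs_le]
      have hεn := hε n
      rcases max_cases (φ x - t - ε n) 0 with h3 | h3 <;>
      rcases min_cases (φ x - t + ε n) 0 with h4 | h4 <;>
      rcases max_cases (- t - ε n) 0 with h5 | h5 <;>
      rcases min_cases (- t + ε n) 0 with h6 | h6 <;>
      constructor <;> linarith
    · rw [image_eq_zero_of_notMem_tsupport hx]; simp
  have hmeas : MeasurableSet {x | φ x = t} :=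
    (isClosed_eq hf.1 continuous_const).measurableSet
  have hle := D.Γ_le_liminf hconv (D.Γ_ne_top f univ)
    (fun n => D.Γ_comp_le_of_one f _ _ univ) hmeas
  refine le_antisymm (hle.trans_eq ?_) zero_le
  have hz : ∀ n, D.Γ (u n) {x | φ x = t} = 0 := by
    intro n
    refine D.Γ_eq_zero_of_ae_eq (U := {x | |φ x - t| < ε n})
      (isOpen_lt ((hf.1.sub continuous_const).abs) continuous_const) ?_
      (-(max (-t - ε n) 0 + min (-t + ε n) 0)) ?_
    · intro x hx
      simp only [mem_ofPred_eq] at hx ⊢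
      simpa [hx] using hε n
    · filter_upwards [D.coeFn_comp f (lipschitzWith_softThreshold (hε n).le t) (by simp),
        hf.2.2] with x h1 h2 hx
      rw [h1, h2]
      have h3 := abs_lt.1 hx
      rw [max_eq_right (by linarith [h3.2]), min_eq_right (by linarith [h3.1])]
      ring
  simp [hz]

theorem IsCc.add {D : PDirichletStructure X μ p} {u v : D.dom} {φ η : X → ℝ}
    (hu : D.IsCc u φ) (hv : D.IsCc v η) : D.IsCc (u + v) (fun x => φ x + η x) := by
  refine ⟨hu.1.add hv.1, hu.2.1.add hv.2.1, ?_⟩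
  filter_upwards [D.coeFn_add u v, hu.2.2, hv.2.2] with x h1 h2 h3
  rw [h1, h2, h3]

/-- The function `min (u, κ - v) = u - (u + v - κ)₊`. -/
def capped (u v : D.dom) (κ : ℝ≥0) : D.dom := u - D.excess (u + v) κ

theorem coeFn_capped (u v : D.dom) (κ : ℝ≥0) :
    ∀ᵐ x ∂μ, (D.capped u v κ : Lp ℝ (ENNReal.ofReal p) μ) x
      = min ((u : Lp ℝ (ENNReal.ofReal p) μ) x) (κ - (v : Lp ℝ (ENNReal.ofReal p) μ) x) := by
  filter_upwards [D.coeFn_sub u (D.excess (u + v) κ), D.coeFn_excess (u + v) κ,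
    D.coeFn_add u v] with x h1 h2 h3
  rw [capped, h1, h2, h3]
  rcases le_total ((u : Lp ℝ (ENNReal.ofReal p) μ) x) (κ - (v : Lp ℝ (ENNReal.ofReal p) μ) x)
    with h | h
  · rw [min_eq_left h, max_eq_right (by linarith)]; ring
  · rw [min_eq_right h, max_eq_left (by linarith)]; ring

variable [Fact (1 ≤ ENNReal.ofReal p)]

theorem tendsto_excess {u : ℕ → D.dom} {f : D.dom}
    (h : Tendsto (fun n => ‖(u n : Lp ℝ (ENNReal.ofReal p) μ) - f‖) atTop (𝓝 0)) (κ : ℝ≥0) :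
    Tendsto (fun n => ‖(D.excess (u n) κ : Lp ℝ (ENNReal.ofReal p) μ) - D.excess f κ‖)
      atTop (𝓝 0) := by
  refine squeeze_zero (fun _ => norm_nonneg _) (fun n => ?_) h
  have := (lipschitzWith_excess κ).norm_compLp_sub_le (p := ENNReal.ofReal p) (μ := μ)
    (by simp) (u n) f
  rw [NNReal.coe_one, one_mul] at this
  exact this

theorem tendsto_add {u v : ℕ → D.dom} {f g : D.dom}
    (hu : Tendsto (fun n => ‖(u n : Lp ℝ (ENNReal.ofReal p) μ) - f‖) atTop (𝓝 0))
    (hv : Tendsto (fun n => ‖(v n : Lp ℝ (ENNReal.ofReal p) μ) - g‖) atTop (𝓝 0)) :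
    Tendsto (fun n => ‖((u n + v n : D.dom) : Lp ℝ (ENNReal.ofReal p) μ) - (f + g : D.dom)‖)
      atTop (𝓝 0) := by
  have := hu.add hv
  rw [add_zero] at this
  refine squeeze_zero (fun _ => norm_nonneg _) (fun n => ?_) this
  push_cast
  rw [add_sub_add_comm]
  exact norm_add_le _ _

theorem tendsto_sub {u v : ℕ → D.dom} {f g : D.dom}
    (hu : Tendsto (fun n => ‖(u n : Lp ℝ (ENNReal.ofReal p) μ) - f‖) atTop (𝓝 0))
    (hv : Tendsto (fun n => ‖(v n : Lp ℝ (ENNReal.ofReal p) μ) - g‖) atTop (𝓝 0)) :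
    Tendsto (fun n => ‖((u n - v n : D.dom) : Lp ℝ (ENNReal.ofReal p) μ) - (f - g : D.dom)‖)
      atTop (𝓝 0) := by
  have := hu.add hv
  rw [add_zero] at this
  refine squeeze_zero (fun _ => norm_nonneg _) (fun n => ?_) this
  push_cast
  rw [sub_sub_sub_comm]
  exact norm_sub_le _ _

/-- On the open set `{u + v > κ}` the function is `κ - v`, on `{u + v < κ}` it is `u`, and the
interface `{u + v = κ}` carries no energy of the excess. Continuity of representatives makes the
first two sets open, as strong locality requires. -/
theorem Γ_capped_le_of_isCc [IsFiniteMeasureOnCompacts μ] (hp : 0 < p)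
    {u v : D.dom} {φ η : X → ℝ} (hu : D.IsCc u φ) (hv : D.IsCc v η) (κ : ℝ≥0)
    {A : Set X} (hA : MeasurableSet A) : D.Γ (D.capped u v κ) A ≤ D.Γ u A + D.Γ v A := by
  have hsum : Continuous fun x => φ x + η x := hu.1.add hv.1
  set P : Set X := {x | (κ : ℝ) < φ x + η x} with hP
  have hPo : IsOpen P := isOpen_lt continuous_const hsum
  rw [← measure_inter_add_sdiff A hPo.measurableSet, add_comm]
  refine add_le_add ?_ ?_
  · refine le_trans (D.Γ_le_of_sub_eq_zero hp (hA.diff hPo.measurableSet) ?_)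
      (measure_mono sdiff_subset)
    rw [D.Γ_sub_comm, capped, sub_sub_cancel]
    have hsub : A \ P ⊆ {x | φ x + η x < κ} ∪ {x | φ x + η x = κ} := by
      intro x hx
      have h : ¬ (κ : ℝ) < φ x + η x := hx.2
      exact lt_or_eq_of_le (not_lt.1 h)
    refine measure_mono_null hsub (measure_union_null ?_ ?_)
    · refine D.Γ_eq_zero_of_ae_eq (isOpen_lt hsum continuous_const) subset_rfl 0 ?_
      filter_upwards [D.coeFn_excess (u + v) κ, (hu.add hv).2.2] with x h1 h2 hx
      rw [h1, h2, max_eq_right]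
      have : φ x + η x < κ := hx
      linarith
    · exact le_antisymm ((D.Γ_excess_le _ κ _).trans_eq
        (D.Γ_levelSet_eq_zero (hu.add hv) κ)) zero_le
  · rw [← D.Γ_neg v]
    refine le_trans (D.Γ_le_of_sub_eq_zero hp (hA.inter hPo.measurableSet) ?_)
      (measure_mono inter_subset_left)
    refine D.Γ_eq_zero_of_ae_eq hPo inter_subset_right κ ?_
    filter_upwards [D.coeFn_sub (D.capped u v κ) (-v), D.coeFn_capped u v κ, D.coeFn_neg v,
      hu.2.2, hv.2.2] with x h1 h2 h3 h4 h5 hx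
    have : (κ : ℝ) < φ x + η x := hx
    rw [h1, h2, h3, h4, h5, min_eq_right (by linarith)]
    ring

/-- Subadditivity of the energy measures under lattice operations. -/
theorem Γ_capped_le [IsFiniteMeasureOnCompacts μ] (hp : 0 < p) (u v : D.dom) (κ : ℝ≥0)
    {A : Set X} (hA : MeasurableSet A) : D.Γ (D.capped u v κ) A ≤ D.Γ u A + D.Γ v A := by
  obtain ⟨un, φ, h1, h2, h3⟩ := D.exists_converges_isCc hp u
  obtain ⟨vn, η, h4, h5, h6⟩ := D.exists_converges_isCc hp v
  have hconv := D.tendsto_sub h2.1 (D.tendsto_excess (D.tendsto_add h2.1 h5.1) κ)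
  have hb : ∀ n, D.Γ (D.capped (un n) (vn n) κ) univ ≤ (D.Γ u univ + 1) + (D.Γ v univ + 1) :=
    fun n => (D.Γ_capped_le_of_isCc hp (h1 n) (h4 n) κ MeasurableSet.univ).trans
      (add_le_add (h3 n) (h6 n))
  refine (D.Γ_le_liminf (f := D.capped u v κ) (u := fun n => D.capped (un n) (vn n) κ) hconv
    (by simp [D.Γ_ne_top]) hb hA).trans ?_
  have hlim := (h2.tendsto_Γ hp hA).add (h5.tendsto_Γ hp hA)
  rw [← hlim.liminf_eq]
  exact liminf_le_liminf (Eventually.of_forall fun n =>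
    D.Γ_capped_le_of_isCc hp (h1 n) (h4 n) κ hA)

/-- The two parts of a function below and above a level share its energy. -/
theorem Γ_sub_excess_add_le [IsFiniteMeasureOnCompacts μ] (hp : 0 < p) (u : D.dom) (κ : ℝ≥0) :
    D.Γ (u - D.excess u κ) univ + D.Γ (D.excess u κ) univ ≤ D.Γ u univ := by
  -- For continuous representatives the lower part is constant above level `κ`, the upper part
  -- vanishes below it, and level `κ` itself carries no energy. The two energies therefore live on
  -- complementary sets.
  have hcc : ∀ (w : D.dom) (φ : X → ℝ), D.IsCc w φ →
      D.Γ (w - D.excess w κ) univ + D.Γ (D.excess w κ) univ ≤ D.Γ w univ := by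
    intro w φ hw
    have hPo : IsOpen {x | (κ : ℝ) < φ x} := isOpen_lt continuous_const hw.1
    have hupper : D.Γ (w - D.excess w κ) {x | (κ : ℝ) < φ x} = 0 := by
      refine D.Γ_eq_zero_of_ae_eq hPo subset_rfl κ ?_
      filter_upwards [D.coeFn_sub w (D.excess w κ), D.coeFn_excess w κ, hw.2.2] with x h1 h2 h3 hx
      have : (κ : ℝ) < φ x := hx
      rw [h1, h2, h3, max_eq_left (by linarith)]
      ring
    have hlower : D.Γ (D.excess w κ) {x | (κ : ℝ) < φ x}ᶜ = 0 := by
      have hsub : {x | (κ : ℝ) < φ x}ᶜ ⊆ {x | φ x < κ} ∪ {x | φ x = κ} := by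
        intro x hx
        have h : ¬ (κ : ℝ) < φ x := hx
        exact lt_or_eq_of_le (not_lt.1 h)
      refine measure_mono_null hsub (measure_union_null ?_ ?_)
      · refine D.Γ_eq_zero_of_ae_eq (isOpen_lt hw.1 continuous_const) subset_rfl 0 ?_
        filter_upwards [D.coeFn_excess w κ, hw.2.2] with x h1 h2 hx
        have : φ x < κ := hx
        rw [h1, h2, max_eq_right (by linarith)]
      · exact le_antisymm ((D.Γ_excess_le _ κ _).trans_eq (D.Γ_levelSet_eq_zero hw κ)) zero_le
    have hlow : D.Γ (w - D.excess w κ) {x | (κ : ℝ) < φ x}ᶜ ≤ D.Γ w {x | (κ : ℝ) < φ x}ᶜ := by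
      rw [sub_eq_add_neg]
      exact D.Γ_add_of_eq_zero hp hPo.measurableSet.compl (by rwa [D.Γ_neg])
    rw [← measure_add_measure_compl (μ := D.Γ (w - D.excess w κ)) hPo.measurableSet,
      ← measure_add_measure_compl (μ := D.Γ (D.excess w κ)) hPo.measurableSet,
      ← measure_add_measure_compl (μ := D.Γ w) hPo.measurableSet, hupper, hlower, zero_add,
      add_zero, add_comm]
    exact add_le_add (D.Γ_excess_le _ _ _) hlow
  obtain ⟨un, φ, h1, h2, h3⟩ := D.exists_converges_isCc hp u
  have hsub := D.tendsto_sub h2.1 (D.tendsto_excess h2.1 κ)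
  have hb : ∀ n, D.Γ (un n - D.excess (un n) κ) univ ≤ D.Γ u univ + 1 := fun n =>
    (le_self_add.trans (hcc _ _ (h1 n))).trans (h3 n)
  have hb2 : ∀ n, D.Γ (D.excess (un n) κ) univ ≤ D.Γ u univ + 1 := fun n =>
    (D.Γ_excess_le _ _ _).trans (h3 n)
  have hM : D.Γ u univ + 1 ≠ ∞ := by simp [D.Γ_ne_top]
  refine (add_le_add (D.Γ_le_liminf hsub hM hb MeasurableSet.univ)
    (D.Γ_le_liminf (D.tendsto_excess h2.1 κ) hM hb2 MeasurableSet.univ)).trans ?_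
  refine (ENNReal.liminf_add_liminf_le _ _).trans ?_
  rw [← (h2.tendsto_Γ hp MeasurableSet.univ).liminf_eq]
  exact liminf_le_liminf (Eventually.of_forall fun n => hcc _ _ (h1 n))

end Truncation

end PDirichletStructure

/-- Two open rays of `EReal` describe the superlevel sets of `|F - c|`, so continuity of `F` can be
used directly, including at infinite values. -/
theorem EReal.ofReal_lt_abs_sub_coe_iff {z : EReal} {c t : ℝ} (ht : 0 ≤ t) :
    ENNReal.ofReal t < (z - (c : EReal)).abs ↔
      z < ((c - t : ℝ) : EReal) ∨ ((c + t : ℝ) : EReal) < z := by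
  induction z with
  | bot => simp [EReal.bot_sub, -EReal.coe_sub]
  | top => simp [-EReal.coe_add]
  | coe a =>
    rw [← EReal.coe_sub, EReal.abs_def, ENNReal.ofReal_lt_ofReal_iff_of_nonneg ht,
      EReal.coe_lt_coe_iff, EReal.coe_lt_coe_iff, lt_abs]
    constructor <;> rintro (h | h)
    · right; linarith
    · left; linarith
    · right; linarith
    · left; linarith

/-- For finite positive `a` the single term with `2^(k+1) < a ≤ 2^(k+2)` suffices. For `a = ∞` every
term is present and the sum diverges. -/
theorem ENNReal.rpow_le_tsum_dyadic {p : ℝ} (hp : 1 ≤ p) (a : ℝ≥0∞) :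
    a ^ p ≤ ∑' k : ℤ, if ENNReal.ofReal ((2 : ℝ) ^ (k + 1)) < a
      then ENNReal.ofReal ((2 : ℝ) ^ (k + 2)) ^ p else 0 := by
  have hp0 : 0 < p := by linarith
  rcases eq_or_ne a 0 with rfl | h0
  · simp [hp0]
  rcases eq_or_ne a ∞ with rfl | htop
  · have htop : (∑' k : ℤ, if ENNReal.ofReal ((2 : ℝ) ^ (k + 1)) < ∞
      then ENNReal.ofReal ((2 : ℝ) ^ (k + 2)) ^ p else 0) = ∞ := by
      refine ENNReal.eq_top_of_forall_nnreal_le fun r => ?_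
      obtain ⟨n, hn⟩ := exists_nat_ge r
      refine le_trans ?_ (ENNReal.le_tsum (n : ℤ))
      rw [if_pos ENNReal.ofReal_lt_top]
      have h1 : (1 : ℝ≥0∞) ≤ ENNReal.ofReal ((2 : ℝ) ^ ((n : ℤ) + 2)) := by
        rw [← ENNReal.ofReal_one]
        exact ENNReal.ofReal_le_ofReal (one_le_zpow₀ (by norm_num) (by omega))
      calc (r : ℝ≥0∞) ≤ ENNReal.ofReal (n : ℝ) := by
            rw [ENNReal.ofReal_natCast]; exact_mod_cast hn
        _ ≤ ENNReal.ofReal ((2 : ℝ) ^ ((n : ℤ) + 2)) := by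
            refine ENNReal.ofReal_le_ofReal ?_
            have h2 : (n : ℝ) ≤ (2 : ℝ) ^ n := by exact_mod_cast (Nat.lt_two_pow_self (n := n)).le
            refine h2.trans ?_
            rw [← zpow_natCast]
            exact zpow_le_zpow_right₀ (by norm_num) (by omega)
        _ ≤ _ := by
            nth_rewrite 1 [← ENNReal.rpow_one (ENNReal.ofReal _)]
            exact ENNReal.rpow_le_rpow_of_exponent_le h1 hp
    rw [htop]; exact le_top
  · have hb : 0 < a.toReal := ENNReal.toReal_pos h0 htop
    obtain ⟨k, hk1, hk2⟩ := _root_.exists_mem_Ioc_zpow hb (by norm_num : (1 : ℝ) < 2)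
    refine le_trans ?_ (ENNReal.le_tsum (k - 1))
    rw [if_pos]
    · refine ENNReal.rpow_le_rpow ?_ hp0.le
      rw [← ENNReal.ofReal_toReal htop]
      refine ENNReal.ofReal_le_ofReal ?_
      rw [show k - 1 + 2 = k + 1 by ring]
      exact hk2
    · rw [← ENNReal.ofReal_toReal htop, sub_add_cancel]
      exact (ENNReal.ofReal_lt_ofReal_iff hb).2 hk1

namespace PDirichletStructure

variable {X : Type*} [MetricSpace X] [MeasurableSpace X] [BorelSpace X] {μ : Measure X} {p : ℝ}

/-! ### Capacitary strong-type inequality for capacity minimizers. -/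

section StrongType

variable (D : PDirichletStructure X μ p)

/-- The truncation `max (min f 1) 0`. -/
def clamp (f : D.dom) : D.dom :=
  D.comp f (K := 1) (g := fun s => max (min s 1) 0)
    ((LipschitzWith.id.min_const 1).max_const 0) (by simp)

theorem coeFn_clamp (f : D.dom) :
    ∀ᵐ x ∂μ, (D.clamp f : Lp ℝ (ENNReal.ofReal p) μ) x
      = max (min ((f : Lp ℝ (ENNReal.ofReal p) μ) x) 1) 0 :=
  D.coeFn_comp f _ _

theorem Γ_clamp_le (f : D.dom) (A : Set X) : D.Γ (D.clamp f) A ≤ D.Γ f A :=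
  D.Γ_comp_le_of_one f _ _ A

theorem norm_clamp_le (f : D.dom) :
    ‖(D.clamp f : Lp ℝ (ENNReal.ofReal p) μ)‖ ≤ ‖(f : Lp ℝ (ENNReal.ofReal p) μ)‖ := by
  refine Lp.norm_le_norm_of_ae_le ?_
  filter_upwards [D.coeFn_clamp f] with x h
  rw [h, Real.norm_eq_abs, Real.norm_eq_abs, abs_of_nonneg (le_max_right _ _)]
  exact max_le ((min_le_left _ _).trans (le_abs_self _)) (abs_nonneg _)

theorem dom_ext {u v : D.dom} (h : ∀ᵐ x ∂μ, (u : Lp ℝ (ENNReal.ofReal p) μ) x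
    = (v : Lp ℝ (ENNReal.ofReal p) μ) x) : u = v :=
  Subtype.ext (Lp.ext h)

/-- The competitor saves all of `Γ ψ H` and pays at most `Γ k Hᶜ` on the complement; by minimality
the saving cannot exceed the payment. Finiteness of `Γ ψ Hᶜ` permits the cancellation. -/
theorem Γ_le_of_competitor {x : X} {r : ℝ} {ψ w k : D.dom} (hψ : D.IsCapacityMinimizer x r ψ)
    (hw : D.IsCutoff x r w) {H : Set X} (hH : MeasurableSet H) (hw0 : D.Γ w H = 0)
    (hle : D.Γ w Hᶜ ≤ D.Γ ψ Hᶜ + D.Γ k Hᶜ) : D.Γ ψ H ≤ D.Γ k univ := by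
  have h1 := hψ.2.2 w hw
  rw [← measure_add_measure_compl (μ := D.Γ ψ) hH, ← measure_add_measure_compl (μ := D.Γ w) hH,
    hw0, zero_add, add_comm] at h1
  exact (ENNReal.le_of_add_le_add_left (D.Γ_ne_top ψ _) (h1.trans hle)).trans
    (measure_mono (subset_univ _))

/-- The absolute value of a function in the domain. -/
def absVal (f : D.dom) : D.dom :=
  D.comp f (K := 1) (g := fun s => |s|) lipschitzWith_one_norm (by simp)

theorem coeFn_absVal (f : D.dom) : ∀ᵐ x ∂μ, (D.absVal f : Lp ℝ (ENNReal.ofReal p) μ) x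
      = |(f : Lp ℝ (ENNReal.ofReal p) μ) x| :=
  D.coeFn_comp f _ _

theorem Γ_absVal_le (f : D.dom) (A : Set X) : D.Γ (D.absVal f) A ≤ D.Γ f A :=
  D.Γ_comp_le_of_one f _ _ A

/-- The dyadic level `2 ^ k`. -/
def dyadicLevel (k : ℤ) : ℝ≥0 := 2 ^ k

theorem coe_dyadicLevel (k : ℤ) : (dyadicLevel k : ℝ) = 2 ^ k := by simp [dyadicLevel]

theorem dyadicLevel_pos (k : ℤ) : (0 : ℝ) < dyadicLevel k := by
  rw [coe_dyadicLevel]; positivity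

theorem coe_dyadicLevel_succ (k : ℤ) : (dyadicLevel (k + 1) : ℝ) = 2 * dyadicLevel k := by
  rw [coe_dyadicLevel, coe_dyadicLevel, zpow_add_one₀ (by norm_num)]; ring

/-- The part of `|f|` between the levels `2 ^ k` and `2 ^ (k + 1)`. -/
def dyadicSlice (f : D.dom) (k : ℤ) : D.dom :=
  D.excess (D.absVal f) (dyadicLevel k) - D.excess (D.absVal f) (dyadicLevel (k + 1))

theorem coeFn_dyadicSlice (f : D.dom) (k : ℤ) :
    ∀ᵐ x ∂μ, (D.dyadicSlice f k : Lp ℝ (ENNReal.ofReal p) μ) x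
      = max (|(f : Lp ℝ (ENNReal.ofReal p) μ) x| - dyadicLevel k) 0
        - max (|(f : Lp ℝ (ENNReal.ofReal p) μ) x| - 2 * dyadicLevel k) 0 := by
  filter_upwards [D.coeFn_sub (D.excess (D.absVal f) (dyadicLevel k))
    (D.excess (D.absVal f) (dyadicLevel (k + 1))), D.coeFn_excess (D.absVal f) (dyadicLevel k),
    D.coeFn_excess (D.absVal f) (dyadicLevel (k + 1)), D.coeFn_absVal f] with x h1 h2 h3 h4
  rw [dyadicSlice, h1, h2, h3, h4, coe_dyadicLevel_succ]

variable [Fact (1 ≤ ENNReal.ofReal p)]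

theorem exists_of_openCap_lt (hp : 0 < p) {O : Set X} (hO : IsOpen O) {ε : ℝ≥0∞} (h : D.openCap O < ε) :
    ∃ e : D.dom, (∀ᵐ x ∂μ, (e : Lp ℝ (ENNReal.ofReal p) μ) x ∈ Icc (0 : ℝ) 1) ∧
      (∀ᵐ x ∂μ, x ∈ O → (e : Lp ℝ (ENNReal.ofReal p) μ) x = 1) ∧
      ENNReal.ofReal (‖(e : Lp ℝ (ENNReal.ofReal p) μ)‖ ^ p) < ε ∧ D.Γ e univ < ε := by
  simp only [openCap, iInf_lt_iff] at h
  obtain ⟨f, hf, hlt⟩ := h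
  rw [ae_restrict_iff' hO.measurableSet] at hf
  refine ⟨D.clamp f, ?_, ?_, ?_, ?_⟩
  · filter_upwards [D.coeFn_clamp f] with x hx
    rw [hx]
    exact ⟨le_max_right _ _, max_le (min_le_right _ _) zero_le_one⟩
  · filter_upwards [D.coeFn_clamp f, hf] with x hx h1 hxO
    rw [hx, h1 hxO]; simp
  · refine lt_of_le_of_lt ?_ (lt_of_le_of_lt le_self_add hlt)
    exact ENNReal.ofReal_le_ofReal (Real.rpow_le_rpow (norm_nonneg _) (D.norm_clamp_le f) hp.le)
  · exact lt_of_le_of_lt (D.Γ_clamp_le f _) (lt_of_le_of_lt le_add_self hlt)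

/-- Strong locality needs an open set of constancy, while `u = κ` is known only off a set `O` of
small capacity. With `e` nearly optimal for `O`, passing to `(u - e)₊` when `κ = 0`, or `max u e`
when `κ = 1`, makes the function constant on all of `V`. These modifications have bounded energy and
tend to `u` in `L^p` as the capacity tends to zero, so lower semicontinuity concludes. -/
theorem Γ_eq_zero_of_quasi_open (hp : 1 ≤ p) {u : D.dom} {κ : ℝ} (hκ : κ = 0 ∨ κ = 1)
    (hu : ∀ᵐ x ∂μ, (u : Lp ℝ (ENNReal.ofReal p) μ) x ∈ Icc (0 : ℝ) 1)
    {H : Set X} (hH : MeasurableSet H)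
    (h : ∀ ε : ℝ≥0∞, 0 < ε → ∃ O V : Set X, IsOpen O ∧ D.openCap O < ε ∧ IsOpen V ∧ H ⊆ V ∧
      ∀ᵐ x ∂μ, x ∈ V → x ∉ O → (u : Lp ℝ (ENNReal.ofReal p) μ) x = κ) : D.Γ u H = 0 := by
  have hp0 : 0 < p := by linarith
  choose O V hO hcap hV hHV huV using fun n : ℕ => h (ENNReal.ofReal (1 / ((n : ℝ) + 1)))
    (by rw [ENNReal.ofReal_pos]; positivity)
  choose e he01 heO henorm heE using fun n : ℕ => D.exists_of_openCap_lt hp0 (hO n) (hcap n)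
  have hlim : Tendsto (fun n : ℕ => 1 / ((n : ℝ) + 1)) atTop (𝓝 0) :=
    tendsto_one_div_add_atTop_nhds_zero_nat
  have hzero : Tendsto (fun n => ‖(e n : Lp ℝ (ENNReal.ofReal p) μ) - (0 : D.dom)‖)
      atTop (𝓝 0) := by
    have hlim2 : Tendsto (fun n : ℕ => (1 / ((n : ℝ) + 1)) ^ (1 / p)) atTop (𝓝 0) := by
      have := hlim.rpow_const (p := 1 / p) (Or.inr (by positivity))
      rwa [Real.zero_rpow (by positivity)] at this
    refine squeeze_zero (fun _ => norm_nonneg _) (fun n => ?_) hlim2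
    have h1 := (ENNReal.ofReal_lt_ofReal_iff (by positivity)).1 (henorm n)
    have h2 := Real.rpow_le_rpow (by positivity) h1.le (by positivity : 0 ≤ 1 / p)
    rw [← Real.rpow_mul (norm_nonneg _), mul_one_div_cancel hp0.ne', Real.rpow_one] at h2
    simpa using h2
  have hE1 : ∀ n, D.Γ (e n) univ ≤ 1 := fun n => by
    refine (heE n).le.trans ?_
    rw [← ENNReal.ofReal_one]
    refine ENNReal.ofReal_le_ofReal ?_
    rw [div_le_one (by positivity)]
    linarith [(Nat.cast_nonneg n : (0 : ℝ) ≤ n)]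
  have hconst : Tendsto (fun _ : ℕ => ‖(u : Lp ℝ (ENNReal.ofReal p) μ) - u‖) atTop (𝓝 0) := by
    simp
  have hpos : D.excess (u - 0) 0 = u := by
    refine D.dom_ext ?_
    rw [sub_zero]
    filter_upwards [D.coeFn_excess u 0, hu] with x h1 h2
    rw [h1, NNReal.coe_zero, sub_zero, max_eq_left h2.1]
  have hw := D.tendsto_excess (D.tendsto_sub hconst hzero) 0
  have hM : (2 : ℝ≥0∞) ^ (p - 1) * (D.Γ u univ + 1) ≠ ∞ :=
    ENNReal.mul_ne_top (ENNReal.rpow_ne_top_of_nonneg (by linarith) (by simp))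
      (by simp [D.Γ_ne_top])
  have hwE : ∀ n, D.Γ (D.excess (u - e n) 0) univ ≤ 2 ^ (p - 1) * (D.Γ u univ + 1) := fun n =>
    (D.Γ_excess_le _ _ _).trans ((D.Γ_sub_le hp _ _ MeasurableSet.univ).trans
      (by gcongr; exact hE1 n))
  rw [hpos] at hw
  refine le_antisymm ?_ zero_le
  rcases hκ with rfl | rfl
  · refine (D.Γ_le_liminf hw hM hwE hH).trans_eq ?_
    have hz : ∀ n, D.Γ (D.excess (u - e n) 0) H = 0 := fun n => by
      refine D.Γ_eq_zero_of_ae_eq (hV n) (hHV n) 0 ?_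
      filter_upwards [D.coeFn_excess (u - e n) 0, D.coeFn_sub u (e n), hu, he01 n, heO n,
        huV n] with x h1 h2 h3 h4 h5 h6 hx
      rw [h1, h2, NNReal.coe_zero, sub_zero, max_eq_right]
      by_cases hxO : x ∈ O n
      · rw [h5 hxO]; linarith [h3.2]
      · rw [h6 hx hxO]; linarith [h4.1]
    simp [hz]
  -- The sum `(u - e)₊ + e` is `max u e`.
  · have hmax := D.tendsto_add hw hzero
    rw [add_zero] at hmax
    have hmE : ∀ n, D.Γ (D.excess (u - e n) 0 + e n) univ
        ≤ 2 ^ (p - 1) * (2 ^ (p - 1) * (D.Γ u univ + 1) + 1) := fun n =>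
      (D.Γ_add_le hp _ _ MeasurableSet.univ).trans
        (mul_le_mul_right (add_le_add (hwE n) (hE1 n)) _)
    have hM2 : (2 : ℝ≥0∞) ^ (p - 1) * (2 ^ (p - 1) * (D.Γ u univ + 1) + 1) ≠ ∞ :=
      ENNReal.mul_ne_top (ENNReal.rpow_ne_top_of_nonneg (by linarith) (by simp))
        (ENNReal.add_ne_top.2 ⟨hM, by simp⟩)
    refine (D.Γ_le_liminf hmax hM2 hmE hH).trans_eq ?_
    have hz : ∀ n, D.Γ (D.excess (u - e n) 0 + e n) H = 0 := fun n => by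
      refine D.Γ_eq_zero_of_ae_eq (hV n) (hHV n) 1 ?_
      filter_upwards [D.coeFn_add (D.excess (u - e n) 0) (e n), D.coeFn_excess (u - e n) 0,
        D.coeFn_sub u (e n), hu, he01 n, heO n, huV n] with x h0 h1 h2 h3 h4 h5 h6 hx
      rw [h0, h1, h2, NNReal.coe_zero, sub_zero]
      by_cases hxO : x ∈ O n
      · rw [h5 hxO, max_eq_right (by linarith [h3.2])]; ring
      · rw [h6 hx hxO, max_eq_left (by linarith [h4.2])]; ring
    simp [hz]

/-- The energy of a capacity minimizer on a quasi-open set where a test function equals `1`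
is controlled by the energy of the test function. -/
theorem Γ_minimizer_le [IsFiniteMeasureOnCompacts μ] (hp : 1 ≤ p) {x : X} {r : ℝ} {ψ k : D.dom}
    (hψ : D.IsCapacityMinimizer x r ψ)
    (hk : ∀ᵐ y ∂μ, (k : Lp ℝ (ENNReal.ofReal p) μ) y ∈ Icc (0 : ℝ) 1)
    (hk0 : (∀ᵐ y ∂μ, y ∉ Metric.ball x (2 * r) → (k : Lp ℝ (ENNReal.ofReal p) μ) y = 0) ∨
      (∀ᵐ y ∂μ, y ∈ Metric.ball x r → (k : Lp ℝ (ENNReal.ofReal p) μ) y = 0))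
    {H : Set X} (hH : MeasurableSet H)
    (h : ∀ ε : ℝ≥0∞, 0 < ε → ∃ O V : Set X, IsOpen O ∧ D.openCap O < ε ∧ IsOpen V ∧ H ⊆ V ∧
      ∀ᵐ y ∂μ, y ∈ V → y ∉ O → (k : Lp ℝ (ENNReal.ofReal p) μ) y = 1) :
    D.Γ ψ H ≤ D.Γ k univ := by
  have hp0 : 0 < p := by linarith
  rcases hk0 with hk0 | hk0
  -- If `k` vanishes outside `2B`, the competitor is `max ψ k = -min (-ψ) (-k)`, which is `1` where
  -- `k = 1`.
  · have hae : ∀ᵐ y ∂μ, ((-D.capped (-ψ) k 0 : D.dom) : Lp ℝ (ENNReal.ofReal p) μ) y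
        = max ((ψ : Lp ℝ (ENNReal.ofReal p) μ) y) ((k : Lp ℝ (ENNReal.ofReal p) μ) y) := by
      filter_upwards [D.coeFn_neg (D.capped (-ψ) k 0), D.coeFn_capped (-ψ) k 0,
        D.coeFn_neg ψ] with y h1 h2 h3
      rw [h1, h2, h3, NNReal.coe_zero, zero_sub, min_neg_neg, neg_neg]
    refine D.Γ_le_of_competitor hψ (w := -D.capped (-ψ) k 0) ⟨?_, ?_⟩ hH ?_ ?_
    · filter_upwards [hae, hψ.1.1, hk] with y h1 h2 h3 hy
      rw [h1, h2 hy, max_eq_left h3.2]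
    · filter_upwards [hae, hψ.1.2, hk0] with y h1 h2 h3 hy
      rw [h1, h2 hy, h3 hy, max_self]
    · refine D.Γ_eq_zero_of_quasi_open hp (κ := 1) (Or.inr rfl) ?_ hH fun ε hε => ?_
      · filter_upwards [hae, hψ.2.1, hk] with y h1 h2 h3
        rw [h1]
        exact ⟨h2.1.trans (le_max_left _ _), max_le h2.2 h3.2⟩
      · obtain ⟨O, V, h1, h2, h3, h4, h5⟩ := h ε hε
        refine ⟨O, V, h1, h2, h3, h4, ?_⟩
        filter_upwards [hae, hψ.2.1, h5] with y h6 h7 h8 hyV hyO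
        rw [h6, h8 hyV hyO, max_eq_right h7.2]
    · rw [D.Γ_neg, ← D.Γ_neg ψ]
      exact D.Γ_capped_le hp0 _ _ _ hH.compl
  -- If `k` vanishes on `B`, the competitor is `min ψ (1 - k)`, which is `0` where `k = 1`. It lies
  -- in the domain although `1 - k` need not.
  · have hae := D.coeFn_capped ψ k 1
    refine D.Γ_le_of_competitor hψ (w := D.capped ψ k 1) ⟨?_, ?_⟩ hH ?_ ?_
    · filter_upwards [hae, hψ.1.1, hk0] with y h1 h2 h3 hy
      rw [h1, h2 hy, h3 hy]; simp
    · filter_upwards [hae, hψ.1.2, hk] with y h1 h2 h3 hy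
      rw [h1, h2 hy, min_eq_left]
      simpa using h3.2
    · refine D.Γ_eq_zero_of_quasi_open hp (κ := 0) (Or.inl rfl) ?_ hH fun ε hε => ?_
      · filter_upwards [hae, hψ.2.1, hk] with y h1 h2 h3
        rw [h1]
        exact ⟨le_min h2.1 (by simpa using h3.2), (min_le_left _ _).trans h2.2⟩
      · obtain ⟨O, V, h1, h2, h3, h4, h5⟩ := h ε hε
        refine ⟨O, V, h1, h2, h3, h4, ?_⟩
        filter_upwards [hae, hψ.2.1, h5] with y h6 h7 h8 hyV hyO
        rw [h6, h8 hyV hyO]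
        simpa using h7.1
    · exact D.Γ_capped_le hp0 _ _ _ hH.compl

theorem sum_Γ_dyadicSlice_le [IsFiniteMeasureOnCompacts μ] (hp : 0 < p) (f : D.dom) (a : ℤ)
    (n : ℕ) : ∑ k ∈ Finset.range n, D.Γ (D.dyadicSlice f (a + k)) univ ≤ D.Γ f univ := by
  have hstep : ∀ k : ℤ, D.Γ (D.dyadicSlice f k) univ
      + D.Γ (D.excess (D.absVal f) (dyadicLevel (k + 1))) univ
      ≤ D.Γ (D.excess (D.absVal f) (dyadicLevel k)) univ := by
    intro k
    -- Removing `2^k` twice removes `2^(k+1)`, so the energy splitting applied to the excess over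
    -- `2^k` separates exactly one slice and the sum telescopes.
    have heq : D.excess (D.excess (D.absVal f) (dyadicLevel k)) (dyadicLevel k)
        = D.excess (D.absVal f) (dyadicLevel (k + 1)) := by
      refine D.dom_ext ?_
      filter_upwards [D.coeFn_excess (D.excess (D.absVal f) (dyadicLevel k)) (dyadicLevel k),
        D.coeFn_excess (D.absVal f) (dyadicLevel k),
        D.coeFn_excess (D.absVal f) (dyadicLevel (k + 1))] with x h1 h2 h3
      rw [h1, h2, h3, coe_dyadicLevel_succ]
      have := dyadicLevel_pos k
      rcases max_cases ((D.absVal f : Lp ℝ (ENNReal.ofReal p) μ) x - dyadicLevel k) 0 with h | h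
      · rw [h.1]; congr 1; ring
      · rw [h.1, max_eq_right (by linarith), max_eq_right (by linarith)]
    have := D.Γ_sub_excess_add_le hp (D.excess (D.absVal f) (dyadicLevel k)) (dyadicLevel k)
    rwa [heq] at this
  have hsum : ∑ k ∈ Finset.range n, D.Γ (D.dyadicSlice f (a + k)) univ
      + D.Γ (D.excess (D.absVal f) (dyadicLevel (a + n))) univ
      ≤ D.Γ (D.excess (D.absVal f) (dyadicLevel a)) univ := by
    induction n with
    | zero => simp
    | succ n ih =>
      rw [Finset.sum_range_succ, add_assoc]
      refine le_trans (add_le_add_right ?_ _) ih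
      have := hstep (a + n)
      rwa [show a + ((n + 1 : ℕ) : ℤ) = a + n + 1 by push_cast; ring]
  exact (le_self_add.trans hsum).trans ((D.Γ_excess_le _ _ _).trans (D.Γ_absVal_le _ _))

theorem tsum_Γ_dyadicSlice_le [IsFiniteMeasureOnCompacts μ] (hp : 0 < p) (f : D.dom) :
    ∑' k : ℤ, D.Γ (D.dyadicSlice f k) univ ≤ D.Γ f univ := by
  rw [ENNReal.tsum_eq_iSup_sum]
  refine iSup_le fun s => ?_
  obtain ⟨m, hm⟩ : ∃ m : ℕ, ∀ k ∈ s, k.natAbs ≤ m := ⟨s.sup Int.natAbs, fun k hk =>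
    Finset.le_sup (f := Int.natAbs) hk⟩
  refine le_trans ?_ (D.sum_Γ_dyadicSlice_le hp f (-m) (2 * m + 1))
  rw [← Finset.sum_image (f := fun k : ℤ => D.Γ (D.dyadicSlice f k) univ)
    (g := fun k : ℕ => -(m : ℤ) + k) (s := Finset.range (2 * m + 1))
    (by intro a _ b _ hab; simpa using hab)]
  refine Finset.sum_le_sum_of_subset fun k hk => ?_
  have := hm k hk
  exact Finset.mem_image.2 ⟨(k + m).toNat, by simp; omega, by omega⟩

/-- Capacitary strong-type inequality for the energy measure of a capacity minimizer. -/
theorem setLIntegral_minimizer_le [IsFiniteMeasureOnCompacts μ] (hp : 1 ≤ p) {x : X} {r : ℝ}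
    {ψ g f : D.dom} (hψ : D.IsCapacityMinimizer x r ψ)
    (hg : (∀ᵐ y ∂μ, y ∉ Metric.ball x (2 * r) → (g : Lp ℝ (ENNReal.ofReal p) μ) y = 0) ∨
      (∀ᵐ y ∂μ, y ∈ Metric.ball x r → (g : Lp ℝ (ENNReal.ofReal p) μ) y = 0))
    {F : X → EReal} (hF : D.IsQuasicontinuousRep f F) (c : ℝ) {S : Set X} (hS : IsOpen S)
    (hgS : ∀ᵐ y ∂μ, y ∈ S → (g : Lp ℝ (ENNReal.ofReal p) μ) y
      = (f : Lp ℝ (ENNReal.ofReal p) μ) y - c) :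
    ∫⁻ y in S, (F y - (c : EReal)).abs ^ p ∂(D.Γ ψ) ≤ 4 ^ p * D.Γ g univ := by
  have hp0 : 0 < p := by linarith
  set G : ℤ → Set EReal := fun k => Iio ((c - 2 ^ (k + 1) : ℝ) : EReal)
    ∪ Ioi ((c + 2 ^ (k + 1) : ℝ) : EReal) with hG
  have hGo : ∀ k, IsOpen (G k) := fun k => isOpen_Iio.union isOpen_Ioi
  have hGmeas : ∀ k, MeasurableSet (F ⁻¹' G k) := fun k => hF.1 (hGo k).measurableSet
  have hmem : ∀ k y, y ∈ F ⁻¹' G k ↔ ENNReal.ofReal ((2 : ℝ) ^ (k + 1)) < (F y - (c : EReal)).abs :=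
    fun k y => (EReal.ofReal_lt_abs_sub_coe_iff (by positivity)).symm
  have hlevel : ∀ k : ℤ, D.Γ ψ (F ⁻¹' G k ∩ S)
      ≤ ENNReal.ofReal (|((2 : ℝ) ^ k)⁻¹| ^ p) * D.Γ (D.dyadicSlice g k) univ := by
    intro k
    rw [← D.Γ_smul]
    -- The rescaled slice is the test function: it has values in `[0,1]`, equals `1` once `|g| ≥
    -- 2^(k+1)`, and inherits the zeros of `g`.
    have hae : ∀ᵐ y ∂μ, ((((2 : ℝ) ^ k)⁻¹ • D.dyadicSlice g k : D.dom) :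
        Lp ℝ (ENNReal.ofReal p) μ) y = ((2 : ℝ) ^ k)⁻¹ *
        (max (|(g : Lp ℝ (ENNReal.ofReal p) μ) y| - 2 ^ k) 0
        - max (|(g : Lp ℝ (ENNReal.ofReal p) μ) y| - 2 * 2 ^ k) 0) := by
      filter_upwards [D.coeFn_smul ((2 : ℝ) ^ k)⁻¹ (D.dyadicSlice g k),
        D.coeFn_dyadicSlice g k] with y h1 h2
      rw [h1, h2, coe_dyadicLevel]
    have h2k : (0 : ℝ) < 2 ^ k := by positivity
    refine D.Γ_minimizer_le hp hψ ?_ ?_ ((hGmeas k).inter hS.measurableSet) fun ε hε => ?_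
    · filter_upwards [hae] with y hy
      rw [hy]
      constructor
      · refine mul_nonneg (by positivity) (sub_nonneg.2 (max_le_max_right 0 (by linarith)))
      · rw [inv_mul_le_iff₀ h2k]
        rcases max_cases (|(g : Lp ℝ (ENNReal.ofReal p) μ) y| - 2 ^ k) 0 with h | h <;>
        rcases max_cases (|(g : Lp ℝ (ENNReal.ofReal p) μ) y| - 2 * 2 ^ k) 0 with h' | h' <;>
        linarith
    · refine hg.imp (fun hg => ?_) (fun hg => ?_) <;>
      · filter_upwards [hae, hg] with y hy h1 hyb
        rw [hy, h1 hyb, abs_zero, max_eq_right (by linarith), max_eq_right (by linarith)]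
        simp
    · obtain ⟨O, hO, hcap, hcont⟩ := hF.2.2 ε hε
      obtain ⟨V, hV, hVeq⟩ := continuousOn_iff'.1 hcont (G k) (hGo k)
      -- Relative openness in `Oᶜ` gives `V`; adjoining `O` covers the whole superlevel set,
      -- including its part where `F` is uncontrolled.
      refine ⟨O, (V ∪ O) ∩ S, hO, hcap, (hV.union hO).inter hS, ?_, ?_⟩
      · intro y hy
        refine ⟨?_, hy.2⟩
        by_cases hyO : y ∈ O
        · exact Or.inr hyO
        · have : y ∈ F ⁻¹' G k ∩ Oᶜ := ⟨hy.1, hyO⟩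
          rw [hVeq] at this
          exact Or.inl this.1
      · filter_upwards [hae, hgS, hF.2.1] with y h1 h2 h3 hyV hyO
        have hyV' : y ∈ V ∩ Oᶜ := ⟨hyV.1.resolve_right hyO, hyO⟩
        rw [← hVeq] at hyV'
        have h4 : F y ∈ G k := hyV'.1
        rw [h3] at h4
        have h5 : 2 * (2 : ℝ) ^ k ≤ |(g : Lp ℝ (ENNReal.ofReal p) μ) y| := by
          rw [h2 hyV.2, ← zpow_one_add₀ (by norm_num), add_comm 1 k]
          rcases h4 with h4 | h4
          · have := EReal.coe_lt_coe_iff.1 h4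
            exact (by linarith : (2 : ℝ) ^ (k + 1) ≤ _).trans (neg_le_abs _)
          · have := EReal.coe_lt_coe_iff.1 h4
            exact (by linarith : (2 : ℝ) ^ (k + 1) ≤ _).trans (le_abs_self _)
        rw [h1, max_eq_left (by linarith), max_eq_left (by linarith)]
        field_simp
        ring
  calc ∫⁻ y in S, (F y - (c : EReal)).abs ^ p ∂(D.Γ ψ)
      ≤ ∫⁻ y in S, ∑' k : ℤ, (F ⁻¹' G k).indicator
          (fun _ => ENNReal.ofReal ((2 : ℝ) ^ (k + 2)) ^ p) y ∂(D.Γ ψ) := by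
        refine lintegral_mono fun y => (ENNReal.rpow_le_tsum_dyadic hp _).trans_eq ?_
        refine tsum_congr fun k => ?_
        classical
        rw [indicator_apply]
        simp only [hmem]
    _ = ∑' k : ℤ, ENNReal.ofReal ((2 : ℝ) ^ (k + 2)) ^ p * D.Γ ψ (F ⁻¹' G k ∩ S) := by
        rw [lintegral_tsum fun k => (measurable_const.indicator (hGmeas k)).aemeasurable]
        refine tsum_congr fun k => ?_
        rw [lintegral_indicator_const (hGmeas k), Measure.restrict_apply (hGmeas k)]
    _ ≤ ∑' k : ℤ, 4 ^ p * D.Γ (D.dyadicSlice g k) univ := by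
        -- The weight `2^((k+2)p)` meets the scaling factor `2^(-kp)`, leaving `4^p` for every `k`.
        refine ENNReal.tsum_le_tsum fun k => (mul_le_mul_right (hlevel k) _).trans_eq ?_
        rw [← mul_assoc, ENNReal.ofReal_rpow_of_pos (by positivity),
          ← ENNReal.ofReal_mul (by positivity), abs_of_pos (by positivity),
          ← Real.mul_rpow (by positivity) (by positivity), zpow_add₀ (by norm_num),
          mul_right_comm, mul_inv_cancel₀ (by positivity), one_mul,
          ← ENNReal.ofReal_rpow_of_pos (by norm_num)]
        norm_num
    _ ≤ 4 ^ p * D.Γ g univ := by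
        rw [ENNReal.tsum_mul_left]
        exact mul_le_mul_right (D.tsum_Γ_dyadicSlice_le hp0 g) _

end StrongType

end PDirichletStructure

/-! ### Averages and bounded overlap. -/

section Averages

variable {X : Type*} [MeasurableSpace X] {μ : Measure X} {p : ℝ}

/-- Hölder's inequality on `s`, in a form without division by the measure. -/
theorem enorm_average_sub_rpow_mul_le (hp : 1 ≤ p) {f : X → ℝ} {s : Set X} (hs : μ s ≠ 0)
    (hs' : μ s ≠ ∞) (hf : IntegrableOn f s μ) (c : ℝ) :
    ‖(⨍ z in s, f z ∂μ) - c‖ₑ ^ p * μ s ≤ ∫⁻ z in s, ‖f z - c‖ₑ ^ p ∂μ := by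
  have hp0 : 0 < p := by linarith
  have hfin : IsFiniteMeasure (μ.restrict s) := ⟨by simpa using hs'.lt_top⟩
  have hreal : μ.real s ≠ 0 := by
    rw [Measure.real, ENNReal.toReal_ne_zero]; exact ⟨hs, hs'⟩
  have h1 : ‖(⨍ z in s, f z ∂μ) - c‖ₑ * μ s = ‖∫ z in s, (f z - c) ∂μ‖ₑ := by
    rw [integral_sub hf (integrable_const c), setAverage_eq, integral_const,
      measureReal_restrict_apply_univ]
    have h2 : μ s = ‖μ.real s‖ₑ := by
      rw [Real.enorm_eq_ofReal measureReal_nonneg, Measure.real, ENNReal.ofReal_toReal hs']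
    rw [h2]
    rw [← enorm_mul]
    congr 1
    simp only [smul_eq_mul]
    field_simp
  have hmeas : AEStronglyMeasurable (fun z => f z - c) (μ.restrict s) :=
    (hf.sub (integrable_const c)).aestronglyMeasurable
  have h3 := eLpNorm'_le_eLpNorm'_mul_rpow_measure_univ (p := 1) (q := p) one_pos hp hmeas
  simp only [eLpNorm', ENNReal.rpow_one, one_div, inv_one, Measure.restrict_apply_univ] at h3
  have h4 := ENNReal.rpow_le_rpow
    (h1.trans_le ((enorm_integral_le_lintegral_enorm _).trans h3)) hp0.le
  rw [ENNReal.mul_rpow_of_nonneg _ _ hp0.le, ENNReal.mul_rpow_of_nonneg _ _ hp0.le,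
    ← ENNReal.rpow_mul, inv_mul_cancel₀ hp0.ne', ENNReal.rpow_one, ← ENNReal.rpow_mul,
    sub_mul, one_mul, inv_mul_cancel₀ hp0.ne'] at h4
  have h5 : μ s ^ p = μ s * μ s ^ (p - 1) := by
    nth_rewrite 2 [← ENNReal.rpow_one (μ s)]
    rw [← ENNReal.rpow_add _ _ hs hs', add_sub_cancel]
  rw [h5, ← mul_assoc] at h4
  exact (ENNReal.mul_le_mul_iff_left
    (by simp [hs, hs', ENNReal.rpow_eq_zero_iff])
    (by simp [hs, hs', ENNReal.rpow_eq_top_iff])).1 h4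

theorem enorm_add_rpow_le (hp : 1 ≤ p) (a b : ℝ) :
    ‖a + b‖ₑ ^ p ≤ 2 ^ (p - 1) * (‖a‖ₑ ^ p + ‖b‖ₑ ^ p) :=
  (ENNReal.rpow_le_rpow (enorm_add_le a b) (by linarith)).trans
    (ENNReal.rpow_add_le_mul_rpow_add_rpow _ _ hp)

theorem enorm_sub_rpow_le (hp : 1 ≤ p) (a b : ℝ) :
    ‖a - b‖ₑ ^ p ≤ 2 ^ (p - 1) * (‖a‖ₑ ^ p + ‖b‖ₑ ^ p) := by
  simpa [sub_eq_add_neg] using enorm_add_rpow_le hp a (-b)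

theorem Lp.ofReal_norm_rpow_eq (hp : 0 < p) (f : Lp ℝ (ENNReal.ofReal p) μ) :
    ENNReal.ofReal (‖f‖ ^ p) = ∫⁻ x, ‖f x‖ₑ ^ p ∂μ := by
  have h0 : ENNReal.ofReal p ≠ 0 := by simpa using hp
  have h1 := eLpNorm_eq_lintegral_rpow_enorm_toReal h0 ENNReal.ofReal_ne_top (f := f) (μ := μ)
  rw [ENNReal.toReal_ofReal hp.le] at h1
  rw [← ENNReal.ofReal_rpow_of_nonneg (by rw [Lp.norm_def]; positivity) hp.le, Lp.norm_def,
    ENNReal.ofReal_toReal (Lp.eLpNorm_ne_top f), h1, ← ENNReal.rpow_mul,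
    one_div_mul_cancel hp.ne', ENNReal.rpow_one]

theorem Lp.integrableOn_of_measure_ne_top [Fact (1 ≤ ENNReal.ofReal p)]
    (f : Lp ℝ (ENNReal.ofReal p) μ) {s : Set X} (hs : μ s ≠ ∞) : IntegrableOn f s μ := by
  have hfin : IsFiniteMeasure (μ.restrict s) := ⟨by simpa using hs.lt_top⟩
  exact ((Lp.memLp f).restrict s).integrable Fact.out

/-- Bounded overlap: the measures of a family of sets sum up to at most `N` times the measure of
their union. -/
theorem sum_measure_le_of_card_le {ι : Type*} (ν : Measure X) (T : Finset ι) (A : ι → Set X)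
    (hA : ∀ i ∈ T, MeasurableSet (A i)) {U : Set X} (hU : MeasurableSet U) (hAU : ∀ i ∈ T, A i ⊆ U)
    {N : ℕ} (R : ι → ι → Prop) [∀ i, DecidablePred (R i)]
    (hR : ∀ i ∈ T, ∀ j ∈ T, ∀ x, x ∈ A i → x ∈ A j → R i j)
    (hN : ∀ i ∈ T, (T.filter (R i)).card ≤ N) :
    ∑ i ∈ T, ν (A i) ≤ N * ν U := by
  calc ∑ i ∈ T, ν (A i) = ∑ i ∈ T, ∫⁻ x, (A i).indicator 1 x ∂ν :=
        Finset.sum_congr rfl fun i hi => (lintegral_indicator_one (hA i hi)).symm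
    _ = ∫⁻ x, ∑ i ∈ T, (A i).indicator 1 x ∂ν :=
        (lintegral_finsetSum' _ fun i hi =>
          (measurable_one.indicator (hA i hi)).aemeasurable).symm
    _ ≤ ∫⁻ x, U.indicator (fun _ => (N : ℝ≥0∞)) x ∂ν := by
        refine lintegral_mono fun x => ?_
        by_cases hx : ∃ i ∈ T, x ∈ A i
        · obtain ⟨i, hi, hxi⟩ := hx
          rw [indicator_of_mem (hAU i hi hxi)]
          calc ∑ j ∈ T, (A j).indicator (1 : X → ℝ≥0∞) x
              ≤ ∑ j ∈ T, if R i j then 1 else 0 := by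
                refine Finset.sum_le_sum fun j hj => ?_
                by_cases hxj : x ∈ A j
                · rw [if_pos (hR i hi j hj x hxi hxj), indicator_of_mem hxj]; simp
                · rw [indicator_of_notMem hxj]; exact zero_le
            _ = ((T.filter (R i)).card : ℝ≥0∞) := by simp
            _ ≤ N := by exact_mod_cast hN i hi
        · push Not at hx
          rw [Finset.sum_eq_zero fun i hi => indicator_of_notMem (hx i hi) _]
          exact zero_le
    _ = N * ν U := lintegral_indicator_const hU _

end Averages

/-! ### Doubling measures and Whitney-type coverings. -/

section Covering

variable {X : Type*} [MetricSpace X] [MeasurableSpace X] {μ : Measure X}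

theorem IsDoublingMeasure.measure_ball_pos (hμ : IsDoublingMeasure μ) (x : X) {r : ℝ}
    (hr : 0 < r) : 0 < μ (Metric.ball x r) := by
  obtain ⟨C, hC⟩ := hμ
  exact (hC x r hr).1

theorem IsDoublingMeasure.measure_ball_lt_top (hμ : IsDoublingMeasure μ) (x : X) (r : ℝ) :
    μ (Metric.ball x r) < ∞ := by
  rcases le_or_gt r 0 with hr | hr
  · rw [Metric.ball_eq_empty.2 hr]; simp
  obtain ⟨C, hC⟩ := hμ
  exact (hC x r hr).2.1

theorem IsDoublingMeasure.exists_measure_ball_le (hμ : IsDoublingMeasure μ) (M : ℝ) :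
    ∃ C : ℝ≥0, ∀ (x y : X) (s t : ℝ), 0 < s → t ≤ M * s → dist x y ≤ M * s →
      μ (Metric.ball y t) ≤ C * μ (Metric.ball x s) := by
  obtain ⟨C, hC⟩ := hμ
  obtain ⟨n, hn⟩ := pow_unbounded_of_one_lt (2 * M) (one_lt_two)
  have hpow : ∀ (k : ℕ) (x : X) (s : ℝ), 0 < s →
      μ (Metric.ball x (2 ^ k * s)) ≤ (C ^ k : ℝ≥0) * μ (Metric.ball x s) := by
    intro k x s hs
    induction k with
    | zero => simp
    | succ k ih =>
      calc μ (Metric.ball x (2 ^ (k + 1) * s)) = μ (Metric.ball x (2 * (2 ^ k * s))) := by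
            rw [pow_succ]; ring_nf
        _ ≤ C * μ (Metric.ball x (2 ^ k * s)) := (hC x _ (by positivity)).2.2
        _ ≤ C * ((C ^ k : ℝ≥0) * μ (Metric.ball x s)) := by gcongr
        _ = _ := by rw [pow_succ]; push_cast; ring
  -- The ball `B(y, t)` lies in `B(x, 2Ms)`, and `2^n` exceeds `2M`.
  refine ⟨C ^ n, fun x y s t hs ht hd => le_trans (measure_mono ?_) (hpow n x s hs)⟩
  refine Metric.ball_subset_ball' ?_
  rw [dist_comm]
  nlinarith

/-- A finite Whitney-type covering of a ball by balls `B(y, 6 s(y))`, with slowly varying radius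
function `s` and bounded overlap. -/
theorem IsDoublingMeasure.exists_cover [BorelSpace X] (hμ : IsDoublingMeasure μ) {K : ℝ} (hK : 1 ≤ K) :
    ∃ N : ℕ, ∀ (x : X) (R : ℝ) (s : X → ℝ) (ε R' : ℝ), 0 < ε → (∀ y, ε ≤ s y) →
      (∀ y ∈ Metric.ball x R, s y ≤ R') → (∀ y z, 4 * K * |s y - s z| ≤ dist y z) →
      ∃ T : Finset X, (∀ y ∈ T, y ∈ Metric.ball x R) ∧
        (∀ z ∈ Metric.ball x R, ∃ y ∈ T, z ∈ Metric.ball y (6 * s y)) ∧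
        ∀ y ∈ T, (T.filter fun z => dist y z < K * (s y + s z)).card ≤ N := by
  -- A neighbourhood of `y` of radius `(3K + 2) s y` contains all small balls of its neighbours `z`;
  -- as `s y ≤ 2 s z`, this radius is at most `(6K + 4) s z`.
  obtain ⟨C, hC⟩ := hμ.exists_measure_ball_le (6 * K + 4)
  refine ⟨⌈C⌉₊, fun x R s ε R' hε hs hR' hlip => ?_⟩
  have hspos : ∀ y, 0 < s y := fun y => hε.trans_le (hs y)
  -- Vitali enlarges closed balls by the factor `5`; the factor `6` in the conclusion leaves room
  -- for open balls.
  obtain ⟨u, hu, hdisj, hcov⟩ := Vitali.exists_disjoint_subfamily_covering_enlargement_closedBall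
    (Metric.ball x R) (fun y => y) s R' hR' 5 (by norm_num)
  have hdisj' : u.PairwiseDisjoint fun y => Metric.ball y (s y) := fun y hy z hz hyz =>
    (hdisj hy hz hyz).mono Metric.ball_subset_closedBall Metric.ball_subset_closedBall
  have hfin : u.Finite := by
    rcases u.eq_empty_or_nonempty with rfl | ⟨y0, hy0⟩
    · exact finite_empty
    have hR : 0 < R := Metric.pos_of_mem_ball (hu hy0)
    obtain ⟨C', hC'⟩ := hμ.exists_measure_ball_le (R / ε)
    have hC'0 : (C' : ℝ≥0∞) ≠ 0 := by
      rintro h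
      have := hC' x x ε R hε (by field_simp; exact le_rfl) (by simp; positivity)
      rw [h, zero_mul] at this
      exact absurd this (not_le.2 (hμ.measure_ball_pos x hR))
    -- The lower bound `ε` on the radii gives the disjoint balls a common lower bound for their
    -- measures inside one ball of finite measure, so there are finitely many. This count depends on
    -- `ε`, but the overlap bound does not.
    have hlow : ∀ y ∈ u, μ (Metric.ball x R) / C' ≤ μ (Metric.ball y (s y)) := fun y hy => by
      rw [ENNReal.div_le_iff' hC'0 ENNReal.coe_ne_top]
      have h1 : R ≤ R / ε * s y := by
        rw [div_mul_eq_mul_div, le_div_iff₀ hε]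
        exact mul_le_mul_of_nonneg_left (hs y) hR.le
      exact hC' y x (s y) R (hspos y) h1 ((Metric.mem_ball.1 (hu hy)).le.trans h1)
    have h2 := Measure.finite_const_le_meas_of_disjoint_iUnion μ
      (ε := μ (Metric.ball x R) / C')
      (ENNReal.div_pos (hμ.measure_ball_pos x hR).ne' ENNReal.coe_ne_top)
      (As := fun y : u => Metric.ball (y : X) (s y)) (fun _ => Metric.isOpen_ball.measurableSet)
      (fun a b hab => hdisj' a.2 b.2 (Subtype.coe_injective.ne hab))
      ((measure_mono (iUnion_subset fun y : u => Metric.ball_subset_ball' (ε₂ := R' + R)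
        (add_le_add (hR' y (hu y.2)) (Metric.mem_ball.1 (hu y.2)).le))).trans_lt
        (hμ.measure_ball_lt_top x (R' + R))).ne
    have h3 : {i : u | μ (Metric.ball x R) / C' ≤ μ (Metric.ball (i : X) (s i))} = univ :=
      eq_univ_of_forall fun i => hlow i i.2
    rw [h3] at h2
    exact Set.finite_coe_iff.1 (Set.finite_univ_iff.1 h2)
  refine ⟨hfin.toFinset, fun y hy => hu (hfin.mem_toFinset.1 hy), fun z hz => ?_, fun y hy => ?_⟩
  · obtain ⟨y, hy, hzy⟩ := hcov z hz
    refine ⟨y, hfin.mem_toFinset.2 hy, ?_⟩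
    have := hzy (Metric.mem_closedBall_self (hspos z).le)
    exact Metric.closedBall_subset_ball (by linarith [hspos y]) this
  · set S := hfin.toFinset.filter fun z => dist y z < K * (s y + s z) with hS
    have hcomp : ∀ z ∈ S, s z ≤ 2 * s y ∧ s y ≤ 2 * s z ∧ z ∈ u ∧ dist y z < K * (s y + s z) := by
      intro z hz
      obtain ⟨hz1, hz2⟩ := Finset.mem_filter.1 hz
      have h1 := (hlip y z).trans hz2.le
      have h2 : 4 * |s y - s z| ≤ s y + s z := by
        have : K * (4 * |s y - s z|) ≤ K * (s y + s z) := by linarith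
        exact le_of_mul_le_mul_left this (by linarith)
      have h3 := le_abs_self (s y - s z)
      have h4 := neg_le_abs (s y - s z)
      exact ⟨by linarith, by linarith, hfin.mem_toFinset.1 hz1, hz2⟩
    set r := (3 * K + 2) * s y with hr
    have hsy := hspos y
    have hpos : 0 < μ (Metric.ball y r) := hμ.measure_ball_pos y (by positivity)
    have hsum : (S.card : ℝ≥0∞) * μ (Metric.ball y r) ≤ C * μ (Metric.ball y r) := by
      calc (S.card : ℝ≥0∞) * μ (Metric.ball y r) = ∑ z ∈ S, μ (Metric.ball y r) := by simp
        _ ≤ ∑ z ∈ S, C * μ (Metric.ball z (s z)) := by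
            refine Finset.sum_le_sum fun z hz => ?_
            obtain ⟨h1, h2, -, h4⟩ := hcomp z hz
            have hKz : K * s y ≤ K * (2 * s z) := by gcongr
            refine hC z y (s z) r (hspos z) (by rw [hr]; nlinarith) ?_
            rw [dist_comm]; nlinarith [hspos z]
        _ = C * μ (⋃ z ∈ S, Metric.ball z (s z)) := by
            rw [← Finset.mul_sum, measure_biUnion_finset]
            · exact fun a ha b hb hab => hdisj' (hcomp a ha).2.2.1 (hcomp b hb).2.2.1 hab
            · exact fun _ _ => Metric.isOpen_ball.measurableSet
        _ ≤ C * μ (Metric.ball y r) := by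
            gcongr
            refine iUnion₂_subset fun z hz => Metric.ball_subset_ball' ?_
            obtain ⟨h1, h2, -, h4⟩ := hcomp z hz
            have hKz : K * s z ≤ K * (2 * s y) := by gcongr
            rw [dist_comm, hr]; nlinarith
    rw [ENNReal.mul_le_mul_iff_left hpos.ne' (hμ.measure_ball_lt_top y r).ne] at hsum
    have : (S.card : ℝ≥0) ≤ C := by exact_mod_cast hsum
    exact_mod_cast this.trans (Nat.le_ceil C)

end Covering

/-! ### Comparison and decay of the scale function. -/

section Scale

variable {X : Type*} [MetricSpace X]

theorem AdmissibleRadius.mono {r s : ℝ} (hr : AdmissibleRadius X r) (hs : 0 < s) (hsr : s ≤ r) :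
    AdmissibleRadius X s :=
  ⟨hs, (ENNReal.ofReal_le_ofReal hsr).trans hr.2⟩

theorem IsRegularScale.exists_le_mul {Ψ : X → ℝ → ℝ} (hΨ : IsRegularScale Ψ) (M : ℝ) :
    ∃ C : ℝ, 0 < C ∧ ∀ (x y : X) (s r : ℝ), 0 < s → s ≤ r → AdmissibleRadius X r → r ≤ M * s →
      dist x y ≤ M * s → Ψ x r ≤ C * Ψ y s := by
  obtain ⟨-, hpos, C, βm, βp, hC, hm, hp, h⟩ := hΨ
  refine ⟨C * (max M 1) ^ βp, by positivity, fun x y s r hs hsr hr hrM hd => ?_⟩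
  have h1 := (h x y s r hs hsr hr).2
  rw [div_le_iff₀ (hpos y s hs)] at h1
  have hr0 : 0 < r := hr.1
  have hmax : 0 < max r (dist x y) := lt_max_of_lt_left hr0
  refine h1.trans ?_
  have hΨ0 := (hpos y s hs).le
  gcongr ?_ * _
  calc C * (r / max r (dist x y)) ^ βm * (max r (dist x y) / s) ^ βp
      ≤ C * 1 * (max M 1) ^ βp := by
        gcongr
        · exact Real.rpow_le_one (by positivity) ((div_le_one hmax).2 (le_max_left _ _)) hm.le
        · rw [div_le_iff₀ hs]
          exact (max_le hrM hd).trans (by gcongr; exact le_max_left _ _)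
    _ = _ := by ring

/-- The lower bound for `Ψ x r / Ψ y s` grows like `(r/s)^βm`, uniformly for `y` in a bounded set.
Hence `Ψ y s` tends to zero uniformly there, which makes Poincaré errors vanish on fine meshes. -/
theorem IsRegularScale.exists_small {Ψ : X → ℝ → ℝ} (hΨ : IsRegularScale Ψ) (x : X) (R : ℝ)
    {r η : ℝ} (hr : AdmissibleRadius X r) (hη : 0 < η) :
    ∃ δ : ℝ, 0 < δ ∧ δ ≤ r ∧ ∀ s, 0 < s → s ≤ δ → ∀ y ∈ Metric.ball x R, Ψ y s ≤ η := by
  obtain ⟨-, hpos, C, βm, βp, hC, hm, hp, h⟩ := hΨ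
  have hr0 : 0 < r := hr.1
  set q : ℝ := r / (r + |R|) with hq
  have hq0 : 0 < q := by positivity
  set A : ℝ := Ψ x r * C * (q ^ βp)⁻¹ with hA
  have hA0 : 0 < A := by have := hpos x r hr0; positivity
  refine ⟨min r (r * (η / A) ^ (1 / βm)), by positivity, min_le_left _ _,
    fun s hs hsδ y hy => ?_⟩
  have hsr : s ≤ r := hsδ.trans (min_le_left _ _)
  have h1 := (h x y s r hs hsr hr).1
  have hΨ0 := hpos y s hs
  have hmax : 0 < max r (dist x y) := lt_max_of_lt_left hr0
  have hd : dist x y ≤ |R| := by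
    rw [dist_comm]; exact (Metric.mem_ball.1 hy).le.trans (le_abs_self R)
  have h2 : C⁻¹ * q ^ βp * (r / s) ^ βm ≤ Ψ x r / Ψ y s := by
    have h3 : q ≤ r / max r (dist x y) :=
      div_le_div_of_nonneg_left hr0.le hmax
        (max_le (by linarith [abs_nonneg R]) (by linarith))
    have h4 : r / s ≤ max r (dist x y) / s :=
      div_le_div_of_nonneg_right (le_max_left _ _) hs.le
    refine le_trans ?_ h1
    exact mul_le_mul (mul_le_mul_of_nonneg_left (Real.rpow_le_rpow hq0.le h3 hp.le)
      (by positivity)) (Real.rpow_le_rpow (by positivity) h4 hm.le) (by positivity) (by positivity)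
  rw [le_div_iff₀ hΨ0] at h2
  have h3 : (s / r) ^ βm ≤ η / A := by
    have h4 : s / r ≤ (η / A) ^ (1 / βm) := by
      rw [div_le_iff₀' hr0]; exact hsδ.trans (min_le_right _ _)
    have h5 := Real.rpow_le_rpow (by positivity) h4 hm.le
    rwa [← Real.rpow_mul (by positivity), one_div_mul_cancel hm.ne', Real.rpow_one] at h5
  have h6 : Ψ y s ≤ A * (s / r) ^ βm := by
    have h7 : (s / r) ^ βm * (r / s) ^ βm = 1 := by
      rw [← Real.mul_rpow (by positivity) (by positivity)]
      have : s / r * (r / s) = 1 := by field_simp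
      rw [this, Real.one_rpow]
    have h8 : (C * (q ^ βp)⁻¹ * (s / r) ^ βm) * (C⁻¹ * q ^ βp * (r / s) ^ βm * Ψ y s) = Ψ y s := by
      calc _ = (C * C⁻¹) * ((q ^ βp)⁻¹ * q ^ βp) * ((s / r) ^ βm * (r / s) ^ βm) * Ψ y s := by ring
        _ = _ := by
          rw [h7, mul_inv_cancel₀ hC.ne', inv_mul_cancel₀ (by positivity)]; ring
    rw [← h8, hA]
    calc _ ≤ (C * (q ^ βp)⁻¹ * (s / r) ^ βm) * Ψ x r := by gcongr
      _ = _ := by ring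
  refine h6.trans ?_
  calc A * (s / r) ^ βm ≤ A * (η / A) := by gcongr
    _ = η := by field_simp

end Scale

theorem ENNReal.exists_pos_mul_ofReal_le {A ε : ℝ≥0∞} (hA : A ≠ ∞) (hε : ε ≠ 0) :
    ∃ η : ℝ, 0 < η ∧ η ≤ 1 ∧ A * ENNReal.ofReal η ≤ ε := by
  have h1 : min (ε / (A + 1)) 1 ≠ ∞ := ne_top_of_le_ne_top (by simp) (min_le_right _ _)
  have h0 : min (ε / (A + 1)) 1 ≠ 0 := by
    have : 0 < min (ε / (A + 1)) 1 := lt_min (ENNReal.div_pos hε (by simp [hA])) one_pos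
    exact this.ne'
  refine ⟨(min (ε / (A + 1)) 1).toReal, ENNReal.toReal_pos h0 h1, ?_, ?_⟩
  · simpa using ENNReal.toReal_mono (by simp) (min_le_right (ε / (A + 1)) 1)
  · rw [ENNReal.ofReal_toReal h1]
    calc A * min (ε / (A + 1)) 1 ≤ (A + 1) * (ε / (A + 1)) := by
          gcongr
          · exact le_self_add
          · exact min_le_left _ _
      _ = ε := ENNReal.mul_div_cancel (by simp) (by simp [hA])

theorem lintegral_biUnion_finset_le {X ι : Type*} [MeasurableSpace X] (μ : Measure X)
    (T : Finset ι) (A : ι → Set X) (f : X → ℝ≥0∞) :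
    ∫⁻ x in ⋃ i ∈ T, A i, f x ∂μ ≤ ∑ i ∈ T, ∫⁻ x in A i, f x ∂μ := by
  have h := lintegral_iUnion_le (μ := μ) (fun i : T => A i) f
  rwa [tsum_fintype, Finset.sum_coe_sort T fun i => ∫⁻ x in A i, f x ∂μ, iUnion_subtype] at h

theorem Lp.exists_subseq_ae_tendsto {X : Type*} [MeasurableSpace X] {μ : Measure X} {p : ℝ}
    [Fact (1 ≤ ENNReal.ofReal p)] {u : ℕ → Lp ℝ (ENNReal.ofReal p) μ}
    {f : Lp ℝ (ENNReal.ofReal p) μ} (h : Tendsto (fun n => ‖u n - f‖) atTop (𝓝 0)) :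
    ∃ ns : ℕ → ℕ, StrictMono ns ∧ ∀ᵐ x ∂μ, Tendsto (fun i => u (ns i) x) atTop (𝓝 (f x)) :=
  (tendstoInMeasure_of_tendsto_Lp (tendsto_iff_norm_sub_tendsto_zero.2 h)).exists_seq_tendsto_ae

namespace PDirichletStructure

variable {X : Type*} [MetricSpace X] [MeasurableSpace X] [BorelSpace X] {μ : Measure X} {p : ℝ}

/-! ### Rellich compactness. -/

section Compactness

variable (D : PDirichletStructure X μ p)

/-- The Poincaré inequality with explicit constants. -/
def PoincareBound (Ψ : X → ℝ → ℝ) (C Λ : ℝ) : Prop :=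
  ∀ (x : X) (r : ℝ), AdmissibleRadius X r → ∀ f : D.dom,
    ∫⁻ y in Metric.ball x r, ‖(f : Lp ℝ (ENNReal.ofReal p) μ) y
        - ⨍ z in Metric.ball x r, (f : Lp ℝ (ENNReal.ofReal p) μ) z ∂μ‖ₑ ^ p ∂μ
      ≤ ENNReal.ofReal C * ENNReal.ofReal (Ψ x r) * D.Γ f (Metric.ball x (Λ * r))

theorem Poincare.exists_bound {D : PDirichletStructure X μ p} {Ψ : X → ℝ → ℝ} (hp : 0 ≤ p)
    (hμ : IsDoublingMeasure μ) (h : D.Poincare Ψ) :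
    ∃ C Λ : ℝ, 0 < C ∧ 1 ≤ Λ ∧ D.PoincareBound Ψ C Λ := by
  obtain ⟨C, Λ, hC, hΛ, h⟩ := h
  refine ⟨C, max Λ 1, hC, le_max_right _ _, fun x r hr f => ?_⟩
  have h1 := h x r hr f
  rw [setLAverage_eq, ENNReal.div_le_iff (hμ.measure_ball_pos x hr.1).ne'
    (hμ.measure_ball_lt_top x r).ne] at h1
  simp only [Real.enorm_eq_ofReal_abs, ENNReal.ofReal_rpow_of_nonneg (abs_nonneg _) hp]
  refine h1.trans ?_
  calc ENNReal.ofReal C * (ENNReal.ofReal (Ψ x r) / μ (Metric.ball x r))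
        * D.Γ f (Metric.ball x (Λ * r)) * μ (Metric.ball x r)
      = ENNReal.ofReal C * (ENNReal.ofReal (Ψ x r) / μ (Metric.ball x r) * μ (Metric.ball x r))
        * D.Γ f (Metric.ball x (Λ * r)) := by ring
    _ ≤ _ := by
        rw [ENNReal.div_mul_cancel (hμ.measure_ball_pos x hr.1).ne'
          (hμ.measure_ball_lt_top x r).ne]
        gcongr
        · exact hr.1.le
        · exact le_max_left _ _

/-- Poincaré enlarges `B(y, 12 s y)` to radius `12 Λ s y ≤ K s y`; two enlarged balls can meet only
for `K`-neighbours, so the overlap bound sums the local energies. -/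
theorem sum_oscillation_le {Ψ : X → ℝ → ℝ} {C Λ K : ℝ}
    (hPI : D.PoincareBound Ψ C Λ) (hK : 12 * Λ ≤ K) {s : X → ℝ} {T : Finset X} {N : ℕ}
    (hs : ∀ y ∈ T, 0 < s y)
    (hT : ∀ y ∈ T, (T.filter fun z => dist y z < K * (s y + s z)).card ≤ N) {T' : Finset X}
    (hT' : T' ⊆ T) {η : ℝ} (hadm : ∀ y ∈ T', AdmissibleRadius X (12 * s y))
    (hη : ∀ y ∈ T', Ψ y (12 * s y) ≤ η) (f : D.dom) :
    ∑ y ∈ T', ∫⁻ z in Metric.ball y (12 * s y), ‖(f : Lp ℝ (ENNReal.ofReal p) μ) z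
        - ⨍ w in Metric.ball y (12 * s y), (f : Lp ℝ (ENNReal.ofReal p) μ) w ∂μ‖ₑ ^ p ∂μ
      ≤ ENNReal.ofReal C * ENNReal.ofReal η * (N * D.Γ f univ) := by
  calc _ ≤ ∑ y ∈ T', ENNReal.ofReal C * ENNReal.ofReal η *
        D.Γ f (Metric.ball y (Λ * (12 * s y))) := by
        refine Finset.sum_le_sum fun y hy => (hPI y _ (hadm y hy) f).trans ?_
        gcongr
        exact hη y hy
    _ = ENNReal.ofReal C * ENNReal.ofReal η *
        ∑ y ∈ T', D.Γ f (Metric.ball y (Λ * (12 * s y))) := by rw [Finset.mul_sum]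
    _ ≤ _ := by
        gcongr
        refine (Finset.sum_le_sum_of_subset hT').trans ?_
        refine sum_measure_le_of_card_le _ T _ (fun _ _ => Metric.isOpen_ball.measurableSet)
          MeasurableSet.univ (fun _ _ => subset_univ _) (fun y z => dist y z < K * (s y + s z))
          (fun y hy z hz w hw1 hw2 => ?_) hT
        have h1 := Metric.mem_ball.1 hw1
        have h2 := Metric.mem_ball.1 hw2
        have h3 := dist_triangle_left y z w
        have h4 : 12 * Λ * s y ≤ K * s y := by have := hs y hy; gcongr
        have h5 : 12 * Λ * s z ≤ K * s z := by have := hs z hz; gcongr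
        nlinarith

variable [Fact (1 ≤ ENNReal.ofReal p)]

/-- Rellich compactness: functions in the domain with a common bounded support and bounded norms
have a subsequence that converges in `L^p`. -/
theorem exists_subseq_tendsto (hp : 1 ≤ p) (hμ : IsDoublingMeasure μ) {Ψ : X → ℝ → ℝ}
    (hΨ : IsRegularScale Ψ) {C Λ : ℝ} (hΛ : 1 ≤ Λ) (hPI : D.PoincareBound Ψ C Λ)
    {r₀ : ℝ} (hr₀ : AdmissibleRadius X r₀) (x : X) (R : ℝ) {M : ℝ≥0∞} (hM : M ≠ ∞)
    (u : ℕ → D.dom)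
    (hu : ∀ n, ∀ᵐ y ∂μ, y ∉ Metric.ball x R → (u n : Lp ℝ (ENNReal.ofReal p) μ) y = 0)
    (hnorm : ∀ n, ∫⁻ y, ‖(u n : Lp ℝ (ENNReal.ofReal p) μ) y‖ₑ ^ p ∂μ ≤ M)
    (hE : ∀ n, D.Γ (u n) univ ≤ M) :
    ∃ (f : Lp ℝ (ENNReal.ofReal p) μ) (φ : ℕ → ℕ), StrictMono φ ∧
      Tendsto (fun n => ‖(u (φ n) : Lp ℝ (ENNReal.ofReal p) μ) - f‖) atTop (𝓝 0) := by
  classical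
  have hp0 : 0 < p := by linarith
  suffices htb : TotallyBounded (range fun n => (u n : Lp ℝ (ENNReal.ofReal p) μ)) by
    have hcomp : IsCompact (closure (range fun n => (u n : Lp ℝ (ENNReal.ofReal p) μ))) :=
      htb.closure.isCompact_of_isClosed isClosed_closure
    obtain ⟨f, -, φ, hφ, hlim⟩ := hcomp.tendsto_subseq
      (x := fun n => (u n : Lp ℝ (ENNReal.ofReal p) μ)) (fun n => subset_closure (mem_range_self n))
    exact ⟨f, φ, hφ, tendsto_iff_norm_sub_tendsto_zero.1 hlim⟩
  -- Each function is encoded by its averages over finitely many balls of radius `δ`, rounded down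
  -- to multiples of `θ`. Equal codes force nearly equal averages, and Poincaré then forces `L^p`
  -- closeness.
  refine Metric.totallyBounded_of_finite_discretization fun ε hε => ?_
  have hε0 : ENNReal.ofReal (ε ^ p) / 4 ≠ 0 := by
    have : 0 < ENNReal.ofReal (ε ^ p) := ENNReal.ofReal_pos.2 (by positivity)
    exact (ENNReal.div_pos this.ne' (by norm_num)).ne'
  have h2top : (2 : ℝ≥0∞) ^ (p - 1) ≠ ∞ :=
    ENNReal.rpow_ne_top_of_nonneg (by linarith) (by simp)
  obtain ⟨N, hN⟩ := hμ.exists_cover (K := 12 * Λ) (by linarith)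
  obtain ⟨η, hη, -, hηle⟩ := ENNReal.exists_pos_mul_ofReal_le
    (A := 2 ^ (p - 1) * (ENNReal.ofReal C * (N * (2 ^ (p - 1) * (M + M)))))
    (by finiteness) hε0
  obtain ⟨δ, hδ, hδr, hδΨ⟩ := hΨ.exists_small x R hr₀ hη
  -- The constant radius function `δ/12` turns the balls `B(y, 12 s y)` of the oscillation estimate
  -- into balls of radius `δ`.
  obtain ⟨T, hTx, hTcov, hTcard⟩ := hN x R (fun _ => δ / 12) (δ / 12) (δ / 12) (by positivity)
    (fun _ => le_rfl) (fun _ _ => le_rfl) (fun y z => by simp)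
  have h12 : 12 * (δ / 12) = δ := by ring
  have hfin : ∀ y, μ (Metric.ball y δ) ≠ ∞ := fun y => (hμ.measure_ball_lt_top y δ).ne
  have hpos : ∀ y, μ (Metric.ball y δ) ≠ 0 := fun y => (hμ.measure_ball_pos y hδ).ne'
  obtain ⟨θ, hθ, hθ1, hθle⟩ := ENNReal.exists_pos_mul_ofReal_le
    (A := 2 ^ (p - 1) * ∑ y ∈ T, μ (Metric.ball y δ))
    (ENNReal.mul_ne_top h2top (ENNReal.sum_ne_top.2 fun y _ => hfin y)) hε0
  set av : X → Lp ℝ (ENNReal.ofReal p) μ → ℝ := fun y f => ⨍ z in Metric.ball y δ, f z ∂μ with hav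
  have hkey : ∀ m n, (∀ y ∈ T, |av y (u m) - av y (u n)| < θ) →
      ‖(u m : Lp ℝ (ENNReal.ofReal p) μ) - u n‖ < ε := by
    intro m n hmn
    set w : D.dom := u m - u n with hw
    have hwE : D.Γ w univ ≤ 2 ^ (p - 1) * (M + M) :=
      (D.Γ_sub_le hp _ _ MeasurableSet.univ).trans (by gcongr <;> apply hE)
    have havw : ∀ y, av y w = av y (u m) - av y (u n) := by
      intro y
      simp only [hav, setAverage_eq, ← smul_sub]
      rw [← integral_sub (Lp.integrableOn_of_measure_ne_top _ (hfin y))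
        (Lp.integrableOn_of_measure_ne_top _ (hfin y))]
      congr 1
      exact integral_congr_ae (ae_restrict_of_ae (D.coeFn_sub (u m) (u n)))
    have hsupp : ∫⁻ y, ‖(w : Lp ℝ (ENNReal.ofReal p) μ) y‖ₑ ^ p ∂μ
        = ∫⁻ y in Metric.ball x R, ‖(w : Lp ℝ (ENNReal.ofReal p) μ) y‖ₑ ^ p ∂μ := by
      rw [← lintegral_indicator Metric.isOpen_ball.measurableSet]
      refine lintegral_congr_ae ?_
      filter_upwards [D.coeFn_sub (u m) (u n), hu m, hu n] with y h1 h2 h3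
      by_cases hy : y ∈ Metric.ball x R
      · rw [indicator_of_mem hy]
      · rw [indicator_of_notMem hy, hw, h1, h2 hy, h3 hy]; simp [hp0]
    have hosc := D.sum_oscillation_le (K := 12 * Λ) hPI le_rfl (s := fun _ => δ / 12)
      (fun _ _ => by positivity) hTcard (subset_refl T) (η := η)
      (fun y _ => by rw [h12]; exact hr₀.mono hδ hδr)
      (fun y hy => by rw [h12]; exact hδΨ δ hδ le_rfl y (hTx y hy)) w
    simp only [h12] at hosc
    have hint : ∫⁻ y, ‖(w : Lp ℝ (ENNReal.ofReal p) μ) y‖ₑ ^ p ∂μ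
        ≤ ENNReal.ofReal (ε ^ p) / 4 + ENNReal.ofReal (ε ^ p) / 4 := by
      calc ∫⁻ y, ‖(w : Lp ℝ (ENNReal.ofReal p) μ) y‖ₑ ^ p ∂μ
          ≤ ∑ y ∈ T, ∫⁻ z in Metric.ball y δ, ‖(w : Lp ℝ (ENNReal.ofReal p) μ) z‖ₑ ^ p ∂μ := by
            rw [hsupp]
            refine (lintegral_mono_set (t := ⋃ y ∈ T, Metric.ball y δ) fun z hz => ?_).trans
              (lintegral_biUnion_finset_le μ T _ _)
            obtain ⟨y, hy, hzy⟩ := hTcov z hz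
            exact mem_biUnion hy (Metric.ball_subset_ball (by linarith) hzy)
        _ ≤ ∑ y ∈ T, 2 ^ (p - 1) * (∫⁻ z in Metric.ball y δ,
              ‖(w : Lp ℝ (ENNReal.ofReal p) μ) z - av y w‖ₑ ^ p ∂μ
              + ENNReal.ofReal θ * μ (Metric.ball y δ)) := by
            refine Finset.sum_le_sum fun y hy => ?_
            calc _ ≤ ∫⁻ z in Metric.ball y δ, 2 ^ (p - 1) *
                  (‖(w : Lp ℝ (ENNReal.ofReal p) μ) z - av y w‖ₑ ^ p + ENNReal.ofReal θ) ∂μ := by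
                  refine lintegral_mono fun z => ?_
                  have h1 := enorm_add_rpow_le hp ((w : Lp ℝ (ENNReal.ofReal p) μ) z - av y w)
                    (av y w)
                  rw [sub_add_cancel] at h1
                  refine h1.trans ?_
                  gcongr
                  rw [havw, Real.enorm_eq_ofReal_abs,
                    ENNReal.ofReal_rpow_of_nonneg (abs_nonneg _) hp0.le]
                  refine ENNReal.ofReal_le_ofReal ?_
                  have h2 := hmn y hy
                  calc _ ≤ θ ^ p := by gcongr
                    _ ≤ θ ^ (1 : ℝ) := Real.rpow_le_rpow_of_exponent_ge hθ hθ1 hp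
                    _ = θ := Real.rpow_one θ
              _ = _ := by
                  rw [lintegral_const_mul' _ _ h2top, lintegral_add_right _ measurable_const]
                  simp
        _ = 2 ^ (p - 1) * ∑ y ∈ T, (∫⁻ z in Metric.ball y δ,
              ‖(w : Lp ℝ (ENNReal.ofReal p) μ) z - av y w‖ₑ ^ p ∂μ)
              + 2 ^ (p - 1) * (∑ y ∈ T, μ (Metric.ball y δ)) * ENNReal.ofReal θ := by
            rw [← Finset.mul_sum, Finset.sum_add_distrib, mul_add, ← Finset.mul_sum]
            ring
        _ ≤ _ := by
            refine add_le_add ?_ hθle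
            refine le_trans ?_ hηle
            calc _ ≤ 2 ^ (p - 1) * (ENNReal.ofReal C * ENNReal.ofReal η *
                  (N * (2 ^ (p - 1) * (M + M)))) := by
                  gcongr
                  exact hosc.trans (by gcongr)
              _ = _ := by ring
    rw [← Lp.ofReal_norm_rpow_eq hp0] at hint
    have hlt : ENNReal.ofReal (ε ^ p) / 4 + ENNReal.ofReal (ε ^ p) / 4 < ENNReal.ofReal (ε ^ p) := by
      have he : (0 : ℝ) < ε ^ p := by positivity
      rw [show (4 : ℝ≥0∞) = ENNReal.ofReal 4 by norm_num, ← ENNReal.ofReal_div_of_pos (by norm_num),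
        ← ENNReal.ofReal_add (by positivity) (by positivity), ENNReal.ofReal_lt_ofReal_iff he]
      linarith
    have h3 := (ENNReal.ofReal_lt_ofReal_iff (by positivity)).1 (hint.trans_lt hlt)
    exact (Real.rpow_lt_rpow_iff (norm_nonneg _) hε.le hp0).1 h3
  have hbound : ∀ y, ∃ B : ℕ, ∀ n, |av y (u n)| ≤ B := by
    intro y
    have hne : M / μ (Metric.ball y δ) ≠ ∞ := ENNReal.div_ne_top hM (hpos y)
    obtain ⟨B, hB⟩ := exists_nat_ge (((M / μ (Metric.ball y δ)) ^ (1 / p)).toReal)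
    refine ⟨B, fun n => le_trans ?_ hB⟩
    have h1 := enorm_average_sub_rpow_mul_le hp (hpos y) (hfin y)
      (Lp.integrableOn_of_measure_ne_top (u n : Lp ℝ (ENNReal.ofReal p) μ) (hfin y)) 0
    simp only [sub_zero] at h1
    have h2 : ‖av y (u n)‖ₑ ^ p ≤ M / μ (Metric.ball y δ) := by
      rw [ENNReal.le_div_iff_mul_le (Or.inl (hpos y)) (Or.inl (hfin y))]
      exact h1.trans ((setLIntegral_le_lintegral _ _).trans (hnorm n))
    have h3 := ENNReal.rpow_le_rpow h2 (by positivity : 0 ≤ 1 / p)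
    rw [← ENNReal.rpow_mul, mul_one_div_cancel hp0.ne', ENNReal.rpow_one] at h3
    have h4 := ENNReal.toReal_mono (ENNReal.rpow_ne_top_of_nonneg (by positivity) hne) h3
    simpa using h4
  choose B hB using hbound
  have hfloor : ∀ y n, ⌊av y (u n) / θ⌋ ∈ Finset.Icc (⌊-(B y : ℝ) / θ⌋) (⌊(B y : ℝ) / θ⌋) := by
    intro y n
    have := abs_le.1 (hB y n)
    exact Finset.mem_Icc.2 ⟨Int.floor_le_floor (by gcongr; exact this.1),
      Int.floor_le_floor (by gcongr; exact this.2)⟩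
  refine ⟨(y : T) → Finset.Icc (⌊-(B y : ℝ) / θ⌋) (⌊(B y : ℝ) / θ⌋), inferInstance,
    fun f y => ⟨⌊av y f / θ⌋, by obtain ⟨_, n, rfl⟩ := f; exact hfloor y n⟩, ?_⟩
  rintro ⟨_, m, rfl⟩ ⟨_, n, rfl⟩ hmn
  rw [dist_eq_norm]
  refine hkey m n fun y hy => ?_
  have h1 := congrFun hmn ⟨y, hy⟩
  have h2 := Int.abs_sub_lt_one_of_floor_eq_floor (Subtype.mk.inj h1)
  rw [← sub_div, abs_div, abs_of_pos hθ, div_lt_one hθ] at h2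
  exact h2

end Compactness

end PDirichletStructure

namespace PDirichletStructure

variable {X : Type*} [MetricSpace X] [MeasurableSpace X] [BorelSpace X] {μ : Measure X} {p : ℝ}

/-! ### Existence of capacity minimizers. -/

section Minimizer

variable (D : PDirichletStructure X μ p)

theorem IsCutoff.clamp {D : PDirichletStructure X μ p} {x : X} {r : ℝ} {φ : D.dom}
    (h : D.IsCutoff x r φ) : D.IsCutoff x r (D.clamp φ) := by
  refine ⟨?_, ?_⟩
  · filter_upwards [h.1, D.coeFn_clamp φ] with y h1 h2 hy
    rw [h2, h1 hy]; simp
  · filter_upwards [h.2, D.coeFn_clamp φ] with y h1 h2 hy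
    rw [h2, h1 hy]; simp

theorem CapUpperBound.exists_cutoff {D : PDirichletStructure X μ p} {Ψ : X → ℝ → ℝ}
    (h : D.CapUpperBound Ψ) : ∃ C : ℝ, 0 < C ∧ ∀ (x : X) (r : ℝ), AdmissibleRadius X r →
    ∃ ψ : D.dom, D.IsCutoff x r ψ ∧
      (∀ᵐ y ∂μ, (ψ : Lp ℝ (ENNReal.ofReal p) μ) y ∈ Icc (0 : ℝ) 1) ∧
      D.Γ ψ univ ≤ ENNReal.ofReal C * (μ (Metric.ball x r) / ENNReal.ofReal (Ψ x r)) := by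
  obtain ⟨C, hC, h⟩ := h
  refine ⟨C, hC, fun x r hr => ?_⟩
  obtain ⟨ψ, φ, -, hae, h1, h2, h3⟩ := h x r hr
  refine ⟨D.clamp ψ, IsCutoff.clamp ⟨?_, ?_⟩, ?_, (D.Γ_clamp_le _ _).trans h3⟩
  · filter_upwards [hae] with y hy hyb
    rw [hy, h1 y hyb]
  · filter_upwards [hae] with y hy hyb
    rw [hy, h2 y hyb]
  · filter_upwards [D.coeFn_clamp ψ] with y hy
    rw [hy]
    exact ⟨le_max_right _ _, max_le (min_le_right _ _) zero_le_one⟩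

variable [Fact (1 ≤ ENNReal.ofReal p)]

/-- Rellich compactness combined with lower semicontinuity of the energy. -/
theorem exists_limit (hp : 1 ≤ p) (hμ : IsDoublingMeasure μ) {Ψ : X → ℝ → ℝ}
    (hΨ : IsRegularScale Ψ) {C Λ : ℝ} (hΛ : 1 ≤ Λ) (hPI : D.PoincareBound Ψ C Λ)
    {r₀ : ℝ} (hr₀ : AdmissibleRadius X r₀) (x : X) (R : ℝ) {M : ℝ≥0∞} (hM : M ≠ ∞)
    (u : ℕ → D.dom)
    (hu : ∀ n, ∀ᵐ y ∂μ, y ∉ Metric.ball x R → (u n : Lp ℝ (ENNReal.ofReal p) μ) y = 0)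
    (hnorm : ∀ n, ∫⁻ y, ‖(u n : Lp ℝ (ENNReal.ofReal p) μ) y‖ₑ ^ p ∂μ ≤ M)
    (hE : ∀ n, D.Γ (u n) univ ≤ M) :
    ∃ (f : D.dom) (φ : ℕ → ℕ), StrictMono φ ∧
      Tendsto (fun n => ‖(u (φ n) : Lp ℝ (ENNReal.ofReal p) μ) - f‖) atTop (𝓝 0) ∧
      (∀ᵐ y ∂μ, Tendsto (fun n => (u (φ n) : Lp ℝ (ENNReal.ofReal p) μ) y) atTop
        (𝓝 ((f : Lp ℝ (ENNReal.ofReal p) μ) y))) ∧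
      D.Γ f univ ≤ liminf (fun n => D.Γ (u (φ n)) univ) atTop := by
  obtain ⟨f, φ, hφ, hlim⟩ := D.exists_subseq_tendsto hp hμ hΨ hΛ hPI hr₀ x R hM u hu hnorm hE
  obtain ⟨ns, hns, hae⟩ := Lp.exists_subseq_ae_tendsto hlim
  have hlim2 := hlim.comp hns.tendsto_atTop
  obtain ⟨hf, hΓ⟩ := D.lsc f (fun n => u (φ (ns n))) hlim2
    ⟨M.toReal, fun i => ENNReal.toReal_mono hM (hE _)⟩
  exact ⟨⟨f, hf⟩, φ ∘ ns, hφ.comp hns, hlim2, hae, hΓ univ MeasurableSet.univ⟩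

/-- The direct method: clamping a minimizing sequence to `[0,1]` does not raise its energies, and
bounds its `L^p` norms through `μ(2B)`. The constraints survive almost everywhere convergence of a
subsequence. -/
theorem exists_isCapacityMinimizer (hp : 1 ≤ p) (hμ : IsDoublingMeasure μ) {Ψ : X → ℝ → ℝ}
    (hΨ : IsRegularScale Ψ) {C Λ : ℝ} (hΛ : 1 ≤ Λ) (hPI : D.PoincareBound Ψ C Λ)
    (hCap : D.CapUpperBound Ψ) {x : X} {r : ℝ} (hr : AdmissibleRadius X r) :
    ∃ ψ : D.dom, D.IsCapacityMinimizer x r ψ := by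
  have hp0 : 0 < p := by linarith
  obtain ⟨C', -, hcut⟩ := hCap.exists_cutoff
  obtain ⟨ψ₀, hψ₀, -, -⟩ := hcut x r hr
  set m : ℝ≥0∞ := ⨅ φ : {φ : D.dom // D.IsCutoff x r φ}, D.Γ φ univ with hm
  have hmtop : m ≠ ∞ := ne_top_of_le_ne_top (D.Γ_ne_top ψ₀ univ)
    (iInf_le (fun φ : {φ : D.dom // D.IsCutoff x r φ} => D.Γ φ univ) ⟨ψ₀, hψ₀⟩)
  have hex : ∀ n : ℕ, ∃ φ : D.dom, D.IsCutoff x r φ ∧ D.Γ φ univ < m + (n + 1 : ℝ≥0∞)⁻¹ := by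
    intro n
    have : m < m + (n + 1 : ℝ≥0∞)⁻¹ := ENNReal.lt_add_right hmtop (by simp)
    obtain ⟨φ, hφ⟩ := iInf_lt_iff.1 this
    exact ⟨φ, φ.2, hφ⟩
  choose φ hφ hφm using hex
  have hval : ∀ n, ∀ᵐ y ∂μ, (D.clamp (φ n) : Lp ℝ (ENNReal.ofReal p) μ) y ∈ Icc (0 : ℝ) 1 :=
    fun n => by
      filter_upwards [D.coeFn_clamp (φ n)] with y hy
      rw [hy]
      exact ⟨le_max_right _ _, max_le (min_le_right _ _) zero_le_one⟩
  have hE : ∀ n, D.Γ (D.clamp (φ n)) univ ≤ m + (n + 1 : ℝ≥0∞)⁻¹ := fun n =>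
    (D.Γ_clamp_le _ _).trans (hφm n).le
  have hE1 : ∀ n : ℕ, m + (n + 1 : ℝ≥0∞)⁻¹ ≤ m + 1 := fun n => by
    gcongr
    exact ENNReal.inv_le_one.2 le_add_self
  have hnorm : ∀ n, ∫⁻ y, ‖(D.clamp (φ n) : Lp ℝ (ENNReal.ofReal p) μ) y‖ₑ ^ p ∂μ
      ≤ μ (Metric.ball x (2 * r)) := fun n => by
    rw [← lintegral_indicator_one Metric.isOpen_ball.measurableSet]
    refine lintegral_mono_ae ?_
    filter_upwards [hval n, (hφ n).clamp.2] with y h1 h2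
    by_cases hy : y ∈ Metric.ball x (2 * r)
    · rw [indicator_of_mem hy, Real.enorm_eq_ofReal h1.1, Pi.one_apply]
      refine ENNReal.rpow_le_one ?_ hp0.le
      rw [← ENNReal.ofReal_one]
      exact ENNReal.ofReal_le_ofReal h1.2
    · rw [h2 hy]; simp [hp0]
  have hB := (hμ.measure_ball_lt_top x (2 * r)).ne
  obtain ⟨f, ns, hns, -, hae, hΓ⟩ := D.exists_limit hp hμ hΨ hΛ hPI hr x (2 * r)
    (M := μ (Metric.ball x (2 * r)) + (m + 1)) (by finiteness) (fun n => D.clamp (φ n))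
    (fun n => (hφ n).clamp.2) (fun n => (hnorm n).trans le_self_add)
    (fun n => ((hE n).trans (hE1 n)).trans le_add_self)
  refine ⟨f, ⟨?_, ?_⟩, ?_, fun η hη => ?_⟩
  · filter_upwards [hae, ae_all_iff.2 fun n => (hφ n).clamp.1] with y h1 h2 hy
    simp only [h2 _ hy] at h1
    exact tendsto_nhds_unique h1 tendsto_const_nhds
  · filter_upwards [hae, ae_all_iff.2 fun n => (hφ n).clamp.2] with y h1 h2 hy
    simp only [h2 _ hy] at h1
    exact tendsto_nhds_unique h1 tendsto_const_nhds
  · filter_upwards [hae, ae_all_iff.2 hval] with y h1 h2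
    exact isClosed_Icc.mem_of_tendsto h1 (Eventually.of_forall fun n => h2 _)
  · refine hΓ.trans (le_trans ?_ (iInf_le (fun φ : {φ : D.dom // D.IsCutoff x r φ} =>
      D.Γ φ univ) ⟨η, hη⟩))
    have hlim : Tendsto (fun n : ℕ => m + ((ns n : ℕ) + 1 : ℝ≥0∞)⁻¹) atTop (𝓝 m) := by
      have h1 : Tendsto (fun n : ℕ => ((n + 1 : ℕ) : ℝ≥0∞)⁻¹) atTop (𝓝 0) :=
        ENNReal.tendsto_inv_nat_nhds_zero.comp (tendsto_add_atTop_nat 1)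
      have h2 := (tendsto_const_nhds (x := m)).add (h1.comp hns.tendsto_atTop)
      simpa using h2
    rw [← hm, ← hlim.liminf_eq]
    exact liminf_le_liminf (Eventually.of_forall fun n => hE (ns n))

end Minimizer

/-! ### Partitions of unity from lattice operations. -/

section Partition

variable (D : PDirichletStructure X μ p) [Fact (1 ≤ ENNReal.ofReal p)]

/-- The function `M` is the maximum of `0` and the family; its energy bound comes from iterating
subadditivity for the lattice operations. -/
theorem exists_finset_max [IsFiniteMeasureOnCompacts μ] (hp : 1 ≤ p) {ι : Type*} (F : Finset ι)
    (ψ : ι → D.dom) :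
    ∃ M : D.dom, (∀ᵐ x ∂μ, 0 ≤ (M : Lp ℝ (ENNReal.ofReal p) μ) x ∧
        (∀ y ∈ F, (ψ y : Lp ℝ (ENNReal.ofReal p) μ) x ≤ (M : Lp ℝ (ENNReal.ofReal p) μ) x) ∧
        ((M : Lp ℝ (ENNReal.ofReal p) μ) x = 0 ∨ ∃ y ∈ F, (M : Lp ℝ (ENNReal.ofReal p) μ) x
          = (ψ y : Lp ℝ (ENNReal.ofReal p) μ) x)) ∧
      D.Γ M univ ≤ ∑ y ∈ F, D.Γ (ψ y) univ := by
  classical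
  have hp0 : 0 < p := by linarith
  induction F using Finset.induction_on with
  | empty =>
    refine ⟨0, ?_, by simp [D.Γ_zero hp0]⟩
    filter_upwards [Lp.coeFn_zero ℝ (ENNReal.ofReal p) μ] with x hx
    have h0 : ((0 : D.dom) : Lp ℝ (ENNReal.ofReal p) μ) x = 0 := hx
    exact ⟨h0.ge, by simp, Or.inl h0⟩
  | insert a F ha ih =>
    obtain ⟨M, hM, hE⟩ := ih
    refine ⟨-D.capped (-ψ a) M 0, ?_, ?_⟩
    · filter_upwards [hM, D.coeFn_neg (D.capped (-ψ a) M 0), D.coeFn_capped (-ψ a) M 0,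
        D.coeFn_neg (ψ a)] with x h1 h2 h3 h4
      obtain ⟨h0, hle, heq⟩ := h1
      rw [h2, h3, h4, NNReal.coe_zero, zero_sub, min_neg_neg, neg_neg]
      refine ⟨h0.trans (le_max_right _ _), fun y hy => ?_, ?_⟩
      · rcases Finset.mem_insert.1 hy with rfl | hy
        · exact le_max_left _ _
        · exact (hle y hy).trans (le_max_right _ _)
      · rcases max_choice ((ψ a : Lp ℝ (ENNReal.ofReal p) μ) x)
          ((M : Lp ℝ (ENNReal.ofReal p) μ) x) with h | h
        · exact Or.inr ⟨a, Finset.mem_insert_self _ _, h⟩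
        · rw [h]
          exact heq.imp_right fun ⟨y, hy, h5⟩ => ⟨y, Finset.mem_insert_of_mem hy, h5⟩
    · rw [D.Γ_neg, Finset.sum_insert ha, ← D.Γ_neg (ψ a)]
      exact (D.Γ_capped_le hp0 _ _ _ MeasurableSet.univ).trans (add_le_add le_rfl hE)

/-- A partition of unity subordinate to a family of cutoff functions. -/
theorem exists_partition [IsFiniteMeasureOnCompacts μ] (hp : 1 ≤ p) {ι : Type*} (T : Finset ι)
    (ψ : ι → D.dom) (R : ι → ι → Prop) [∀ i, DecidablePred (R i)]
    (hψ : ∀ y ∈ T, ∀ᵐ x ∂μ, 0 ≤ (ψ y : Lp ℝ (ENNReal.ofReal p) μ) x)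
    (hR : ∀ y ∈ T, ∀ z ∈ T, ¬ R y z → ∀ᵐ x ∂μ, (ψ y : Lp ℝ (ENNReal.ofReal p) μ) x = 0 ∨
      (ψ z : Lp ℝ (ENNReal.ofReal p) μ) x = 0) :
    ∃ χ : ι → D.dom,
      (∀ y ∈ T, ∀ᵐ x ∂μ, 0 ≤ (χ y : Lp ℝ (ENNReal.ofReal p) μ) x ∧
        (χ y : Lp ℝ (ENNReal.ofReal p) μ) x ≤ (ψ y : Lp ℝ (ENNReal.ofReal p) μ) x) ∧
      (∀ᵐ x ∂μ, (∀ y ∈ T, (ψ y : Lp ℝ (ENNReal.ofReal p) μ) x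
          ≤ ∑ z ∈ T, (χ z : Lp ℝ (ENNReal.ofReal p) μ) x) ∧
        (∑ z ∈ T, (χ z : Lp ℝ (ENNReal.ofReal p) μ) x = 0 ∨
          ∃ y ∈ T, ∑ z ∈ T, (χ z : Lp ℝ (ENNReal.ofReal p) μ) x
            = (ψ y : Lp ℝ (ENNReal.ofReal p) μ) x)) ∧
      ∀ y ∈ T, D.Γ (χ y) univ
        ≤ 2 ^ (p - 1) * (D.Γ (ψ y) univ + ∑ z ∈ T.filter (R y), D.Γ (ψ z) univ) := by
  classical
  induction T using Finset.induction_on with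
  | empty => exact ⟨ψ, by simp, by simp, by simp⟩
  | insert a T ha ih =>
    obtain ⟨χ, h1, h2, h3⟩ := ih (fun y hy => hψ y (Finset.mem_insert_of_mem hy))
      (fun y hy z hz => hR y (Finset.mem_insert_of_mem hy) z (Finset.mem_insert_of_mem hz))
    obtain ⟨M, hM, hME⟩ := D.exists_finset_max hp (T.filter (R a)) ψ
    -- The new member is the increment of the running maximum, so no products or quotients are
    -- needed. Taking `M` over the neighbours of `a` only keeps the energy bound local.
    set χa : D.dom := D.excess (ψ a - M) 0 with hχa
    have hχa_ae : ∀ᵐ x ∂μ, (χa : Lp ℝ (ENNReal.ofReal p) μ) x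
        = max ((ψ a : Lp ℝ (ENNReal.ofReal p) μ) x - (M : Lp ℝ (ENNReal.ofReal p) μ) x) 0 := by
      filter_upwards [D.coeFn_excess (ψ a - M) 0, D.coeFn_sub (ψ a) M] with x h5 h6
      rw [hχa, h5, h6, NNReal.coe_zero, sub_zero]
    have hne : ∀ y ∈ T, y ≠ a := fun y hy h => ha (h ▸ hy)
    have hsum : ∀ x, ∑ z ∈ insert a T, (Function.update χ a χa z : Lp ℝ (ENNReal.ofReal p) μ) x
        = (χa : Lp ℝ (ENNReal.ofReal p) μ) x
          + ∑ z ∈ T, (χ z : Lp ℝ (ENNReal.ofReal p) μ) x := fun x => by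
      rw [Finset.sum_insert ha, Function.update_self]
      congr 1
      exact Finset.sum_congr rfl fun z hz => by rw [Function.update_of_ne (hne z hz)]
    refine ⟨Function.update χ a χa, fun y hy => ?_, ?_, fun y hy => ?_⟩
    · rcases Finset.mem_insert.1 hy with rfl | hyT
      · rw [Function.update_self]
        filter_upwards [hχa_ae, hM, hψ y hy] with x h5 h6 h7
        rw [h5]
        exact ⟨le_max_right _ _, max_le (by linarith [h6.1]) h7⟩
      · rw [Function.update_of_ne (hne y hyT)]
        exact h1 y hyT
    · have hRa : ∀ᵐ x ∂μ, ∀ z ∈ T, ¬ R a z → (ψ a : Lp ℝ (ENNReal.ofReal p) μ) x = 0 ∨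
          (ψ z : Lp ℝ (ENNReal.ofReal p) μ) x = 0 := by
        refine (ae_ball_iff T.countable_toSet).2 fun z hz => ?_
        by_cases hRz : R a z
        · exact Eventually.of_forall fun x h => absurd hRz h
        · filter_upwards [hR a (Finset.mem_insert_self _ _) z (Finset.mem_insert_of_mem hz) hRz]
            with x hx _ using hx
      filter_upwards [h2, hχa_ae, hM, hRa, hψ a (Finset.mem_insert_self _ _),
        (ae_ball_iff T.countable_toSet).2 fun z hz => hψ z (Finset.mem_insert_of_mem hz)] with
        x h4 h5 h6 h7 h8 h9
      rw [hsum, h5]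
      obtain ⟨h4a, h4b⟩ := h4
      obtain ⟨h6a, h6b, h6c⟩ := h6
      set S := ∑ z ∈ T, (χ z : Lp ℝ (ENNReal.ofReal p) μ) x with hS
      set t := (ψ a : Lp ℝ (ENNReal.ofReal p) μ) x with ht
      have hS0 : 0 ≤ S := by
        rcases h4b with h | ⟨z, hz, h⟩
        · rw [h]
        · rw [h]; exact h9 z hz
      have hmax : max (t - (M : Lp ℝ (ENNReal.ofReal p) μ) x) 0 + S = max t S := by
        rcases h8.eq_or_lt with h0 | h0
        · rw [← h0, max_eq_right (by linarith), zero_add, max_eq_right hS0]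
        -- Where `ψ a > 0`, all non-neighbours vanish, so the local maximum `M` agrees with the
        -- maximum over all previous indices.
        · have hSM : S = (M : Lp ℝ (ENNReal.ofReal p) μ) x := by
            apply le_antisymm
            · rcases h4b with h | ⟨z, hz, h⟩
              · rw [h]; exact h6a
              · by_cases hRz : R a z
                · rw [h]; exact h6b z (Finset.mem_filter.2 ⟨hz, hRz⟩)
                · rcases h7 z hz hRz with h10 | h10
                  · exact absurd h10 h0.ne'
                  · rw [h, h10]; exact h6a
            · rcases h6c with h | ⟨z, hz, h⟩
              · rw [h]; exact hS0
              · rw [h]; exact h4a z (Finset.mem_filter.1 hz).1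
          rw [← hSM]
          rcases le_total t S with h | h
          · rw [max_eq_right (by linarith), max_eq_right h]; ring
          · rw [max_eq_left (by linarith), max_eq_left h]; ring
      rw [hmax]
      refine ⟨fun y hy => ?_, ?_⟩
      · rcases Finset.mem_insert.1 hy with rfl | hyT
        · exact le_max_left _ _
        · exact (h4a y hyT).trans (le_max_right _ _)
      · rcases max_choice t S with h | h
        · exact Or.inr ⟨a, Finset.mem_insert_self _ _, h⟩
        · rw [h]
          exact h4b.imp_right fun ⟨y, hy, h10⟩ => ⟨y, Finset.mem_insert_of_mem hy, h10⟩
    · have hmono : ∀ y, ∑ z ∈ T.filter (R y), D.Γ (ψ z) univ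
          ≤ ∑ z ∈ (insert a T).filter (R y), D.Γ (ψ z) univ := fun y =>
        Finset.sum_le_sum_of_subset (Finset.filter_subset_filter _ (Finset.subset_insert _ _))
      rcases Finset.mem_insert.1 hy with rfl | hyT
      · rw [Function.update_self]
        refine (D.Γ_excess_le _ _ _).trans ((D.Γ_sub_le hp _ _ MeasurableSet.univ).trans ?_)
        gcongr
        exact hME.trans (hmono y)
      · rw [Function.update_of_ne (hne y hyT)]
        refine (h3 y hyT).trans ?_
        gcongr
        exact Finset.subset_insert _ _

end Partition

end PDirichletStructure

theorem enorm_sum_mul_rpow_le {ι : Type*} {p : ℝ} (hp : 1 ≤ p) (T : Finset ι) (t b : ι → ℝ)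
    (ht : ∀ i ∈ T, 0 ≤ t i) (hsum : ∑ i ∈ T, t i = 1) :
    ‖∑ i ∈ T, t i * b i‖ₑ ^ p ≤ ∑ i ∈ T, ENNReal.ofReal (t i) * ‖b i‖ₑ ^ p := by
  have h1 : ‖∑ i ∈ T, t i * b i‖ₑ ≤ ∑ i ∈ T, ENNReal.ofReal (t i) * ‖b i‖ₑ := by
    refine (enorm_sum_le _ _).trans (Finset.sum_le_sum fun i hi => ?_)
    rw [enorm_mul, Real.enorm_eq_ofReal (ht i hi)]
  refine (ENNReal.rpow_le_rpow h1 (by linarith)).trans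
    (ENNReal.rpow_arith_mean_le_arith_mean_rpow T _ _ ?_ hp)
  rw [← ENNReal.ofReal_sum_of_nonneg ht, hsum, ENNReal.ofReal_one]

/-- The Lipschitz constant `1/(4K)` gives `|s y - s z| ≤ (s y + s z)/4` for neighbours, hence a
ratio of at most `5/3`. -/
theorem comparable_of_lipschitz {X : Type*} [MetricSpace X] {s : X → ℝ} {K : ℝ} (hK : 0 < K)
    (hs : ∀ y z, 4 * K * |s y - s z| ≤ dist y z) (hpos : ∀ y, 0 < s y) {y z : X}
    (h : dist y z < K * (s y + s z)) : s z ≤ 2 * s y := by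
  have h1 := (hs y z).trans h.le
  have h2 : 4 * |s y - s z| ≤ s y + s z :=
    le_of_mul_le_mul_left (by linarith : K * (4 * |s y - s z|) ≤ K * (s y + s z)) hK
  have h3 := neg_le_abs (s y - s z)
  linarith [hpos y]

namespace PDirichletStructure

variable {X : Type*} [MetricSpace X] [MeasurableSpace X] [BorelSpace X] {μ : Measure X} {p : ℝ}

/-! ### Whitney coverings with subordinate partitions of unity. -/

section Whitney

variable (D : PDirichletStructure X μ p)

/-- A Whitney-type covering by balls `B(y, 6 s(y))`, `y ∈ T`, with slowly varying radius function
`s`, and a partition of unity `χ` subordinate to the balls `B(y, 12 s(y))`. -/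
structure IsWhitneyPartition (Ψ : X → ℝ → ℝ) (s : X → ℝ) (K : ℝ) (N : ℕ) (A : ℝ≥0)
    (T : Finset X) (χ : X → D.dom) : Prop where
  pos : ∀ y, 0 < s y
  comparable : ∀ y z, dist y z < K * (s y + s z) → s z ≤ 2 * s y
  card_le : ∀ y ∈ T, (T.filter fun z => dist y z < K * (s y + s z)).card ≤ N
  nonneg : ∀ y ∈ T, ∀ᵐ w ∂μ, 0 ≤ (χ y : Lp ℝ (ENNReal.ofReal p) μ) w
  support : ∀ y ∈ T, ∀ᵐ w ∂μ, w ∉ Metric.ball y (12 * s y) →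
    (χ y : Lp ℝ (ENNReal.ofReal p) μ) w = 0
  sum_eq_one : ∀ y ∈ T, ∀ᵐ w ∂μ, w ∈ Metric.ball y (6 * s y) →
    ∑ z ∈ T, (χ z : Lp ℝ (ENNReal.ofReal p) μ) w = 1
  energy_le : ∀ y ∈ T, ∀ z ∈ T, dist y z < 12 * (s y + s z) →
    D.Γ (χ z) univ ≤ A * (μ (Metric.ball y (60 * s y)) / ENNReal.ofReal (Ψ y (60 * s y)))

/-- The function `∑ a_z χ_z` has energy on `B(y, 6 s(y))` controlled by the differences of the
coefficients of the neighbours of `y`. -/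
theorem IsWhitneyPartition.Γ_sum_smul_le {D : PDirichletStructure X μ p} (hp : 1 ≤ p) {Ψ : X → ℝ → ℝ} {s : X → ℝ} {K : ℝ}
    {N : ℕ} {A : ℝ≥0} {T : Finset X} {χ : X → D.dom} (h : D.IsWhitneyPartition Ψ s K N A T χ)
    (hK : 12 ≤ K) (a : X → ℝ) {y : X} (hy : y ∈ T) :
    D.Γ (∑ z ∈ T, a z • χ z) (Metric.ball y (6 * s y))
      ≤ (N : ℝ≥0∞) ^ (p - 1) * A * ∑ z ∈ T.filter (fun z => dist y z < 12 * (s y + s z)),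
        ‖a z - a y‖ₑ ^ p * (μ (Metric.ball y (60 * s y)) / ENNReal.ofReal (Ψ y (60 * s y))) := by
  have hp0 : 0 < p := by linarith
  set F := T.filter (fun z => dist y z < 12 * (s y + s z)) with hF
  have hcard : F.card ≤ N := by
    refine (Finset.card_le_card fun z hz => ?_).trans (h.card_le y hy)
    obtain ⟨h1, h2⟩ := Finset.mem_filter.1 hz
    refine Finset.mem_filter.2 ⟨h1, h2.trans_le ?_⟩
    exact mul_le_mul_of_nonneg_right hK (by linarith [h.pos y, h.pos z])
  set w : D.dom := ∑ z ∈ F, (a z - a y) • χ z with hw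
  -- On `B(y, 6 s y)` the `χ z` sum to `1` and non-neighbours vanish, so the sum differs from `w` by
  -- the constant `a y`, which strong locality discards.
  have hzero : D.Γ (∑ z ∈ T, a z • χ z - w) (Metric.ball y (6 * s y)) = 0 := by
    refine D.Γ_eq_zero_of_ae_eq Metric.isOpen_ball subset_rfl (a y) ?_
    have hsmul : ∀ b : X → ℝ, ∀ᵐ v ∂μ, ∀ z ∈ T,
        ((b z • χ z : D.dom) : Lp ℝ (ENNReal.ofReal p) μ) v
          = b z * (χ z : Lp ℝ (ENNReal.ofReal p) μ) v := fun b =>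
      (ae_ball_iff T.countable_toSet).2 fun z _ => D.coeFn_smul (b z) (χ z)
    filter_upwards [D.coeFn_sub (∑ z ∈ T, a z • χ z) w, D.coeFn_sum T fun z => a z • χ z,
      D.coeFn_sum F fun z => (a z - a y) • χ z, hsmul a, hsmul fun z => a z - a y,
      h.sum_eq_one y hy, (ae_ball_iff T.countable_toSet).2 h.support] with v h1 h2 h3 h4 h5 h6 h7 hv
    rw [h1, h2, hw, h3]
    have h8 : ∑ z ∈ F, (((a z - a y) • χ z : D.dom) : Lp ℝ (ENNReal.ofReal p) μ) v
        = ∑ z ∈ T, (a z - a y) * (χ z : Lp ℝ (ENNReal.ofReal p) μ) v := by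
      rw [hF, Finset.sum_filter]
      refine Finset.sum_congr rfl fun z hz => ?_
      split_ifs with hyz
      · exact h5 z hz
      · rw [h7 z hz, mul_zero]
        intro hvz
        refine hyz ?_
        have h9 := Metric.mem_ball.1 hv
        have h10 := Metric.mem_ball.1 hvz
        linarith [dist_triangle_left y z v, h.pos y]
    rw [h8, Finset.sum_congr rfl fun z hz => h4 z hz, ← Finset.sum_sub_distrib]
    calc _ = a y * ∑ z ∈ T, (χ z : Lp ℝ (ENNReal.ofReal p) μ) v := by
          rw [Finset.mul_sum]
          exact Finset.sum_congr rfl fun z _ => by ring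
      _ = a y := by rw [h6 hv, mul_one]
  calc D.Γ (∑ z ∈ T, a z • χ z) (Metric.ball y (6 * s y))
      ≤ D.Γ w (Metric.ball y (6 * s y)) :=
        D.Γ_le_of_sub_eq_zero hp0 Metric.isOpen_ball.measurableSet hzero
    _ ≤ D.Γ w univ := measure_mono (subset_univ _)
    _ ≤ (F.card : ℝ≥0∞) ^ (p - 1) * ∑ z ∈ F, D.Γ ((a z - a y) • χ z) univ :=
        D.Γ_sum_le hp F _ MeasurableSet.univ
    _ ≤ (N : ℝ≥0∞) ^ (p - 1) * ∑ z ∈ F, A * (‖a z - a y‖ₑ ^ p *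
          (μ (Metric.ball y (60 * s y)) / ENNReal.ofReal (Ψ y (60 * s y)))) := by
        gcongr with z hz
        · obtain ⟨h1, h2⟩ := Finset.mem_filter.1 hz
          rw [D.Γ_smul, ← ENNReal.ofReal_rpow_of_nonneg (abs_nonneg _) hp0.le,
            ← Real.enorm_eq_ofReal_abs]
          refine (mul_le_mul_right (h.energy_le y hy z h1 h2) _).trans_eq ?_
          ring
    _ = _ := by rw [← Finset.mul_sum, mul_assoc]

/-- Integrating a convex combination of coefficients. -/
theorem IsWhitneyPartition.lintegral_sum_mul_le {D : PDirichletStructure X μ p} (hp : 1 ≤ p) {Ψ : X → ℝ → ℝ} {s : X → ℝ} {K : ℝ}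
    {N : ℕ} {A : ℝ≥0} {T : Finset X} {χ : X → D.dom} (h : D.IsWhitneyPartition Ψ s K N A T χ)
    {S : Set X} (hS : MeasurableSet S) (hcov : ∀ w ∈ S, ∃ y ∈ T, w ∈ Metric.ball y (6 * s y))
    (b : X → X → ℝ) (hb : ∀ z, AEMeasurable (b z) μ)
    {T' : Finset X} (hT'T : T' ⊆ T)
    (hT' : ∀ z ∈ T, ∀ w ∈ S, w ∈ Metric.ball z (12 * s z) → z ∈ T') :
    ∫⁻ w in S, ‖∑ z ∈ T, (χ z : Lp ℝ (ENNReal.ofReal p) μ) w * b z w‖ₑ ^ p ∂μ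
      ≤ ∑ z ∈ T', ∫⁻ w in Metric.ball z (12 * s z), ‖b z w‖ₑ ^ p ∂μ := by
  classical
  calc _ ≤ ∫⁻ w, ∑ z ∈ T', (Metric.ball z (12 * s z)).indicator
          (fun w => ‖b z w‖ₑ ^ p) w ∂μ := by
        rw [← lintegral_indicator hS]
        refine lintegral_mono_ae ?_
        filter_upwards [(ae_ball_iff T.countable_toSet).2 h.nonneg,
          (ae_ball_iff T.countable_toSet).2 h.support,
          (ae_ball_iff T.countable_toSet).2 h.sum_eq_one] with w h1 h2 h3
        by_cases hw : w ∈ S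
        · rw [indicator_of_mem hw]
          obtain ⟨y, hy, hwy⟩ := hcov w hw
          have hsum := h3 y hy hwy
          refine (enorm_sum_mul_rpow_le hp T _ (fun z => b z w) h1 hsum).trans ?_
          rw [← Finset.sum_subset hT'T (f := fun z =>
            ENNReal.ofReal ((χ z : Lp ℝ (ENNReal.ofReal p) μ) w) * ‖b z w‖ₑ ^ p)]
          · refine Finset.sum_le_sum fun z hz => ?_
            by_cases hwz : w ∈ Metric.ball z (12 * s z)
            · rw [indicator_of_mem hwz]
              refine mul_le_of_le_one_left zero_le ?_
              rw [← ENNReal.ofReal_one]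
              refine ENNReal.ofReal_le_ofReal ?_
              rw [← hsum]
              exact Finset.single_le_sum h1 (hT'T hz)
            · rw [h2 z (hT'T hz) hwz]; simp
          · intro z hz hz'
            rw [h2 z hz fun hwz => hz' (hT' z hz w hw hwz)]; simp
        · rw [indicator_of_notMem hw]; exact zero_le
    _ = _ := by
        rw [lintegral_finsetSum' _ fun z _ => ((hb z).enorm.pow_const p).indicator
          Metric.isOpen_ball.measurableSet]
        exact Finset.sum_congr rfl fun z _ => lintegral_indicator Metric.isOpen_ball.measurableSet _

variable [Fact (1 ≤ ENNReal.ofReal p)]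

theorem exists_isWhitneyPartition [IsFiniteMeasureOnCompacts μ] (hp : 1 ≤ p)
    (hμ : IsDoublingMeasure μ) {Ψ : X → ℝ → ℝ} (hΨ : IsRegularScale Ψ)
    (hCap : D.CapUpperBound Ψ) {K : ℝ} (hK : 60 ≤ K) :
    ∃ (N : ℕ) (A : ℝ≥0), ∀ (x : X) (R : ℝ) (s : X → ℝ) (ε R' : ℝ), 0 < ε → (∀ y, ε ≤ s y) →
      (∀ y ∈ Metric.ball x R, s y ≤ R') → (∀ y z, 4 * K * |s y - s z| ≤ dist y z) →
      (∀ y ∈ Metric.ball x R, AdmissibleRadius X (60 * s y)) →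
      ∃ (T : Finset X) (χ : X → D.dom), D.IsWhitneyPartition Ψ s K N A T χ ∧
        (∀ y ∈ T, y ∈ Metric.ball x R) ∧
        (∀ z ∈ Metric.ball x R, ∃ y ∈ T, z ∈ Metric.ball y (6 * s y)) := by
  classical
  obtain ⟨N, hN⟩ := hμ.exists_cover (K := K) (by linarith)
  obtain ⟨Cc, hCc, hcut⟩ := hCap.exists_cutoff
  obtain ⟨Cd, hCd⟩ := hμ.exists_measure_ball_le 2
  -- With `dist y w ≤ 108 s y` and `s y ≤ 4 s w`, the distance is at most `432 s w = 72 * (6 s w)`.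
  obtain ⟨Cs, hCs, hscale⟩ := hΨ.exists_le_mul 72
  have hposΨ := hΨ.2.1
  set A₀ : ℝ≥0 := Real.toNNReal Cc * (Cd * Real.toNNReal Cs) with hA₀
  refine ⟨N, Real.toNNReal (2 ^ (p - 1)) * (A₀ + N * A₀), fun x R s ε R' hε hs hR' hlip hadm => ?_⟩
  have hspos : ∀ y, 0 < s y := fun y => hε.trans_le (hs y)
  obtain ⟨T, hT, hcov, hcard⟩ := hN x R s ε R' hε hs hR' hlip
  have hex : ∀ y : X, ∃ ψ : D.dom, y ∈ T → (D.IsCutoff y (6 * s y) ψ ∧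
      (∀ᵐ w ∂μ, (ψ : Lp ℝ (ENNReal.ofReal p) μ) w ∈ Icc (0 : ℝ) 1) ∧
      D.Γ ψ univ ≤ ENNReal.ofReal Cc *
        (μ (Metric.ball y (6 * s y)) / ENNReal.ofReal (Ψ y (6 * s y)))) := by
    intro y
    by_cases hy : y ∈ T
    · obtain ⟨ψ, hψ⟩ := hcut y (6 * s y)
        ((hadm y (hT y hy)).mono (by have := hspos y; positivity) (by linarith [hspos y]))
      exact ⟨ψ, fun _ => hψ⟩
    · exact ⟨0, fun h => absurd h hy⟩
  choose ψ hψ using hex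
  have hcomp : ∀ y z, dist y z < K * (s y + s z) → s z ≤ 2 * s y := fun y z h =>
    comparable_of_lipschitz (by linarith) hlip hspos h
  have h12K : ∀ y z, 12 * (s y + s z) ≤ K * (s y + s z) := fun y z =>
    mul_le_mul_of_nonneg_right (by linarith) (by linarith [hspos y, hspos z])
  obtain ⟨χ, h1, h2, h3⟩ := D.exists_partition hp T ψ (fun y z => dist y z < 12 * (s y + s z))
    (fun y hy => by filter_upwards [(hψ y hy).2.1] with w hw using hw.1)
    (fun y hy z hz hyz => by
      filter_upwards [(hψ y hy).1.2, (hψ z hz).1.2] with w hw1 hw2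
      by_cases hw : w ∈ Metric.ball y (2 * (6 * s y))
      · refine Or.inr (hw2 fun hw' => hyz ?_)
        have h4 := Metric.mem_ball.1 hw
        have h5 := Metric.mem_ball.1 hw'
        have := dist_triangle_left y z w
        linarith
      · exact Or.inl (hw1 hw))
  refine ⟨T, χ, ⟨hspos, hcomp, hcard, fun y hy => ?_, fun y hy => ?_, fun y hy => ?_,
    fun y hy z hz hyz => ?_⟩, hT, hcov⟩
  · filter_upwards [h1 y hy] with w hw using hw.1
  · filter_upwards [h1 y hy, (hψ y hy).1.2] with w hw hw2 hwb
    have := hw2 (by rwa [show 2 * (6 * s y) = 12 * s y by ring])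
    exact le_antisymm (hw.2.trans_eq this) hw.1
  · filter_upwards [h2, (hψ y hy).1.1,
      (ae_ball_iff T.countable_toSet).2 fun z hz => (hψ z hz).2.1] with w hw1 hw2 hw3 hwb
    apply le_antisymm
    · rcases hw1.2 with h | ⟨z, hz, h⟩
      · rw [h]; exact zero_le_one
      · rw [h]; exact (hw3 z hz).2
    · rw [← hw2 hwb]; exact hw1.1 y hy
  -- The energy of `χ z` involves neighbours `w` of the neighbour `z` of `y`. Two steps cost `12 (s
  -- y + s z) + 12 (s z + s w) ≤ 36 s y + 72 s y = 108 s y`.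
  · have hkey : ∀ w ∈ T, s w ≤ 4 * s y → s y ≤ 4 * s w → dist y w ≤ 108 * s y →
        D.Γ (ψ w) univ ≤ A₀ * (μ (Metric.ball y (60 * s y)) / ENNReal.ofReal (Ψ y (60 * s y))) := by
      intro w hw hw1 hw2 hw3
      have hsy := hspos y
      have hsw := hspos w
      have hm : μ (Metric.ball w (6 * s w)) ≤ Cd * μ (Metric.ball y (60 * s y)) :=
        hCd y w (60 * s y) (6 * s w) (by positivity) (by linarith) (by linarith)
      have hsc : Ψ y (60 * s y) ≤ Cs * Ψ w (6 * s w) :=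
        hscale y w (6 * s w) (60 * s y) (by positivity) (by linarith) (hadm y (hT y hy))
          (by linarith) (by linarith)
      have hΨy := hposΨ y (60 * s y) (by positivity)
      have hΨw := hposΨ w (6 * s w) (by positivity)
      have hinv : (ENNReal.ofReal (Ψ w (6 * s w)))⁻¹
          ≤ ENNReal.ofReal Cs * (ENNReal.ofReal (Ψ y (60 * s y)))⁻¹ := by
        rw [← ENNReal.div_eq_inv_mul.trans (mul_comm _ _), ENNReal.le_div_iff_mul_le
          (Or.inl (by simpa using hΨy)) (Or.inl ENNReal.ofReal_ne_top), mul_comm,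
          ← ENNReal.div_eq_inv_mul.trans (mul_comm _ _), ENNReal.div_le_iff
          (by simpa using hΨw) ENNReal.ofReal_ne_top, ← ENNReal.ofReal_mul hCs.le]
        exact ENNReal.ofReal_le_ofReal hsc
      refine (hψ w hw).2.2.trans ?_
      rw [div_eq_mul_inv, div_eq_mul_inv]
      calc ENNReal.ofReal Cc * (μ (Metric.ball w (6 * s w)) * (ENNReal.ofReal (Ψ w (6 * s w)))⁻¹)
          ≤ ENNReal.ofReal Cc * ((Cd * μ (Metric.ball y (60 * s y))) *
            (ENNReal.ofReal Cs * (ENNReal.ofReal (Ψ y (60 * s y)))⁻¹)) := by gcongr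
        _ = _ := by rw [hA₀]; push_cast; simp only [ENNReal.ofReal]; ring
    have hsz : s z ≤ 2 * s y := hcomp y z (hyz.trans_le (h12K y z))
    have hsy : s y ≤ 2 * s z := hcomp z y (by
      rw [dist_comm, add_comm]; exact hyz.trans_le (h12K y z))
    refine (h3 z hz).trans ?_
    set q := μ (Metric.ball y (60 * s y)) / ENNReal.ofReal (Ψ y (60 * s y)) with hq
    have hcardz : (T.filter fun w => dist z w < 12 * (s z + s w)).card ≤ N := by
      refine (Finset.card_le_card ?_).trans (hcard z hz)
      intro w hw
      obtain ⟨hw1, hw2⟩ := Finset.mem_filter.1 hw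
      exact Finset.mem_filter.2 ⟨hw1, hw2.trans_le (h12K z w)⟩
    have hsum : ∑ w ∈ T.filter (fun w => dist z w < 12 * (s z + s w)), D.Γ (ψ w) univ
        ≤ N * (A₀ * q) := by
      calc _ ≤ ∑ w ∈ T.filter (fun w => dist z w < 12 * (s z + s w)), A₀ * q := by
            refine Finset.sum_le_sum fun w hw => ?_
            obtain ⟨hw1, hw2⟩ := Finset.mem_filter.1 hw
            have hsw : s w ≤ 2 * s z := hcomp z w (hw2.trans_le (h12K z w))
            have hsw' : s z ≤ 2 * s w := hcomp w z (by
              rw [dist_comm, add_comm]; exact hw2.trans_le (h12K z w))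
            refine hkey w hw1 (by linarith) (by linarith) ?_
            linarith [dist_triangle y z w]
        _ = ((T.filter fun w => dist z w < 12 * (s z + s w)).card : ℝ≥0∞) * (A₀ * q) := by simp
        _ ≤ _ := by gcongr
    have h2p : (2 : ℝ≥0∞) ^ (p - 1) = ((Real.toNNReal (2 ^ (p - 1)) : ℝ≥0) : ℝ≥0∞) := by
      rw [← ENNReal.ofReal, ← ENNReal.ofReal_rpow_of_pos (by norm_num)]; norm_num
    calc _ ≤ 2 ^ (p - 1) * (A₀ * q + N * (A₀ * q)) := by
          gcongr
          exact hkey z hz (by linarith [hspos y]) (by linarith [hspos z]) (by linarith)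
      _ = _ := by rw [h2p]; push_cast; ring

end Whitney

end PDirichletStructure

/-- A neighbour's ball `B(z, 12t)` has centre within `36s` of `y` and radius at most `24s`, so it
sits in `B(y, 60s)`. This is the origin of the factor `60`. -/
theorem Lp.exists_average_sub_le {X : Type*} [MetricSpace X] [MeasurableSpace X]
    {μ : Measure X} {p : ℝ} [Fact (1 ≤ ENNReal.ofReal p)] (hp : 1 ≤ p) (hμ : IsDoublingMeasure μ) :
    ∃ C : ℝ≥0, ∀ (f : Lp ℝ (ENNReal.ofReal p) μ) (y z : X) (s t b : ℝ), 0 < s → 0 < t →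
      t ≤ 2 * s → s ≤ 2 * t → dist y z < 12 * (s + t) →
      ‖(⨍ w in Metric.ball z (12 * t), f w ∂μ) - b‖ₑ ^ p * μ (Metric.ball y (60 * s))
        ≤ C * ∫⁻ w in Metric.ball y (60 * s), ‖f w - b‖ₑ ^ p ∂μ := by
  obtain ⟨C, hC⟩ := hμ.exists_measure_ball_le 10
  refine ⟨C, fun f y z s t b hs ht hts hst hd => ?_⟩
  have ht12 : 0 < 12 * t := by positivity
  have h1 : μ (Metric.ball y (60 * s)) ≤ C * μ (Metric.ball z (12 * t)) :=
    hC z y (12 * t) (60 * s) ht12 (by linarith) (by rw [dist_comm]; linarith)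
  have hsub : Metric.ball z (12 * t) ⊆ Metric.ball y (60 * s) :=
    Metric.ball_subset_ball' (by rw [dist_comm]; linarith)
  have h2 := enorm_average_sub_rpow_mul_le hp (hμ.measure_ball_pos z ht12).ne'
    (hμ.measure_ball_lt_top z _).ne (Lp.integrableOn_of_measure_ne_top f
      (hμ.measure_ball_lt_top z _).ne) b
  calc _ ≤ ‖(⨍ w in Metric.ball z (12 * t), f w ∂μ) - b‖ₑ ^ p
        * (C * μ (Metric.ball z (12 * t))) := by gcongr
    _ = C * (‖(⨍ w in Metric.ball z (12 * t), f w ∂μ) - b‖ₑ ^ p * μ (Metric.ball z (12 * t))) := by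
        ring
    _ ≤ _ := by
        gcongr
        exact h2.trans (lintegral_mono_set hsub)

namespace PDirichletStructure

variable {X : Type*} [MetricSpace X] [MeasurableSpace X] [BorelSpace X] {μ : Measure X} {p : ℝ}

/-! ### Whitney blending of a function into zero. -/

section Blend

variable (D : PDirichletStructure X μ p)

/-- The energy of `f` on `S` together with the scaled `L^p` norm of `f - c` on `S`. -/
def localEnergy (f : D.dom) (c Θ : ℝ) (S : Set X) : ℝ≥0∞ :=
  D.Γ f S + (ENNReal.ofReal Θ)⁻¹ *
    ∫⁻ y in S, ‖(f : Lp ℝ (ENNReal.ofReal p) μ) y - c‖ₑ ^ p ∂μ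

/-- As a measure in `S`, the local energy can be summed by the bounded overlap estimate. -/
theorem localEnergy_eq_measure (f : D.dom) (c Θ : ℝ) {S : Set X} (hS : MeasurableSet S) :
    D.localEnergy f c Θ S = (D.Γ f + (ENNReal.ofReal Θ)⁻¹ •
      μ.withDensity fun y => ‖(f : Lp ℝ (ENNReal.ofReal p) μ) y - c‖ₑ ^ p) S := by
  rw [localEnergy, Measure.add_apply, Measure.smul_apply, withDensity_apply _ hS, smul_eq_mul]

variable [Fact (1 ≤ ENNReal.ofReal p)]

/-- If both coefficients are averages, the constant `c` cancels and Poincaré on `B(y, 60s)` bounds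
their difference. If one of them may have been switched to zero, `s` is comparable to `ρ`, so `Ψ y
(60s)` is comparable from below to `Ψ x ρ` and the `L^p` term pays for the jump. -/
theorem exists_coefficient_le (hp : 1 ≤ p) (hμ : IsDoublingMeasure μ) {Ψ : X → ℝ → ℝ}
    (hΨ : IsRegularScale Ψ) {C Λ : ℝ} (hΛ : 1 ≤ Λ) (hPI : D.PoincareBound Ψ C Λ) (L : ℝ) :
    ∃ A : ℝ≥0, ∀ (x : X) (ρ : ℝ), AdmissibleRadius X ρ → ∀ (f : D.dom) (c : ℝ) (y z : X)
      (s t α β : ℝ), 0 < s → 0 < t → t ≤ 2 * s → s ≤ 2 * t → dist y z < 12 * (s + t) →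
      60 * s ≤ ρ → dist x y ≤ 9 * ρ →
      (α = (⨍ w in Metric.ball z (12 * t), (f : Lp ℝ (ENNReal.ofReal p) μ) w ∂μ) - c ∧
        β = (⨍ w in Metric.ball y (12 * s), (f : Lp ℝ (ENNReal.ofReal p) μ) w ∂μ) - c ∨
      ρ ≤ L * s ∧
        (α = (⨍ w in Metric.ball z (12 * t), (f : Lp ℝ (ENNReal.ofReal p) μ) w ∂μ) - c ∨ α = 0) ∧
        (β = (⨍ w in Metric.ball y (12 * s), (f : Lp ℝ (ENNReal.ofReal p) μ) w ∂μ) - c ∨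
          β = 0)) →
      ‖α - β‖ₑ ^ p * (μ (Metric.ball y (60 * s)) / ENNReal.ofReal (Ψ y (60 * s)))
        ≤ A * D.localEnergy f c (Ψ x ρ) (Metric.ball y (60 * Λ * s)) := by
  have hp0 : 0 < p := by linarith
  obtain ⟨Cd, hCd⟩ := Lp.exists_average_sub_le (μ := μ) hp hμ
  obtain ⟨Cs, hCs, hscale⟩ := hΨ.exists_le_mul L
  have hposΨ := hΨ.2.1
  refine ⟨Real.toNNReal (2 ^ (p - 1)) * (2 * Cd) * (Real.toNNReal C + Real.toNNReal Cs),
    fun x ρ hρ f c y z s t α β hs ht hts hst hyz hsρ hxy hcase => ?_⟩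
  have h2p : (2 : ℝ≥0∞) ^ (p - 1) = ((Real.toNNReal (2 ^ (p - 1)) : ℝ≥0) : ℝ≥0∞) := by
    rw [← ENNReal.ofReal, ← ENNReal.ofReal_rpow_of_pos (by norm_num)]; norm_num
  have hs60 : 0 < 60 * s := by positivity
  have hΨy := hposΨ y (60 * s) hs60
  have hΨy0 : ENNReal.ofReal (Ψ y (60 * s)) ≠ 0 := by simpa using hΨy
  have hcomb : ∀ (α' β' : ℝ) (I : ℝ≥0∞), ‖α'‖ₑ ^ p * μ (Metric.ball y (60 * s)) ≤ Cd * I →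
      ‖β'‖ₑ ^ p * μ (Metric.ball y (60 * s)) ≤ Cd * I →
      ‖α' - β'‖ₑ ^ p * (μ (Metric.ball y (60 * s)) / ENNReal.ofReal (Ψ y (60 * s)))
        ≤ 2 ^ (p - 1) * (2 * Cd) * (I * (ENNReal.ofReal (Ψ y (60 * s)))⁻¹) := by
    intro α' β' I h1 h2
    have h3 : ‖α' - β'‖ₑ ^ p * μ (Metric.ball y (60 * s)) ≤ 2 ^ (p - 1) * (2 * Cd) * I :=
      calc _ ≤ 2 ^ (p - 1) * (‖α'‖ₑ ^ p + ‖β'‖ₑ ^ p) * μ (Metric.ball y (60 * s)) := by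
            gcongr; exact enorm_sub_rpow_le hp _ _
        _ = 2 ^ (p - 1) * (‖α'‖ₑ ^ p * μ (Metric.ball y (60 * s))
            + ‖β'‖ₑ ^ p * μ (Metric.ball y (60 * s))) := by ring
        _ ≤ 2 ^ (p - 1) * (Cd * I + Cd * I) := by gcongr
        _ = _ := by ring
    rw [div_eq_mul_inv, ← mul_assoc, ← mul_assoc]
    exact mul_le_mul_left h3 _
  have hyy : dist y y < 12 * (s + s) := by rw [dist_self]; positivity
  rcases hcase with ⟨rfl, rfl⟩ | ⟨hρs, hα, hβ⟩
  · set b := ⨍ w in Metric.ball y (60 * s), (f : Lp ℝ (ENNReal.ofReal p) μ) w ∂μ with hb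
    have h1 := hcomb _ _ _ (hCd f y z s t b hs ht hts hst hyz)
      (hCd f y y s s b hs hs (by linarith) (by linarith) hyy)
    rw [sub_sub_sub_cancel_right] at h1 ⊢
    refine h1.trans ?_
    have h3 := hPI y (60 * s) (hρ.mono hs60 hsρ) f
    calc _ ≤ 2 ^ (p - 1) * (2 * Cd) * ((ENNReal.ofReal C * ENNReal.ofReal (Ψ y (60 * s))
            * D.Γ f (Metric.ball y (Λ * (60 * s)))) * (ENNReal.ofReal (Ψ y (60 * s)))⁻¹) := by
          gcongr
      _ = 2 ^ (p - 1) * (2 * Cd) * (ENNReal.ofReal C * D.Γ f (Metric.ball y (60 * Λ * s))) *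
          (ENNReal.ofReal (Ψ y (60 * s)) * (ENNReal.ofReal (Ψ y (60 * s)))⁻¹) := by
          rw [show Λ * (60 * s) = 60 * Λ * s by ring]; ring
      _ = 2 ^ (p - 1) * (2 * Cd) * (ENNReal.ofReal C * D.Γ f (Metric.ball y (60 * Λ * s))) := by
          rw [ENNReal.mul_inv_cancel hΨy0 ENNReal.ofReal_ne_top, mul_one]
      _ ≤ _ := by
          rw [h2p, localEnergy]
          push_cast
          rw [mul_assoc _ (_ + _)]
          gcongr
          · exact le_self_add
          · exact le_self_add
  · have hz : ∀ γ : ℝ, ∀ z' t', 0 < t' → t' ≤ 2 * s → s ≤ 2 * t' → dist y z' < 12 * (s + t') →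
        (γ = (⨍ w in Metric.ball z' (12 * t'), (f : Lp ℝ (ENNReal.ofReal p) μ) w ∂μ) - c ∨
          γ = 0) → ‖γ‖ₑ ^ p * μ (Metric.ball y (60 * s)) ≤ Cd *
          ∫⁻ w in Metric.ball y (60 * s), ‖(f : Lp ℝ (ENNReal.ofReal p) μ) w - c‖ₑ ^ p ∂μ := by
      rintro γ z' t' ht' h1 h2 h3 (rfl | rfl)
      · exact hCd f y z' s t' c hs ht' h1 h2 h3
      · simp [hp0]
    refine (hcomb α β _ (hz α z t ht hts hst hyz hα)
      (hz β y s hs (by linarith) (by linarith) hyy hβ)).trans ?_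
    have hΨx := hposΨ x ρ hρ.1
    have hd9 : dist x y ≤ L * (60 * s) := by linarith [hρ.1]
    have h1 : Ψ x ρ ≤ Cs * Ψ y (60 * s) :=
      hscale x y (60 * s) ρ hs60 hsρ hρ (by linarith [hρ.1]) hd9
    have h2 : (ENNReal.ofReal (Ψ y (60 * s)))⁻¹
        ≤ ENNReal.ofReal Cs * (ENNReal.ofReal (Ψ x ρ))⁻¹ := by
      rw [← div_eq_mul_inv, ENNReal.le_div_iff_mul_le (Or.inl (by simpa using hΨx))
        (Or.inl ENNReal.ofReal_ne_top), mul_comm, ← div_eq_mul_inv,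
        ENNReal.div_le_iff hΨy0 ENNReal.ofReal_ne_top, ← ENNReal.ofReal_mul hCs.le]
      exact ENNReal.ofReal_le_ofReal h1
    have hsub : Metric.ball y (60 * s) ⊆ Metric.ball y (60 * Λ * s) :=
      Metric.ball_subset_ball (by nlinarith)
    calc _ ≤ 2 ^ (p - 1) * (2 * Cd) * ((∫⁻ w in Metric.ball y (60 * Λ * s),
          ‖(f : Lp ℝ (ENNReal.ofReal p) μ) w - c‖ₑ ^ p ∂μ) *
          (ENNReal.ofReal Cs * (ENNReal.ofReal (Ψ x ρ))⁻¹)) := by gcongr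
      _ = 2 ^ (p - 1) * (2 * Cd) * (ENNReal.ofReal Cs * ((ENNReal.ofReal (Ψ x ρ))⁻¹ *
          ∫⁻ w in Metric.ball y (60 * Λ * s),
          ‖(f : Lp ℝ (ENNReal.ofReal p) μ) w - c‖ₑ ^ p ∂μ)) := by ring
      _ ≤ _ := by
          rw [h2p, localEnergy]
          push_cast
          rw [mul_assoc _ (_ + _)]
          gcongr
          · exact le_add_self
          · exact le_add_self

end Blend

end PDirichletStructure

namespace PDirichletStructure

variable {X : Type*} [MetricSpace X] [MeasurableSpace X] [BorelSpace X] {μ : Measure X} {p : ℝ}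

section Blend

variable (D : PDirichletStructure X μ p) [Fact (1 ≤ ENNReal.ofReal p)]

/-- Whitney blending at a finite resolution: a function that is close to `f - c` on `B(x, a)`, and
vanishes outside `B(x, a + ρ)`, with controlled energy. -/
theorem exists_blend_approx [IsFiniteMeasureOnCompacts μ] (hp : 1 ≤ p)
    (hμ : IsDoublingMeasure μ) {Ψ : X → ℝ → ℝ} (hΨ : IsRegularScale Ψ)
    (hCap : D.CapUpperBound Ψ) {C Λ : ℝ} (hΛ : 1 ≤ Λ) (hPI : D.PoincareBound Ψ C Λ) :
    ∃ B : ℝ≥0, ∀ (x : X) (ρ a : ℝ), AdmissibleRadius X ρ → ρ ≤ a → a ≤ 8 * ρ →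
      ∀ (f : D.dom) (c η : ℝ), 0 < η → ∃ g : D.dom,
        (∀ᵐ y ∂μ, y ∉ Metric.ball x (a + ρ) → (g : Lp ℝ (ENNReal.ofReal p) μ) y = 0) ∧
        D.Γ g univ ≤ B * D.localEnergy f c (Ψ x ρ) (Metric.ball x (10 * ρ)) ∧
        ∫⁻ y, ‖(g : Lp ℝ (ENNReal.ofReal p) μ) y‖ₑ ^ p ∂μ
          ≤ B * ∫⁻ y in Metric.ball x (10 * ρ), ‖(f : Lp ℝ (ENNReal.ofReal p) μ) y - c‖ₑ ^ p ∂μ ∧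
        ∫⁻ y in Metric.ball x a, ‖(g : Lp ℝ (ENNReal.ofReal p) μ) y
          - ((f : Lp ℝ (ENNReal.ofReal p) μ) y - c)‖ₑ ^ p ∂μ
          ≤ B * (ENNReal.ofReal η * D.Γ f univ) := by
  classical
  have hp0 : 0 < p := by linarith
  set K : ℝ := 60 * Λ with hK
  set L : ℝ := 4 * K with hL
  have hK60 : 60 ≤ K := by linarith
  have hL0 : 0 < L := by linarith
  obtain ⟨N, A, hWhit⟩ := D.exists_isWhitneyPartition hp hμ hΨ hCap hK60
  -- A switch happens at a point with `L s ≥ ρ/2`; a neighbour's radius may be half as large, so `ρ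
  -- ≤ 4 L s` there.
  obtain ⟨A', hcoef⟩ := D.exists_coefficient_le hp hμ hΨ hΛ hPI (4 * L)
  set B₁ : ℝ≥0 := (N : ℝ≥0) ^ (p - 1) * A * (N * A') * N with hB₁
  refine ⟨max B₁ (max N (Real.toNNReal C * N)), fun x ρ a hρ hρa ha8 f c η hη => ?_⟩
  have hρ0 : 0 < ρ := hρ.1
  obtain ⟨δ, hδ, hδρ, hδΨ⟩ := hΨ.exists_small x (10 * ρ) hρ hη
  set ε : ℝ := min δ (ρ / 2) with hε
  have hε0 : 0 < ε := lt_min hδ (by linarith)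
  have hεδ : ε ≤ δ := min_le_left _ _
  have hερ : ε ≤ ρ / 2 := min_le_right _ _
  -- The mesh has size `ε / L` on `B(x, a)` and grows in proportion to the distance from it. The
  -- choice `L = 4K` gives the required Lipschitz constant.
  set s : X → ℝ := fun y => max ε (dist x y - a) / L with hs
  have hLs : ∀ y, L * s y = max ε (dist x y - a) := fun y => by
    simp only [hs]; field_simp
  have hsε : ∀ y, ε / L ≤ s y := fun y => by
    simp only [hs]; gcongr; exact le_max_left _ _
  have hspos : ∀ y, 0 < s y := fun y => (by positivity : 0 < ε / L).trans_le (hsε y)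
  have hsρ : ∀ y ∈ Metric.ball x (a + ρ), L * s y ≤ ρ := fun y hy => by
    rw [hLs, max_le_iff]
    have := Metric.mem_ball'.1 hy
    exact ⟨by linarith, by linarith⟩
  have hlip : ∀ y z, 4 * K * |s y - s z| ≤ dist y z := fun y z => by
    have h1 : L * |s y - s z| = |max ε (dist x y - a) - max ε (dist x z - a)| := by
      rw [← hLs, ← hLs, ← mul_sub, abs_mul, abs_of_pos hL0]
    rw [← hL, h1]
    refine (abs_max_sub_max_le_max _ _ _ _).trans ?_
    rw [sub_self, abs_zero, sub_sub_sub_cancel_right]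
    refine max_le dist_nonneg ?_
    rw [dist_comm x y, dist_comm x z]
    exact abs_dist_sub_le y z x
  have hKs : ∀ y ∈ Metric.ball x (a + ρ), K * s y ≤ ρ / 4 := fun y hy => by
    have := hsρ y hy
    rw [hL] at this
    linarith
  have h60s : ∀ y ∈ Metric.ball x (a + ρ), 60 * s y ≤ ρ / 4 := fun y hy =>
    (mul_le_mul_of_nonneg_right hK60 (hspos y).le).trans (hKs y hy)
  obtain ⟨T, χ, hW, hT, hcov⟩ := hWhit x (a + ρ) s (ε / L) (ρ / L) (by positivity) hsε
    (fun y hy => by rw [le_div_iff₀' hL0]; exact hsρ y hy) hlip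
    (fun y hy => hρ.mono (by have := hspos y; positivity) (by linarith [h60s y hy]))
  set av : X → ℝ := fun z =>
    ⨍ w in Metric.ball z (12 * s z), (f : Lp ℝ (ENNReal.ofReal p) μ) w ∂μ with hav
  -- Cutting off at `a + ρ/2` puts the jump where the mesh size is comparable to `ρ`, and leaves
  -- room for the supports inside `B(x, a + 3ρ/4)`.
  set α : X → ℝ := fun z => if dist x z < a + ρ / 2 then av z - c else 0 with hα
  set g : D.dom := ∑ z ∈ T, α z • χ z with hg
  have hα_or : ∀ z, α z = av z - c ∨ α z = 0 := fun z => by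
    by_cases h : dist x z < a + ρ / 2
    · exact Or.inl (if_pos h)
    · exact Or.inr (if_neg h)
  have hg_ae : ∀ᵐ w ∂μ, (g : Lp ℝ (ENNReal.ofReal p) μ) w
      = ∑ z ∈ T, (χ z : Lp ℝ (ENNReal.ofReal p) μ) w * α z := by
    filter_upwards [D.coeFn_sum T fun z => α z • χ z,
      (ae_ball_iff T.countable_toSet).2 fun z _ => D.coeFn_smul (α z) (χ z)] with w h1 h2
    rw [hg, h1]
    exact Finset.sum_congr rfl fun z hz => by rw [h2 z hz, mul_comm]
  have hsupp : ∀ᵐ w ∂μ, w ∉ Metric.closedBall x (a + 3 * ρ / 4) →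
      (g : Lp ℝ (ENNReal.ofReal p) μ) w = 0 := by
    filter_upwards [hg_ae, (ae_ball_iff T.countable_toSet).2 hW.support] with w h1 h2 hw
    rw [h1]
    refine Finset.sum_eq_zero fun z hz => ?_
    by_cases hz2 : dist x z < a + ρ / 2
    · rw [h2 z hz, zero_mul]
      intro hwz
      refine hw (Metric.mem_closedBall.2 ?_)
      have h3 := Metric.mem_ball.1 hwz
      have h4 := h60s z (hT z hz)
      have h5 := dist_triangle w z x
      rw [dist_comm z x] at h5
      linarith [hspos z]
    · simp [hα, hz2]
  have hsupp' : ∀ᵐ w ∂μ, w ∉ Metric.ball x (a + ρ) →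
      (g : Lp ℝ (ENNReal.ofReal p) μ) w = 0 := by
    filter_upwards [hsupp] with w hw hwb
    exact hw fun h => hwb (Metric.closedBall_subset_ball (by linarith) h)
  have hoverlap : ∀ ν : Measure X, ∑ y ∈ T, ν (Metric.ball y (K * s y))
      ≤ N * ν (Metric.ball x (10 * ρ)) := fun ν => by
    refine sum_measure_le_of_card_le ν T _ (fun _ _ => Metric.isOpen_ball.measurableSet)
      Metric.isOpen_ball.measurableSet (fun y hy => Metric.ball_subset_ball' ?_)
      (fun y z => dist y z < K * (s y + s z)) (fun y hy z hz w hw1 hw2 => ?_) hW.card_le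
    · linarith [hKs y (hT y hy), Metric.mem_ball.1 (hT y hy)]
    · linarith [Metric.mem_ball.1 hw1, Metric.mem_ball.1 hw2, dist_triangle_left y z w]
  have hBle : (B₁ : ℝ≥0∞) ≤ ((max B₁ (max N (Real.toNNReal C * N)) : ℝ≥0) : ℝ≥0∞) :=
    ENNReal.coe_le_coe.2 (le_max_left _ _)
  have hNle : (N : ℝ≥0∞) ≤ ((max B₁ (max N (Real.toNNReal C * N)) : ℝ≥0) : ℝ≥0∞) := by
    rw [← ENNReal.coe_natCast]
    exact ENNReal.coe_le_coe.2 ((le_max_left _ _).trans (le_max_right _ _))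
  have hCle : ENNReal.ofReal C * N
      ≤ ((max B₁ (max N (Real.toNNReal C * N)) : ℝ≥0) : ℝ≥0∞) := by
    rw [← ENNReal.coe_natCast, ENNReal.ofReal, ← ENNReal.coe_mul]
    exact ENNReal.coe_le_coe.2 ((le_max_right _ _).trans (le_max_right _ _))
  refine ⟨g, hsupp', ?_, ?_, ?_⟩
  · have hout : D.Γ g (Metric.closedBall x (a + 3 * ρ / 4))ᶜ = 0 :=
      D.Γ_eq_zero_of_ae_eq Metric.isClosed_closedBall.isOpen_compl subset_rfl 0 hsupp
    have hlocal : ∀ y ∈ T, D.Γ g (Metric.ball y (6 * s y)) ≤ (N : ℝ≥0∞) ^ (p - 1) * A *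
        (N * (A' * D.localEnergy f c (Ψ x ρ) (Metric.ball y (K * s y)))) := by
      intro y hy
      refine (hW.Γ_sum_smul_le hp (by linarith) α hy).trans ?_
      gcongr
      have hcardF : (T.filter fun z => dist y z < 12 * (s y + s z)).card ≤ N := by
        refine (Finset.card_le_card fun z hz => ?_).trans (hW.card_le y hy)
        obtain ⟨h1, h2⟩ := Finset.mem_filter.1 hz
        refine Finset.mem_filter.2 ⟨h1, h2.trans_le ?_⟩
        exact mul_le_mul_of_nonneg_right (by linarith) (by linarith [hspos y, hspos z])
      calc _ ≤ ∑ z ∈ T.filter (fun z => dist y z < 12 * (s y + s z)),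
            A' * D.localEnergy f c (Ψ x ρ) (Metric.ball y (K * s y)) := by
            refine Finset.sum_le_sum fun z hz => ?_
            obtain ⟨hzT, hyz⟩ := Finset.mem_filter.1 hz
            have hyzK : dist y z < K * (s y + s z) := hyz.trans_le
              (mul_le_mul_of_nonneg_right (by linarith) (by linarith [hspos y, hspos z]))
            have h1 := hW.comparable y z hyzK
            have h2 := hW.comparable z y (by rwa [dist_comm, add_comm])
            refine hcoef x ρ hρ f c y z (s y) (s z) (α z) (α y) (hspos y) (hspos z) h1 h2 hyz
              (by linarith [h60s y (hT y hy)])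
              (by linarith [Metric.mem_ball'.1 (hT y hy)]) ?_
            by_cases hy2 : dist x y < a + ρ / 2
            · by_cases hz2 : dist x z < a + ρ / 2
              · exact Or.inl ⟨if_pos hz2, if_pos hy2⟩
              · refine Or.inr ⟨?_, hα_or z, hα_or y⟩
                have h3 : ρ / 2 ≤ L * s z := by
                  rw [hLs]; exact le_max_of_le_right (by linarith)
                have h4 := mul_le_mul_of_nonneg_left h1 hL0.le
                linarith
            · refine Or.inr ⟨?_, hα_or z, hα_or y⟩
              have h3 : ρ / 2 ≤ L * s y := by
                rw [hLs]; exact le_max_of_le_right (by linarith)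
              linarith
        _ = ((T.filter fun z => dist y z < 12 * (s y + s z)).card : ℝ≥0∞) *
            (A' * D.localEnergy f c (Ψ x ρ) (Metric.ball y (K * s y))) := by simp
        _ ≤ _ := by gcongr
    calc D.Γ g univ ≤ D.Γ g ((Metric.closedBall x (a + 3 * ρ / 4))ᶜ
          ∪ ⋃ y ∈ T, Metric.ball y (6 * s y)) := by
          refine measure_mono fun w _ => ?_
          by_cases hw : w ∈ Metric.closedBall x (a + 3 * ρ / 4)
          · obtain ⟨y, hy, hwy⟩ := hcov w (Metric.closedBall_subset_ball (by linarith) hw)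
            exact Or.inr (mem_biUnion hy hwy)
          · exact Or.inl hw
      _ ≤ 0 + ∑ y ∈ T, D.Γ g (Metric.ball y (6 * s y)) := by
          refine (measure_union_le _ _).trans (add_le_add hout.le ?_)
          exact measure_biUnion_finset_le _ _
      _ ≤ ∑ y ∈ T, (N : ℝ≥0∞) ^ (p - 1) * A *
          (N * (A' * D.localEnergy f c (Ψ x ρ) (Metric.ball y (K * s y)))) := by
          rw [zero_add]
          exact Finset.sum_le_sum hlocal
      _ = (N : ℝ≥0∞) ^ (p - 1) * A * (N * A') *
          ∑ y ∈ T, D.localEnergy f c (Ψ x ρ) (Metric.ball y (K * s y)) := by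
          rw [Finset.mul_sum]
          exact Finset.sum_congr rfl fun y _ => by ring
      _ ≤ (N : ℝ≥0∞) ^ (p - 1) * A * (N * A') *
          (N * D.localEnergy f c (Ψ x ρ) (Metric.ball x (10 * ρ))) := by
          gcongr
          simp only [D.localEnergy_eq_measure f c (Ψ x ρ) Metric.isOpen_ball.measurableSet]
          exact hoverlap _
      _ = B₁ * D.localEnergy f c (Ψ x ρ) (Metric.ball x (10 * ρ)) := by
          rw [hB₁]
          push_cast
          rw [ENNReal.coe_rpow_of_nonneg _ (by linarith), ENNReal.coe_natCast]
          ring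
      _ ≤ _ := by gcongr
  · calc ∫⁻ y, ‖(g : Lp ℝ (ENNReal.ofReal p) μ) y‖ₑ ^ p ∂μ
        = ∫⁻ w in Metric.ball x (a + ρ),
          ‖∑ z ∈ T, (χ z : Lp ℝ (ENNReal.ofReal p) μ) w * α z‖ₑ ^ p ∂μ := by
          rw [← lintegral_indicator Metric.isOpen_ball.measurableSet]
          refine lintegral_congr_ae ?_
          filter_upwards [hg_ae, hsupp'] with w h1 h2
          by_cases hw : w ∈ Metric.ball x (a + ρ)
          · rw [indicator_of_mem hw, h1]
          · rw [indicator_of_notMem hw, h2 hw]; simp [hp0]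
      _ ≤ ∑ z ∈ T, ∫⁻ _ in Metric.ball z (12 * s z), ‖α z‖ₑ ^ p ∂μ :=
          hW.lintegral_sum_mul_le hp Metric.isOpen_ball.measurableSet hcov (fun z _ => α z)
            (fun _ => aemeasurable_const) (subset_refl T) (fun z hz _ _ _ => hz)
      _ ≤ ∑ z ∈ T, ∫⁻ w in Metric.ball z (12 * s z),
          ‖(f : Lp ℝ (ENNReal.ofReal p) μ) w - c‖ₑ ^ p ∂μ := by
          refine Finset.sum_le_sum fun z _ => ?_
          have h12 : 0 < 12 * s z := by have := hspos z; positivity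
          rw [lintegral_const, Measure.restrict_apply_univ]
          rcases hα_or z with h | h
          · rw [h]
            exact enorm_average_sub_rpow_mul_le hp (hμ.measure_ball_pos z h12).ne'
              (hμ.measure_ball_lt_top z _).ne (Lp.integrableOn_of_measure_ne_top _
                (hμ.measure_ball_lt_top z _).ne) c
          · rw [h]; simp [hp0]
      _ ≤ ∑ z ∈ T, (μ.withDensity fun w => ‖(f : Lp ℝ (ENNReal.ofReal p) μ) w - c‖ₑ ^ p)
          (Metric.ball z (K * s z)) := by
          refine Finset.sum_le_sum fun z _ => ?_
          rw [withDensity_apply _ Metric.isOpen_ball.measurableSet]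
          refine lintegral_mono_set (Metric.ball_subset_ball ?_)
          exact mul_le_mul_of_nonneg_right (by linarith) (hspos z).le
      _ ≤ N * ∫⁻ y in Metric.ball x (10 * ρ),
          ‖(f : Lp ℝ (ENNReal.ofReal p) μ) y - c‖ₑ ^ p ∂μ := by
          rw [← withDensity_apply _ Metric.isOpen_ball.measurableSet]
          exact hoverlap _
      _ ≤ _ := by gcongr
  · have hball : Metric.ball x a ⊆ Metric.ball x (a + ρ) :=
      Metric.ball_subset_ball (by linarith)
    set T' := T.filter fun z => dist x z < a + 12 * s z with hT'
    -- A partition function reaching into `B(x, a)` has the finest mesh size: otherwise `L s z =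
    -- dist x z - a < 12 s z`, against `L ≥ 240`. Its coefficient is therefore an average over a
    -- ball of radius at most `δ`.
    have hnear : ∀ z ∈ T', L * s z = ε ∧ dist x z < a + ρ / 2 := by
      intro z hz
      have h1 := (Finset.mem_filter.1 hz).2
      have h2 := hLs z
      have h3 : 240 * s z ≤ L * s z := mul_le_mul_of_nonneg_right (by linarith) (hspos z).le
      rcases max_cases ε (dist x z - a) with h | h
      · rw [h.1] at h2
        exact ⟨h2, by linarith⟩
      · rw [h.1] at h2
        linarith [hspos z]
    calc ∫⁻ y in Metric.ball x a, ‖(g : Lp ℝ (ENNReal.ofReal p) μ) y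
          - ((f : Lp ℝ (ENNReal.ofReal p) μ) y - c)‖ₑ ^ p ∂μ
        = ∫⁻ w in Metric.ball x a, ‖∑ z ∈ T, (χ z : Lp ℝ (ENNReal.ofReal p) μ) w *
          (α z - ((f : Lp ℝ (ENNReal.ofReal p) μ) w - c))‖ₑ ^ p ∂μ := by
          refine setLIntegral_congr_fun_ae Metric.isOpen_ball.measurableSet ?_
          filter_upwards [hg_ae, (ae_ball_iff T.countable_toSet).2 hW.sum_eq_one] with w h1 h2 hw
          obtain ⟨y, hy, hwy⟩ := hcov w (hball hw)
          simp only [h1, mul_sub, Finset.sum_sub_distrib, ← Finset.sum_mul, h2 y hy hwy, one_mul]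
      _ ≤ ∑ z ∈ T', ∫⁻ w in Metric.ball z (12 * s z),
          ‖α z - ((f : Lp ℝ (ENNReal.ofReal p) μ) w - c)‖ₑ ^ p ∂μ := by
          refine hW.lintegral_sum_mul_le hp Metric.isOpen_ball.measurableSet
            (fun w hw => hcov w (hball hw))
            (fun z w => α z - ((f : Lp ℝ (ENNReal.ofReal p) μ) w - c))
            (fun z => ((Lp.aestronglyMeasurable _).aemeasurable.sub_const c).const_sub _)
            (Finset.filter_subset _ _) (fun z hz w hw hwz => Finset.mem_filter.2 ⟨hz, ?_⟩)
          linarith [Metric.mem_ball'.1 hw, Metric.mem_ball.1 hwz, dist_triangle x w z]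
      _ = ∑ z ∈ T', ∫⁻ w in Metric.ball z (12 * s z),
          ‖(f : Lp ℝ (ENNReal.ofReal p) μ) w - av z‖ₑ ^ p ∂μ := by
          refine Finset.sum_congr rfl fun z hz => lintegral_congr fun w => ?_
          have h1 : α z = av z - c := if_pos (hnear z hz).2
          rw [h1, ← enorm_neg]
          congr 2
          ring
      _ ≤ ENNReal.ofReal C * ENNReal.ofReal η * (N * D.Γ f univ) := by
          refine D.sum_oscillation_le hPI (by linarith) (fun y _ => hspos y) hW.card_le
            (Finset.filter_subset _ _) (fun z hz => ?_) (fun z hz => ?_) f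
          · have hzT := hT z (Finset.mem_filter.1 hz).1
            exact hρ.mono (by have := hspos z; positivity) (by linarith [h60s z hzT, hspos z])
          · have hzT := hT z (Finset.mem_filter.1 hz).1
            have h3 : 240 * s z ≤ L * s z := mul_le_mul_of_nonneg_right (by linarith) (hspos z).le
            refine hδΨ _ (by have := hspos z; positivity) ?_ z
              (Metric.ball_subset_ball (by linarith) hzT)
            linarith [(hnear z hz).1, hspos z]
      _ = ENNReal.ofReal C * N * (ENNReal.ofReal η * D.Γ f univ) := by ring
      _ ≤ _ := by gcongr

/-- Whitney blending: a function that coincides with `f - c` on `B(x, a)`, and vanishes outside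
`B(x, a + ρ)`, with controlled energy. -/
theorem exists_blend [IsFiniteMeasureOnCompacts μ] (hp : 1 ≤ p)
    (hμ : IsDoublingMeasure μ) {Ψ : X → ℝ → ℝ} (hΨ : IsRegularScale Ψ)
    (hCap : D.CapUpperBound Ψ) {C Λ : ℝ} (hΛ : 1 ≤ Λ) (hPI : D.PoincareBound Ψ C Λ) :
    ∃ B : ℝ≥0, ∀ (x : X) (ρ a : ℝ), AdmissibleRadius X ρ → ρ ≤ a → a ≤ 8 * ρ →
      ∀ (f : D.dom) (c : ℝ), ∃ g : D.dom,
        (∀ᵐ y ∂μ, y ∈ Metric.ball x a → (g : Lp ℝ (ENNReal.ofReal p) μ) y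
          = (f : Lp ℝ (ENNReal.ofReal p) μ) y - c) ∧
        (∀ᵐ y ∂μ, y ∉ Metric.ball x (a + ρ) → (g : Lp ℝ (ENNReal.ofReal p) μ) y = 0) ∧
        D.Γ g univ ≤ B * D.localEnergy f c (Ψ x ρ) (Metric.ball x (10 * ρ)) := by
  have hp0 : 0 < p := by linarith
  obtain ⟨B, hB⟩ := D.exists_blend_approx hp hμ hΨ hCap hΛ hPI
  refine ⟨B, fun x ρ a hρ hρa ha8 f c => ?_⟩
  choose u hu1 hu2 hu3 hu4 using fun n : ℕ => hB x ρ a hρ hρa ha8 f c (1 / ((n : ℝ) + 1))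
    (by positivity)
  have hfc : ∫⁻ y in Metric.ball x (10 * ρ),
      ‖(f : Lp ℝ (ENNReal.ofReal p) μ) y - c‖ₑ ^ p ∂μ ≠ ∞ := by
    have h1 : ∫⁻ y, ‖(f : Lp ℝ (ENNReal.ofReal p) μ) y‖ₑ ^ p ∂μ ≠ ∞ := by
      rw [← Lp.ofReal_norm_rpow_eq hp0]; exact ENNReal.ofReal_ne_top
    have h2 : ∫⁻ y in Metric.ball x (10 * ρ), ‖(f : Lp ℝ (ENNReal.ofReal p) μ) y - c‖ₑ ^ p ∂μ
        ≤ 2 ^ (p - 1) * (∫⁻ y, ‖(f : Lp ℝ (ENNReal.ofReal p) μ) y‖ₑ ^ p ∂μ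
          + ‖c‖ₑ ^ p * μ (Metric.ball x (10 * ρ))) := by
      calc _ ≤ ∫⁻ y in Metric.ball x (10 * ρ), 2 ^ (p - 1) *
            (‖(f : Lp ℝ (ENNReal.ofReal p) μ) y‖ₑ ^ p + ‖c‖ₑ ^ p) ∂μ :=
            lintegral_mono fun y => enorm_sub_rpow_le hp _ _
        _ = 2 ^ (p - 1) * (∫⁻ y in Metric.ball x (10 * ρ),
            ‖(f : Lp ℝ (ENNReal.ofReal p) μ) y‖ₑ ^ p ∂μ
            + ‖c‖ₑ ^ p * μ (Metric.ball x (10 * ρ))) := by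
            rw [lintegral_const_mul' _ _ (ENNReal.rpow_ne_top_of_nonneg (by linarith) (by simp)),
              lintegral_add_right _ measurable_const]
            simp
        _ ≤ _ := by
            gcongr
            exact Measure.restrict_le_self
    refine ne_top_of_le_ne_top ?_ h2
    have h3 := (hμ.measure_ball_lt_top x (10 * ρ)).ne
    have h4 : ‖c‖ₑ ^ p ≠ ∞ := ENNReal.rpow_ne_top_of_nonneg hp0.le enorm_ne_top
    have h5 : (2 : ℝ≥0∞) ^ (p - 1) ≠ ∞ := ENNReal.rpow_ne_top_of_nonneg (by linarith) (by simp)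
    finiteness
  set Q := D.localEnergy f c (Ψ x ρ) (Metric.ball x (10 * ρ)) with hQ
  have hQtop : Q ≠ ∞ := by
    rw [hQ, localEnergy]
    have h1 : (ENNReal.ofReal (Ψ x ρ))⁻¹ ≠ ∞ := by
      simpa using hΨ.2.1 x ρ hρ.1
    exact ENNReal.add_ne_top.2 ⟨D.Γ_ne_top _ _, ENNReal.mul_ne_top h1 hfc⟩
  obtain ⟨g, φ, hφ, -, hae, hE⟩ := D.exists_limit hp hμ hΨ hΛ hPI hρ x (a + ρ)
    (M := B * Q + B * ∫⁻ y in Metric.ball x (10 * ρ),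
      ‖(f : Lp ℝ (ENNReal.ofReal p) μ) y - c‖ₑ ^ p ∂μ)
    (ENNReal.add_ne_top.2 ⟨ENNReal.mul_ne_top ENNReal.coe_ne_top hQtop,
      ENNReal.mul_ne_top ENNReal.coe_ne_top hfc⟩) u hu1
    (fun n => (hu3 n).trans le_add_self) (fun n => (hu2 n).trans le_self_add)
  refine ⟨g, ?_, ?_, ?_⟩
  · set h : X → ℝ≥0∞ := fun y => ‖(g : Lp ℝ (ENNReal.ofReal p) μ) y
      - ((f : Lp ℝ (ENNReal.ofReal p) μ) y - c)‖ₑ ^ p with hh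
    have hmeas : ∀ v : D.dom, AEMeasurable (fun y => ‖(v : Lp ℝ (ENNReal.ofReal p) μ) y
        - ((f : Lp ℝ (ENNReal.ofReal p) μ) y - c)‖ₑ ^ p) (μ.restrict (Metric.ball x a)) := fun v =>
      (((Lp.aestronglyMeasurable _).aemeasurable.sub
        ((Lp.aestronglyMeasurable _).aemeasurable.sub_const c)).enorm.pow_const p).restrict
    -- Fatou's lemma along the almost everywhere convergent subsequence, since the approximation
    -- error tends to zero with `η`.
    have hz : ∫⁻ y in Metric.ball x a, h y ∂μ = 0 := by
      refine le_antisymm ?_ zero_le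
      calc ∫⁻ y in Metric.ball x a, h y ∂μ
          = ∫⁻ y in Metric.ball x a, liminf (fun n => ‖(u (φ n) : Lp ℝ (ENNReal.ofReal p) μ) y
            - ((f : Lp ℝ (ENNReal.ofReal p) μ) y - c)‖ₑ ^ p) atTop ∂μ := by
            refine lintegral_congr_ae (ae_restrict_of_ae ?_)
            filter_upwards [hae] with y hy
            exact (((hy.sub_const _).enorm).ennrpow_const p).liminf_eq.symm
        _ ≤ liminf (fun n => ∫⁻ y in Metric.ball x a, ‖(u (φ n) : Lp ℝ (ENNReal.ofReal p) μ) y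
            - ((f : Lp ℝ (ENNReal.ofReal p) μ) y - c)‖ₑ ^ p ∂μ) atTop :=
            lintegral_liminf_le' fun n => hmeas _
        _ ≤ liminf (fun n => B * (ENNReal.ofReal (1 / ((φ n : ℝ) + 1)) * D.Γ f univ)) atTop :=
            liminf_le_liminf (Eventually.of_forall fun n => hu4 (φ n))
        _ = 0 := by
            have h1 : Tendsto (fun n : ℕ => 1 / ((φ n : ℝ) + 1)) atTop (𝓝 0) :=
              tendsto_one_div_add_atTop_nhds_zero_nat.comp hφ.tendsto_atTop
            have h2 := ENNReal.tendsto_ofReal h1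
            rw [ENNReal.ofReal_zero] at h2
            have h3 := ENNReal.Tendsto.const_mul (a := (B : ℝ≥0∞))
              (ENNReal.Tendsto.mul_const (b := D.Γ f univ) h2 (Or.inr (D.Γ_ne_top f univ)))
              (Or.inr ENNReal.coe_ne_top)
            rw [zero_mul, mul_zero] at h3
            exact h3.liminf_eq
    rw [lintegral_eq_zero_iff' (hmeas g), EventuallyEq,
      ae_restrict_iff' Metric.isOpen_ball.measurableSet] at hz
    filter_upwards [hz] with y hy hyb
    have h1 := hy hyb
    simp only [Pi.zero_apply, ENNReal.rpow_eq_zero_iff, hp0, and_true, enorm_eq_zero, enorm_ne_top,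
      false_and, or_false] at h1
    linarith
  · filter_upwards [hae, ae_all_iff.2 hu1] with y h1 h2 hy
    simp only [h2 _ hy] at h1
    exact tendsto_nhds_unique h1 tendsto_const_nhds
  · refine hE.trans ?_
    refine (liminf_le_liminf (Eventually.of_forall fun n => hu2 (φ n))).trans_eq ?_
    simp

end Blend

end PDirichletStructure

/-- When `5/2 r` exceeds `2 diam X`, the radius `2 diam X` serves instead, because its ball is
already the whole space. -/
theorem AdmissibleRadius.exists_enlarged {X : Type*} [MetricSpace X] {r : ℝ}
    (hr : AdmissibleRadius X r) (x : X) : ∃ R : ℝ, AdmissibleRadius X R ∧ r ≤ R ∧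
      R ≤ 5 / 2 * r ∧ Metric.ball x (5 / 2 * r) ⊆ Metric.ball x R := by
  have hr0 : 0 < r := hr.1
  by_cases h : ENNReal.ofReal (5 / 2 * r) ≤ 2 * Metric.ediam (univ : Set X)
  · exact ⟨5 / 2 * r, ⟨by positivity, h⟩, by linarith, le_rfl, subset_rfl⟩
  · push Not at h
    have htop : Metric.ediam (univ : Set X) ≠ ∞ := by
      rintro h'
      rw [h'] at h
      simp at h
    set d := (Metric.ediam (univ : Set X)).toReal with hd
    have hd2 : 2 * Metric.ediam (univ : Set X) = ENNReal.ofReal (2 * d) := by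
      rw [ENNReal.ofReal_mul (by norm_num), hd, ENNReal.ofReal_toReal htop]; norm_num
    have h1 : r ≤ 2 * d := by
      have := hr.2
      rwa [hd2, ENNReal.ofReal_le_ofReal_iff (by positivity)] at this
    have h2 : 2 * d ≤ 5 / 2 * r := by
      rw [hd2] at h
      exact ((ENNReal.ofReal_lt_ofReal_iff (by positivity)).1 h).le
    refine ⟨2 * d, ⟨by linarith, hd2.ge⟩, h1, h2, fun y _ => ?_⟩
    have h3 : dist y x ≤ d := by
      rw [dist_edist]
      exact ENNReal.toReal_mono htop (Metric.edist_le_ediam_of_mem (mem_univ _) (mem_univ _))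
    exact Metric.mem_ball.2 (by linarith)

namespace PDirichletStructure

variable {X : Type*} [MetricSpace X] [MeasurableSpace X] [BorelSpace X] {μ : Measure X} {p : ℝ}

/-! ### The cutoff Sobolev inequality. -/

section CutoffSobolev

variable (D : PDirichletStructure X μ p) [Fact (1 ≤ ENNReal.ofReal p)]

/-- The mean over `B(x, r)` is exchanged for the mean over the enlarged ball at the cost of
doubling; Poincaré there yields a factor `Ψ x R`, which is comparable to the `Ψ x (r/4)` in the
denominator. -/
theorem exists_localEnergy_le (hp : 1 ≤ p) (hμ : IsDoublingMeasure μ) {Ψ : X → ℝ → ℝ}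
    (hΨ : IsRegularScale Ψ) {C Λ : ℝ} (hΛ : 1 ≤ Λ) (hPI : D.PoincareBound Ψ C Λ) :
    ∃ B : ℝ≥0, ∀ (x : X) (r : ℝ), AdmissibleRadius X r → ∀ f : D.dom,
      D.localEnergy f (⨍ z in Metric.ball x r, (f : Lp ℝ (ENNReal.ofReal p) μ) z ∂μ)
        (Ψ x (r / 4)) (Metric.ball x (5 / 2 * r)) ≤ B * D.Γ f (Metric.ball x (3 * Λ * r)) := by
  obtain ⟨Cd, hCd⟩ := hμ.exists_measure_ball_le (5 / 2)
  obtain ⟨Cs, hCs, hscale⟩ := hΨ.exists_le_mul 10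
  refine ⟨1 + Real.toNNReal (2 ^ (p - 1)) * (1 + Cd) * (Real.toNNReal C * Real.toNNReal Cs),
    fun x r hr f => ?_⟩
  have hr0 : 0 < r := hr.1
  have h2p : (2 : ℝ≥0∞) ^ (p - 1) = ((Real.toNNReal (2 ^ (p - 1)) : ℝ≥0) : ℝ≥0∞) := by
    rw [← ENNReal.ofReal, ← ENNReal.ofReal_rpow_of_pos (by norm_num)]; norm_num
  have h2top : (2 : ℝ≥0∞) ^ (p - 1) ≠ ∞ := by rw [h2p]; exact ENNReal.coe_ne_top
  obtain ⟨R, hR, hrR, hR52, hsub⟩ := hr.exists_enlarged x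
  set c := ⨍ z in Metric.ball x r, (f : Lp ℝ (ENNReal.ofReal p) μ) z ∂μ with hc
  set b := ⨍ z in Metric.ball x R, (f : Lp ℝ (ENNReal.ofReal p) μ) z ∂μ with hb
  set I := ∫⁻ y in Metric.ball x R, ‖(f : Lp ℝ (ENNReal.ofReal p) μ) y - b‖ₑ ^ p ∂μ with hI
  have hcb : ‖c - b‖ₑ ^ p * μ (Metric.ball x R) ≤ Cd * I := by
    have h1 := enorm_average_sub_rpow_mul_le hp (hμ.measure_ball_pos x hr0).ne'
      (hμ.measure_ball_lt_top x r).ne (Lp.integrableOn_of_measure_ne_top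
        (f : Lp ℝ (ENNReal.ofReal p) μ) (hμ.measure_ball_lt_top x r).ne) b
    calc _ ≤ ‖c - b‖ₑ ^ p * (Cd * μ (Metric.ball x r)) := by
          gcongr
          exact hCd x x r R hr0 hR52 (by rw [dist_self]; positivity)
      _ = Cd * (‖c - b‖ₑ ^ p * μ (Metric.ball x r)) := by ring
      _ ≤ Cd * I := by
          gcongr
          exact h1.trans (lintegral_mono_set (Metric.ball_subset_ball hrR))
  have hint : ∫⁻ y in Metric.ball x (5 / 2 * r),
      ‖(f : Lp ℝ (ENNReal.ofReal p) μ) y - c‖ₑ ^ p ∂μ ≤ 2 ^ (p - 1) * (1 + Cd) * I := by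
    calc _ ≤ ∫⁻ y in Metric.ball x R, ‖(f : Lp ℝ (ENNReal.ofReal p) μ) y - c‖ₑ ^ p ∂μ :=
          lintegral_mono_set hsub
      _ ≤ ∫⁻ y in Metric.ball x R, 2 ^ (p - 1) *
          (‖(f : Lp ℝ (ENNReal.ofReal p) μ) y - b‖ₑ ^ p + ‖c - b‖ₑ ^ p) ∂μ := by
          refine lintegral_mono fun y => ?_
          have := enorm_sub_rpow_le hp ((f : Lp ℝ (ENNReal.ofReal p) μ) y - b) (c - b)
          rwa [sub_sub_sub_cancel_right] at this
      _ = 2 ^ (p - 1) * (I + ‖c - b‖ₑ ^ p * μ (Metric.ball x R)) := by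
          rw [lintegral_const_mul' _ _ h2top, lintegral_add_right _ measurable_const]
          simp [hI]
      _ ≤ 2 ^ (p - 1) * (I + Cd * I) := by gcongr
      _ = _ := by ring
  have hΨr := hΨ.2.1 x (r / 4) (by positivity)
  have hΨ0 : ENNReal.ofReal (Ψ x (r / 4)) ≠ 0 := by simpa using hΨr
  have hball : D.Γ f (Metric.ball x (Λ * R)) ≤ D.Γ f (Metric.ball x (3 * Λ * r)) := by
    refine measure_mono (Metric.ball_subset_ball ?_)
    nlinarith
  have hPI' : I ≤ ENNReal.ofReal C * (ENNReal.ofReal Cs * ENNReal.ofReal (Ψ x (r / 4)))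
      * D.Γ f (Metric.ball x (3 * Λ * r)) := by
    refine (hPI x R hR f).trans ?_
    gcongr
    rw [← ENNReal.ofReal_mul hCs.le]
    refine ENNReal.ofReal_le_ofReal (hscale x x (r / 4) R (by positivity) (by linarith) hR
      (by linarith) (by rw [dist_self]; positivity))
  rw [localEnergy]
  calc _ ≤ D.Γ f (Metric.ball x (3 * Λ * r)) + (ENNReal.ofReal (Ψ x (r / 4)))⁻¹ *
        (2 ^ (p - 1) * (1 + Cd) * (ENNReal.ofReal C *
          (ENNReal.ofReal Cs * ENNReal.ofReal (Ψ x (r / 4)))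
          * D.Γ f (Metric.ball x (3 * Λ * r)))) := by
        refine add_le_add (measure_mono (Metric.ball_subset_ball (by nlinarith))) ?_
        gcongr
        refine hint.trans ?_
        gcongr
    _ = D.Γ f (Metric.ball x (3 * Λ * r)) + 2 ^ (p - 1) * (1 + Cd) * (ENNReal.ofReal C *
          ENNReal.ofReal Cs) * D.Γ f (Metric.ball x (3 * Λ * r)) *
          ((ENNReal.ofReal (Ψ x (r / 4)))⁻¹ * ENNReal.ofReal (Ψ x (r / 4))) := by ring
    _ = _ := by
        rw [ENNReal.inv_mul_cancel hΨ0 ENNReal.ofReal_ne_top, mul_one, h2p]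
        simp only [ENNReal.ofReal]
        push_cast
        ring

/-- Capacity minimizers satisfy the cutoff Sobolev inequality. -/
theorem exists_cutoffInequality [IsFiniteMeasureOnCompacts μ] (hp : 1 ≤ p)
    (hμ : IsDoublingMeasure μ) {Ψ : X → ℝ → ℝ} (hΨ : IsRegularScale Ψ)
    (hCap : D.CapUpperBound Ψ) {C Λ : ℝ} (hΛ : 1 ≤ Λ) (hPI : D.PoincareBound Ψ C Λ) :
    ∃ B Λ' : ℝ, 1 ≤ B ∧ 1 ≤ Λ' ∧ ∀ (x : X) (r : ℝ), AdmissibleRadius X r → ∀ ψ : D.dom,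
      D.IsCapacityMinimizer x r ψ → D.CutoffInequality B Λ' x r ψ := by
  obtain ⟨B₁, hblend⟩ := D.exists_blend hp hμ hΨ hCap hΛ hPI
  obtain ⟨B₂, hlocal⟩ := D.exists_localEnergy_le hp hμ hΨ hΛ hPI
  set B : ℝ≥0 := Real.toNNReal (4 ^ p) * ((1 + Real.toNNReal (2 ^ (p - 1)) * 2) * (B₁ * B₂))
    with hB
  refine ⟨max 1 B, 3 * Λ, le_max_left _ _, by linarith, fun x r hr ψ hψ f F hF => ?_⟩
  have hr0 : 0 < r := hr.1
  have h2p : (2 : ℝ≥0∞) ^ (p - 1) = ((Real.toNNReal (2 ^ (p - 1)) : ℝ≥0) : ℝ≥0∞) := by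
    rw [← ENNReal.ofReal, ← ENNReal.ofReal_rpow_of_pos (by norm_num)]; norm_num
  have h4p : (4 : ℝ≥0∞) ^ p = ((Real.toNNReal (4 ^ p) : ℝ≥0) : ℝ≥0∞) := by
    rw [← ENNReal.ofReal, ← ENNReal.ofReal_rpow_of_pos (by norm_num)]; norm_num
  set c := ⨍ z in Metric.ball x r, (f : Lp ℝ (ENNReal.ofReal p) μ) z ∂μ with hc
  have hρ : AdmissibleRadius X (r / 4) := hr.mono (by positivity) (by linarith)
  have hE : ∀ g : D.dom, D.Γ g univ
      ≤ B₁ * D.localEnergy f c (Ψ x (r / 4)) (Metric.ball x (10 * (r / 4))) →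
      D.Γ g univ ≤ B₁ * B₂ * D.Γ f (Metric.ball x (3 * Λ * r)) := fun g hg => by
    rw [mul_assoc]
    refine hg.trans ?_
    rw [show 10 * (r / 4) = 5 / 2 * r by ring]
    exact mul_le_mul_right (hlocal x r hr f) _
  -- With `ρ = r/4` this blend vanishes outside `B(x, 7/4 r)`, hence outside `2B`.
  obtain ⟨g₁, h₁, h₁', hE₁⟩ := hblend x (r / 4) (3 / 2 * r) hρ (by linarith) (by linarith) f c
  -- Near the boundary of `2B` no blend vanishing outside `2B` is available. The difference `g₂ -
  -- g₃` vanishes on `B` instead, and equals `f - c` on `S`, because `g₃` vanishes outside `B(x, 5/4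
  -- r)`.
  obtain ⟨g₂, h₂, -, hE₂⟩ := hblend x (r / 4) (2 * r) hρ (by linarith) (by linarith) f c
  obtain ⟨g₃, h₃, h₃', hE₃⟩ := hblend x (r / 4) r hρ (by linarith) (by linarith) f c
  set Q := (B₁ : ℝ≥0∞) * B₂ * D.Γ f (Metric.ball x (3 * Λ * r)) with hQ
  set S : Set X := Metric.ball x (2 * r) ∩ (Metric.closedBall x (5 / 4 * r))ᶜ with hS
  have hSo : IsOpen S := Metric.isOpen_ball.inter Metric.isClosed_closedBall.isOpen_compl
  have hI₁ : ∫⁻ y in Metric.ball x (3 / 2 * r), (F y - (c : EReal)).abs ^ p ∂(D.Γ ψ)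
      ≤ 4 ^ p * Q := by
    refine (D.setLIntegral_minimizer_le hp hψ (g := g₁) (Or.inl ?_) hF c Metric.isOpen_ball
      h₁).trans ?_
    · filter_upwards [h₁'] with y hy hyb
      exact hy fun h => hyb (Metric.ball_subset_ball (by linarith) h)
    · gcongr
      exact hE g₁ hE₁
  have hI₂ : ∫⁻ y in S, (F y - (c : EReal)).abs ^ p ∂(D.Γ ψ)
      ≤ 4 ^ p * (2 ^ (p - 1) * (Q + Q)) := by
    refine (D.setLIntegral_minimizer_le hp hψ (g := g₂ - g₃) (Or.inr ?_) hF c hSo ?_).trans ?_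
    · filter_upwards [D.coeFn_sub g₂ g₃, h₂, h₃] with y h4 h5 h6 hy
      rw [h4, h5 (Metric.ball_subset_ball (by linarith) hy), h6 hy, sub_self]
    · filter_upwards [D.coeFn_sub g₂ g₃, h₂, h₃'] with y h4 h5 h6 hy
      rw [h4, h5 hy.1, h6, sub_zero]
      intro h7
      refine hy.2 (Metric.ball_subset_closedBall (Metric.ball_subset_ball (by linarith) h7))
    · gcongr
      refine (D.Γ_sub_le hp _ _ MeasurableSet.univ).trans ?_
      gcongr
      · exact hE g₂ hE₂
      · exact hE g₃ hE₃
  have hcover : Metric.ball x (2 * r) ⊆ Metric.ball x (3 / 2 * r) ∪ S := fun y hy => by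
    by_cases h : y ∈ Metric.closedBall x (5 / 4 * r)
    · exact Or.inl (Metric.closedBall_subset_ball (by linarith) h)
    · exact Or.inr ⟨hy, h⟩
  calc _ ≤ ∫⁻ y in Metric.ball x (3 / 2 * r) ∪ S, (F y - (c : EReal)).abs ^ p ∂(D.Γ ψ) :=
        lintegral_mono_set hcover
    _ ≤ _ := lintegral_union_le _ _ _
    _ ≤ 4 ^ p * Q + 4 ^ p * (2 ^ (p - 1) * (Q + Q)) := add_le_add hI₁ hI₂
    _ = B * D.Γ f (Metric.ball x (3 * Λ * r)) := by
        rw [hB, hQ, h2p, h4p]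
        push_cast
        ring
    _ ≤ _ := by
        gcongr
        rw [← ENNReal.ofReal_coe_nnreal]
        exact ENNReal.ofReal_le_ofReal (le_max_right _ _)

end CutoffSobolev

end PDirichletStructure

end

theorem mainTheorem1 {X : Type*} [MetricSpace X] [CompleteSpace X] [LocallyCompactSpace X]
    [TopologicalSpace.SeparableSpace X] [MeasurableSpace X] [BorelSpace X]
    (μ : Measure X) [μ.Regular] (hμ : IsDoublingMeasure μ)
    (p : ℝ) (hp : 1 < p) (D : PDirichletStructure X μ p)
    (Ψ : X → ℝ → ℝ) (hΨ : IsRegularScale Ψ)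
    (hCap : D.CapUpperBound Ψ) (hPI : D.Poincare Ψ) :
    D.CutoffSobolev ∧
    ∃ C Λ : ℝ, 1 ≤ C ∧ 1 ≤ Λ ∧ ∀ (x : X) (r : ℝ), AdmissibleRadius X r →
      (∃ ψ : D.dom, D.IsCapacityMinimizer x r ψ) ∧
      ∀ ψ : D.dom, D.IsCapacityMinimizer x r ψ → D.CutoffInequality C Λ x r ψ := by
  have : Fact (1 ≤ ENNReal.ofReal p) := ⟨by simpa using ENNReal.ofReal_le_ofReal hp.le⟩
  obtain ⟨C₀, Λ₀, -, hΛ₀, hPI'⟩ := hPI.exists_bound (by linarith) hμ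
  obtain ⟨C, Λ, hC, hΛ, hmin⟩ := D.exists_cutoffInequality hp.le hμ hΨ hCap hΛ₀ hPI'
  have hex : ∀ (x : X) (r : ℝ), AdmissibleRadius X r → ∃ ψ : D.dom, D.IsCapacityMinimizer x r ψ :=
    fun x r hr => D.exists_isCapacityMinimizer hp.le hμ hΨ hΛ₀ hPI' hCap hr
  refine ⟨⟨C, Λ, hC, hΛ, fun x r hr => ?_⟩, C, Λ, hC, hΛ, fun x r hr => ⟨hex x r hr, hmin x r hr⟩⟩
  obtain ⟨ψ, hψ⟩ := hex x r hr
  exact ⟨ψ, hψ.1, hmin x r hr ψ hψ⟩
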